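/- **Supersymmetric LLT Cauchy identity.** Let $K$ be a field of characteristic $0$, let $n\ge 1$, let $q\in K$ with $q\neq 0$, and put $v=q^2$. Let $g:\mathbb Z/n\to K$ satisfy $g(0)=-v$ and $g(a)g(-a)=v$ for $a\ne 0$, and put $\hat g(a)=g(-a)$. Let $\mathcal F_g$ be the metaplectic Fock space of $g$: the space spanned by the semi-infinite wedges $u_{m_1}\wedge u_{m_2}\wedge\cdots$ ($m_i\in\mathbb Z$, $m_i=c-i$ for some $c\in\mathbb Z$ and all large $i$) modulo the relations, for adjacent factors and $l\le m$, $$u_l\wedge u_m=-u_m\wedge u_l\qquad(l\equiv m \bmod n),$$ $$u_l\wedge u_m=g(l-m)\,u_m\wedge u_l+(v-1)\big(u_{m-i}\wedge u_{l+i}+g(l-m)\,u_{m-n}\wedge u_{l+n}+v\,u_{m-n-i}\wedge u_{l+n+i}+v\,g(l-m)\,u_{m-2n}\wedge u_{l+2n}+\cdots\big)\qquad(l\not\equiv m \bmod n),$$ where $0<i<n$, $i\equiv m-l \bmod n$, and the sum continues as long as its wedges are normally ordered. The normally ordered wedges ($m_1>m_2>\cdots$) form a basis of $\mathcal F_g$.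 For $k\neq 0$ the current operator $J_k$ sends a normally ordered wedge to the sum over $i\ge 1$ of the wedges obtained from it by replacing $m_i$ by $m_i-kn$. Fix $c\in\mathbb Z$; for a partition $\lambda$ (padded with zeros) let $|\lambda+\rho\rangle$ be the wedge with $m_i=\lambda_i+c-i$ (for $c=\ell\ge\ell(\lambda)$ this is $u_{\lambda_1+\ell-1}\wedge\cdots\wedge u_{\lambda_\ell}\wedge u_{-1}\wedge u_{-2}\wedge\cdots$), and let $\langle\mu+\rho|$ be the corresponding coordinate function. With $L_+(x)=\sum_{k\ge1}\sum_j\frac1k x_j^kJ_k$ and $x^n=(x_1^n,x_2^n,\dots)$ set $$\mathcal G^{g}_{\lambda/\mu}[x|y]=\langle\mu+\rho|\,e^{L_+(x^n)-L_+(y^n)}\,|\lambda+\rho\rangle .$$ For $g(a)=-q$ ($a\ne0$), the usual $q$-Fock space, this is the supersymmetric LLT polynomial $\mathcal G_{\lambda/\mu}[x|y]$. Let $x=(x_1,\dots,x_N)$, $y=(y_1,\dots,y_N)$, $z=(z_1,\dots,z_M)$, $w=(w_1,\dots,w_M)$ be indeterminates, and let $$\Omega(x|y;z|w)=\prod_{t=0}^{n-1}\prod_{i=1}^{N}\prod_{j=1}^{M}\frac{(1-v^tx_i^nw_j^n)(1-v^ty_i^nz_j^n)}{(1-v^tx_i^nz_j^n)(1-v^ty_i^nw_j^n)}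 .$$ Then for all partitions $\lambda,\mu$, in the ring of formal power series in $x,y,z,w$ over $K$, $$\Omega(x|y;z|w)\sum_\nu\mathcal G^{g}_{\lambda/\nu}[x|y]\,\mathcal G^{\hat g}_{\mu/\nu}[z|w]=\sum_\nu\mathcal G^{g}_{\nu/\mu}[x|y]\,\mathcal G^{\hat g}_{\nu/\lambda}[z|w],$$ where both sums run over all partitions $\nu$ and converge coefficientwise (each monomial occurs in only finitely many terms). In particular, whenever $\hat g=g$, and so for the supersymmetric LLT polynomials themselves, where $g(a)=-q$ for $a\neq 0$, $$\Omega(x|y;z|w)\sum_\nu\mathcal G_{\lambda/\nu}[x|y]\,\mathcal G_{\mu/\nu}[z|w]=\sum_\nu\mathcal G_{\nu/\mu}[x|y]\,\mathcal G_{\nu/\lambda}[z|w].$$ -/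

import Mathlib

open scoped MvPowerSeries.WithPiTopology

namespace LLT

/-- A shift-invariant Drinfeld twist of `q`-Fock space (for `U_q(\widehat{sl}_n)`), recorded by its
function `g` on charges: `g (i - j) = -q α_{ij}` for `i ≢ j mod n`, where `α_{ij} α_{ji} = 1`,
and `g 0 = -q ^ 2`. -/
structure Twist {K : Type*} [Field K] (n : ℕ) (q : K) where
  g : ZMod n → K
  g_zero : g 0 = -q ^ 2
  g_mul_neg : ∀ a : ZMod n, a ≠ 0 → g a * g (-a) = q ^ 2

section Fock

variable {K : Type*} [Field K] {n : ℕ} {q : K}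

/-- The untwisted `q`-Fock space, `α_{ij} = 1`. -/
def Twist.untwisted (n : ℕ) (q : K) : Twist n q where
  g a := if a = 0 then -q ^ 2 else -q
  g_zero := by simp
  g_mul_neg a ha := by simp [ha, sq]

/-- The opposite twist, which replaces `α_{ij}` by `α_{ji} = α_{ij}⁻¹`. -/
def Twist.dual (g : Twist n q) : Twist n q where
  g a := g.g (-a)
  g_zero := by simpa using g.g_zero
  g_mul_neg a ha := g.g_mul_neg (-a) (neg_ne_zero.mpr ha)

theorem Twist.dual_eq_self (g : Twist n q) (h : ∀ a, g.g (-a) = g.g a) : g.dual = g := by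
  cases g
  simp only [Twist.dual, Twist.mk.injEq]
  exact funext h

theorem Twist.dual_untwisted : (Twist.untwisted n q).dual = Twist.untwisted n q :=
  Twist.dual_eq_self _ (by simp [Twist.untwisted])

/-- Index sequences `m₁, m₂, …` of semi-infinite wedges `u_{m₁} ∧ u_{m₂} ∧ ⋯`: sequences of integers
which eventually decrease by one at each step. -/
def SemiInf : Type :=
  {m : ℕ → ℤ // ∃ c : ℤ, ∀ᶠ i : ℕ in Filter.atTop, m i = c - i}

/-- Replace the entry at position `i`. -/
def SemiInf.set (m : SemiInf) (i : ℕ) (a : ℤ) : SemiInf :=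
  ⟨Function.update m.1 i a, by
    obtain ⟨c, hc⟩ := m.2
    refine ⟨c, ?_⟩
    filter_upwards [hc, Filter.eventually_gt_atTop i] with j hj hij
    rw [Function.update_of_ne (by omega), hj]⟩

/-- Index sequences of normally ordered wedges, `m₁ > m₂ > ⋯`. -/
def NormOrd : Type := {m : SemiInf // StrictAnti m.1}

/-- The right-hand side of the normal ordering relation for `u_l ∧ u_m`, `l ≤ m`, as a combination
of pairs `(a, b)` standing for `u_a ∧ u_b`. If `l ≡ m mod n` it is `- u_m ∧ u_l`. Otherwise, with
`0 < i < n` and `i ≡ m - l mod n`, it is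
`g(l-m) u_m ∧ u_l + (q²-1) (u_{m-i} ∧ u_{l+i} + g(l-m) u_{m-n} ∧ u_{l+n}
  + q² u_{m-n-i} ∧ u_{l+n+i} + q² g(l-m) u_{m-2n} ∧ u_{l+2n} + ⋯)`,
where the sum continues as long as the wedges are normally ordered (all the later terms fail the
test `b < a`, and there are fewer than `m - l` groups of terms). -/
noncomputable def orderPair (g : Twist n q) (l m : ℤ) : (ℤ × ℤ) →₀ K :=
  if ((l - m : ℤ) : ZMod n) = 0 then -Finsupp.single (m, l) 1
  else
    Finsupp.single (m, l) (g.g ((l - m : ℤ) : ZMod n)) +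
      (q ^ 2 - 1) • ∑ t ∈ Finset.range (m - l).toNat, (q ^ 2) ^ t •
        ((if l + t * n + (m - l) % n < m - t * n - (m - l) % n then
            Finsupp.single (m - t * n - (m - l) % n, l + t * n + (m - l) % n) 1 else 0) +
          (if l + (t + 1) * n < m - (t + 1) * n then
            Finsupp.single (m - (t + 1) * n, l + (t + 1) * n)
              (g.g ((l - m : ℤ) : ZMod n)) else 0))

/-- The span of the normal ordering relations, applied to adjacent factors of semi-infinite
wedges. -/
noncomputable def relations (g : Twist n q) : Submodule K (SemiInf →₀ K) :=
  Submodule.span K {r | ∃ (m : SemiInf) (i : ℕ), m.1 i ≤ m.1 (i + 1) ∧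
    r = Finsupp.single m 1 -
      (orderPair g (m.1 i) (m.1 (i + 1))).mapDomain fun p => (m.set i p.1).set (i + 1) p.2}

/-- The metaplectic Fock space: semi-infinite wedges modulo the normal ordering relations. -/
abbrev Fock (g : Twist n q) : Type _ := (SemiInf →₀ K) ⧸ relations g

/-- The semi-infinite wedge `u_{m₁} ∧ u_{m₂} ∧ ⋯`. -/
noncomputable def wedge (g : Twist n q) (m : SemiInf) : Fock g :=
  (relations g).mkQ (Finsupp.single m 1)

/-- The coordinates of a vector of Fock space in its basis of normally ordered wedges, that is, the
inverse of the map which sends a family of coefficients to the corresponding linear combination of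
normally ordered wedges. -/
noncomputable def coords (g : Twist n q) : Fock g → (NormOrd →₀ K) :=
  Function.invFun (Finsupp.linearCombination K fun m : NormOrd => wedge g m.1)

/-- `J_k · (u_{m₁} ∧ u_{m₂} ∧ ⋯)`, the sum over `i` of the wedges in which `m_i` is replaced by
`m_i - k n`; for `k ≠ 0` only finitely many of these are non-zero. -/
noncomputable def currentWedge (g : Twist n q) (k : ℤ) (m : NormOrd) : Fock g :=
  ∑ᶠ i : ℕ, wedge g (m.1.set i (m.1.1 i - k * n))

/-- The current operator `J_k`, written in the basis of normally ordered wedges, after extension of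
scalars to a commutative `K`-algebra `R`. -/
noncomputable def current (R : Type*) [CommRing R] [Algebra K R] (g : Twist n q) (k : ℤ) :
    (NormOrd →₀ R) →ₗ[R] (NormOrd →₀ R) :=
  Finsupp.linearCombination R fun m : NormOrd =>
    (coords g (currentWedge g k m)).mapRange (algebraMap K R) (map_zero _)

/-- The operator `∑_{k ≥ 1} s_k J_k`; on each vector only finitely many terms are non-zero. -/
noncomputable def hamiltonian {R : Type*} [CommRing R] [Algebra K R] (g : Twist n q) (s : ℕ+ → R)
    (v : NormOrd →₀ R) : NormOrd →₀ R :=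
  ∑ᶠ k : ℕ+, s k • current R g (k : ℤ) v

/-- The operator `exp (∑_{k ≥ 1} s_k J_k)`; on each vector only finitely many terms of the
exponential series are non-zero. -/
noncomputable def expHamiltonian {R : Type*} [CommRing R] [Algebra K R] (g : Twist n q)
    (s : ℕ+ → R) (v : NormOrd →₀ R) : NormOrd →₀ R :=
  ∑ᶠ j : ℕ, algebraMap K R ((j.factorial : K)⁻¹) • (hamiltonian g s)^[j] v

/-- The index sequence of `|lam + ρ⟩`, where `lam` is padded to length `c`: the `i`-th entry,
`i = 1, 2, …`, is `lam_i + c - i`. For `c = ℓ ≥ ℓ(lam)` this is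
`u_{lam_1 + ℓ - 1} ∧ ⋯ ∧ u_{lam_ℓ} ∧ u_{-1} ∧ u_{-2} ∧ ⋯`. -/
def ket (c : ℤ) (lam : YoungDiagram) : NormOrd :=
  ⟨⟨fun i => lam.rowLen i + c - (i + 1), by
    refine ⟨c - 1, ?_⟩
    filter_upwards [Filter.eventually_ge_atTop (lam.colLen 0)] with i hi
    have h : lam.rowLen i = 0 := by
      by_contra h0
      have h1 : (i, 0) ∈ lam := YoungDiagram.mem_iff_lt_rowLen.mpr (Nat.pos_of_ne_zero h0)
      have h2 := YoungDiagram.mem_iff_lt_colLen.mp h1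
      omega
    rw [h]
    push_cast
    ring⟩, by
    intro i j hij
    have h := lam.rowLen_anti i j hij.le
    show (lam.rowLen j : ℤ) + c - (j + 1) < lam.rowLen i + c - (i + 1)
    omega⟩

/-- The supersymmetric LLT polynomial
`𝒢_{lam/mu}[x|y] = ⟨mu + ρ| exp (L₊(xⁿ) - L₊(yⁿ)) |lam + ρ⟩`, with
`L₊(x) = ∑_{k ≥ 1} ∑_j (1/k) x_j^k J_k`, evaluated at elements `x_j`, `y_j` of a commutative
`K`-algebra. -/
noncomputable def superLLT {R : Type*} [CommRing R] [Algebra K R] (g : Twist n q) (c : ℤ)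
    (lam mu : YoungDiagram) {N : ℕ} (x y : Fin N → R) : R :=
  expHamiltonian g
    (fun k : ℕ+ => algebraMap K R ((k : K)⁻¹) *
      (∑ j, (x j ^ n) ^ (k : ℕ) - ∑ j, (y j ^ n) ^ (k : ℕ)))
    (Finsupp.single (ket c lam) 1) (ket c mu)

/-- `Ω(x|y; z|w) = ∏_{t < n} ∏_{i,j} (1 - vᵗ x_iⁿ w_jⁿ) (1 - vᵗ y_iⁿ z_jⁿ) /
((1 - vᵗ x_iⁿ z_jⁿ) (1 - vᵗ y_iⁿ w_jⁿ))`, for `v = q ^ 2`. -/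
noncomputable def Omega {σ : Type*} (n : ℕ) (q : K) {N M : ℕ}
    (x y : Fin N → MvPowerSeries σ K) (z w : Fin M → MvPowerSeries σ K) : MvPowerSeries σ K :=
  ∏ t ∈ Finset.range n, ∏ i : Fin N, ∏ j : Fin M,
    ((1 - (q ^ 2) ^ t • (x i ^ n * w j ^ n)) * (1 - (q ^ 2) ^ t • (y i ^ n * z j ^ n))) *
      ((1 - (q ^ 2) ^ t • (x i ^ n * z j ^ n)) * (1 - (q ^ 2) ^ t • (y i ^ n * w j ^ n)))⁻¹

end Fock

end LLT

/-! Write v = q². Let L₊ be the exponent in x, y built from the J_k, and L₋ the same expression in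
z, w built from the J_{-k}. If the transpose of J_k for ĝ is J_{-k} for g, the sum on the left is
⟨μ| e^{L₋} e^{L₊} |λ⟩ and the sum on the right is ⟨μ| e^{L₊} e^{L₋} |λ⟩. If moreover the J_k form a
Heisenberg algebra with [J_k, J_{-k}] = k (1 + v^k + ⋯ + v^{(n-1)k}), exchanging the exponentials
costs the scalar exp ∑_k (1/k) (∑_t v^{tk}) (p_k(xⁿ) - p_k(yⁿ)) (p_k(zⁿ) - p_k(wⁿ)), which is Ω. The
real content is therefore the Heisenberg relations, the transposition, and the fact that normally
ordered wedges are a basis of a space given only by generators and relations.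

All of this is obtained from a model on the span of Maya diagrams. Let x_e (`lowerOp`) move a
particle from e to e - n, with a factor g for each particle that it passes, and let y_e (`raiseOp`)
move it back. Two x's commute if far apart and commute up to v if near. Let E_r (`lowerAll`) be the
sum of all ordered products of r different x's, and F_r (`raiseAll`) its analogue for the y's.
Telescoping sums of local identities show that E_1 commutes with every E_r (`lowerSum_comm`) and
that [E_1, F_{r+1}] = (1 + v + ⋯ + v^{n-1}) F_r (`lowerElem_raiseElem`).

Wedging with u_m becomes an operator ψ_m (`wedgeOp`): for m above all particles it adds a particle,
and ψ_{m-n} = [E_1, ψ_m] defines it for the other m. The E_r and F_r then act on products by E_{r+1}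
ψ_m = ψ_m E_{r+1} + ψ_{m-n} E_r and its mirror image (`lowerAll_wedgeOp`, `raiseAll_wedgeOp`). The
exchange relation of ψ_l and ψ_m is visible for neighbouring indices above all particles, and
commuting with E_1 and E_2 carries it to all indices (`exchange_eq_zero`); this gives the normal
ordering relations (`wedgeOp_orderPair`). So Fock space maps to the span of Maya diagrams, and a
normally ordered wedge goes to its own diagram. Hence these wedges are independent, and
straightening shows that they span.

Newton's identities turn the E_r and F_r into power sums, which act as derivations ψ_m ↦ ψ_{m∓kn};
up to sign the power sums of the E_r are the J_k of the statement (`fockMap_currentWedge`). An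
operator that commutes with all ψ_m and kills all vacua is zero (`eq_zero_of_commute`). Together
with the energy grading and transposition this gives the Heisenberg relations up to the value of the
central scalars. To find these, E_r F_r is evaluated on an n-core with widely separated runners: the
diagonal matrix element is the complete symmetric function h_r(1, v, …, v^{n-1})
(`raiseAll_separatedCore`, `curScalar_eq`).

Finally, everything is graded by the degree in x, y and the degree in z, w. In each bidegree only
finitely many ν contribute, so the infinite sums converge and the exchange of exponentials can be
checked degree by degree. -/

namespace LLT

/-! ### Maya diagrams. -/

/-- Maya diagrams: sets of integers that are bounded above and contain all small integers. -/
def Maya : Type :=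
  {A : Set ℤ // (∃ a, Set.Iio a ⊆ A) ∧ ∃ b, A ⊆ Set.Iio b}

namespace Maya

theorem ext' {A B : Maya} (h : ∀ x, x ∈ A.1 ↔ x ∈ B.1) : A = B :=
  Subtype.ext (Set.ext h)

/-- Move a particle from `s` to `t`. -/
def move (A : Maya) (s t : ℤ) : Maya :=
  ⟨insert t (A.1 \ {s}), by
    obtain ⟨⟨a, ha⟩, b, hb⟩ := A.2
    refine ⟨⟨min a s, fun x hx => ?_⟩, max b (t + 1), fun x hx => ?_⟩
    · simp only [Set.mem_Iio, lt_min_iff] at hx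
      exact Or.inr ⟨ha hx.1, hx.2.ne⟩
    · simp only [Set.mem_Iio, lt_max_iff]
      rcases hx with rfl | hx
      · right; omega
      · exact Or.inl (hb hx.1)⟩

theorem mem_move {A : Maya} {s t x : ℤ} : x ∈ (A.move s t).1 ↔ x = t ∨ (x ∈ A.1 ∧ x ≠ s) := by
  simp [move]

/-- The Maya diagram of the vacuum. -/
def sea (c : ℤ) : Maya := ⟨Set.Iio c, ⟨c, le_rfl⟩, c, le_rfl⟩

theorem mem_sea {c x : ℤ} : x ∈ (sea c).1 ↔ x < c := Iff.rfl

/-- Add a particle at `m`. -/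
def add (A : Maya) (m : ℤ) : Maya :=
  ⟨insert m A.1, by
    obtain ⟨⟨a, ha⟩, b, hb⟩ := A.2
    refine ⟨⟨a, fun x hx => Or.inr (ha hx)⟩, max b (m + 1), fun x hx => ?_⟩
    simp only [Set.mem_Iio, lt_max_iff]
    rcases hx with rfl | hx
    · right; omega
    · exact Or.inl (hb hx)⟩

theorem mem_add {A : Maya} {m x : ℤ} : x ∈ (A.add m).1 ↔ x = m ∨ x ∈ A.1 := by
  simp [add]

theorem add_comm (A : Maya) (l m : ℤ) : (A.add l).add m = (A.add m).add l :=
  ext' fun x => by simp only [mem_add]; tauto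

/-- All particles are below `b`, and there are no holes below `a`. -/
def Within (a b : ℤ) (A : Maya) : Prop :=
  (∀ x < a, x ∈ A.1) ∧ ∀ x ∈ A.1, x < b

theorem exists_within (A : Maya) : ∃ a b, A.Within a b := by
  obtain ⟨⟨a, ha⟩, b, hb⟩ := A.2
  exact ⟨a, b, fun x hx => ha hx, fun x hx => hb hx⟩

theorem Within.mono {A : Maya} {a b a' b' : ℤ} (h : A.Within a b) (ha : a' ≤ a) (hb : b ≤ b') :
    A.Within a' b' :=
  ⟨fun x hx => h.1 x (by omega), fun x hx => (h.2 x hx).trans_le hb⟩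

theorem sea_within (c : ℤ) : (sea c).Within c c := ⟨fun _ h => h, fun _ h => h⟩

theorem Within.add {A : Maya} {a b m : ℤ} (h : A.Within a b) (hm : b ≤ m) :
    (A.add m).Within a (m + 1) :=
  ⟨fun x hx => mem_add.mpr (Or.inr (h.1 x hx)), fun x hx => by
    rcases mem_add.mp hx with rfl | hx
    · omega
    · have := h.2 x hx; omega⟩

open Classical in
/-- Every Maya diagram is obtained from a vacuum by successively adding particles on top. -/
theorem induction_top {P : Maya → Prop} (h0 : ∀ c, P (sea c))
    (h1 : ∀ A m, (∀ x ∈ A.1, x < m) → P A → P (A.add m)) (A : Maya) : P A := by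
  obtain ⟨a, b, h⟩ := A.exists_within
  suffices H : ∀ (k : ℕ) (A : Maya), A.Within a (a + k) → P A from
    H (b - a).toNat A (h.mono le_rfl (by omega))
  intro k
  induction k with
  | zero =>
    intro A h
    have : A = sea a := ext' fun x => ⟨fun hx => by simpa [mem_sea] using h.2 x hx, fun hx => h.1 x hx⟩
    exact this ▸ h0 a
  | succ k ih =>
    intro A h
    by_cases hk : a + k ∈ A.1
    · let B : Maya := ⟨A.1 \ {a + k}, ⟨a, fun x hx => ⟨h.1 x hx, by
        simp only [Set.mem_Iio] at hx; simp only [Set.mem_singleton_iff]; omega⟩⟩,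
        a + (k + 1 : ℕ), fun x hx => h.2 x hx.1⟩
      have hB : B.Within a (a + k) := by
        refine ⟨fun x hx => ⟨h.1 x hx, ?_⟩, fun x hx => ?_⟩
        · simp only [Set.mem_singleton_iff]; omega
        · have h2 := h.2 x hx.1
          have h3 : x ≠ a + k := hx.2
          push_cast at h2
          omega
      have hA : A = B.add (a + k) := ext' fun x => by
        rw [mem_add]
        refine ⟨fun hx => ?_, ?_⟩
        · by_cases hxk : x = a + k
          · exact Or.inl hxk
          · exact Or.inr ⟨hx, hxk⟩
        · rintro (rfl | hx)
          · exact hk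
          · exact hx.1
      rw [hA]
      exact h1 B _ hB.2 (ih B hB)
    · refine ih A ⟨h.1, fun x hx => ?_⟩
      have h2 := h.2 x hx
      have h3 : x ≠ a + k := fun h => hk (h ▸ hx)
      push_cast at h2
      omega

end Maya

/-! ### Moving one particle, with a multiplicative weight for the particles it passes. -/

section Single

variable {K : Type*} [Field K]

theorem maya_end_ext {f g : Module.End K (Maya →₀ K)}
    (h : ∀ A, f (Finsupp.single A 1) = g (Finsupp.single A 1)) : f = g :=
  Finsupp.lhom_ext' fun A => LinearMap.ext_ring (h A)

open Classical in
/-- The product of the factors `h b` over the particles `b` in `I`. -/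
noncomputable def passWeight (h : ℤ → K) (I : Finset ℤ) (A : Maya) : K :=
  ∏ b ∈ I, if b ∈ A.1 then h b else 1

theorem passWeight_congr {h : ℤ → K} {I : Finset ℤ} {A B : Maya}
    (hAB : ∀ b ∈ I, b ∈ A.1 ↔ b ∈ B.1) : passWeight h I A = passWeight h I B := by
  classical
  exact Finset.prod_congr rfl fun b hb => by simp only [hAB b hb]

theorem passWeight_move {h : ℤ → K} {I : Finset ℤ} {A : Maya} {s t : ℤ} (hs : s ∉ I) (ht : t ∉ I) :
    passWeight h I (A.move s t) = passWeight h I A := by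
  refine passWeight_congr fun b hb => ?_
  have h1 : b ≠ s := fun h => hs (h ▸ hb)
  have h2 : b ≠ t := fun h => ht (h ▸ hb)
  simp [Maya.mem_move, h1, h2]

theorem passWeight_eq_mul_erase {h : ℤ → K} {I : Finset ℤ} {A : Maya} {s : ℤ} (hs : s ∈ I)
    (hA : s ∈ A.1) : passWeight h I A = h s * passWeight h (I.erase s) A := by
  classical
  rw [passWeight, ← Finset.mul_prod_erase I _ hs, if_pos hA]
  rfl

theorem passWeight_eq_erase {h : ℤ → K} {I : Finset ℤ} {A : Maya} {s : ℤ} (hs : s ∈ I)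
    (hA : s ∉ A.1) : passWeight h I A = passWeight h (I.erase s) A := by
  classical
  rw [passWeight, ← Finset.mul_prod_erase I _ hs, if_neg hA, one_mul]
  rfl

/-- A second particle that starts inside the interval `I` and leaves it takes its factor away. This
lemma and `passWeight_move_target` produce every exchange factor between two moves. -/
theorem passWeight_move_source {h : ℤ → K} {I : Finset ℤ} {A : Maya} {s t : ℤ} (hs : s ∈ I)
    (ht : t ∉ I) (hA : s ∈ A.1) : passWeight h I A = h s * passWeight h I (A.move s t) := by
  have hst : s ≠ t := fun e => ht (e ▸ hs)
  rw [passWeight_eq_mul_erase hs hA, passWeight_eq_erase (A := A.move s t) hs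
    (by simp [Maya.mem_move, hst]), passWeight_move (Finset.notMem_erase _ _)
    (fun h => ht (Finset.mem_of_mem_erase h))]

theorem passWeight_move_target {h : ℤ → K} {I : Finset ℤ} {A : Maya} {s t : ℤ} (hs : s ∉ I)
    (ht : t ∈ I) (hA : t ∉ A.1) : passWeight h I (A.move s t) = h t * passWeight h I A := by
  rw [passWeight_eq_mul_erase ht (Maya.mem_move.mpr (Or.inl rfl)), passWeight_eq_erase ht hA,
    passWeight_move (fun h => hs (Finset.mem_of_mem_erase h)) (Finset.notMem_erase _ _)]

open Classical in
/-- The operator that moves a particle from `s` to `t`, with a factor `h b` for each particle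
`b` in `I`. -/
noncomputable def moveOp (h : ℤ → K) (I : Finset ℤ) (s t : ℤ) : Module.End K (Maya →₀ K) :=
  Finsupp.linearCombination K fun A =>
    if s ∈ A.1 ∧ t ∉ A.1 then Finsupp.single (A.move s t) (passWeight h I A) else 0

variable {h h' : ℤ → K} {I I' : Finset ℤ} {s t s' t' : ℤ} {A : Maya}

theorem moveOp_single_of (hs : s ∈ A.1) (ht : t ∉ A.1) :
    moveOp h I s t (Finsupp.single A 1) = Finsupp.single (A.move s t) (passWeight h I A) := by
  simp [moveOp, hs, ht]

theorem moveOp_single_of_not (hA : ¬(s ∈ A.1 ∧ t ∉ A.1)) :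
    moveOp h I s t (Finsupp.single A 1) = 0 := by
  simp only [moveOp, Finsupp.linearCombination_single, one_smul, if_neg hA]

theorem single_eq_smul (A : Maya) (c : K) : Finsupp.single A c = c • Finsupp.single A (1 : K) := by
  simp

theorem moveOp_comp_single_of (hss : s ≠ s') (htt : t ≠ t')
    (hs : s ∈ A.1) (ht : t ∉ A.1) (hs' : s' ∈ A.1) (ht' : t' ∉ A.1) :
    moveOp h I s t (moveOp h' I' s' t' (Finsupp.single A 1)) =
      Finsupp.single ((A.move s' t').move s t)
        (passWeight h' I' A * passWeight h I (A.move s' t')) := by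
  rw [moveOp_single_of hs' ht', single_eq_smul, map_smul, moveOp_single_of, Finsupp.smul_single,
    smul_eq_mul]
  · simp [Maya.mem_move, hs, hss]
  · simp [Maya.mem_move, ht, htt]

theorem moveOp_comp_single_of_not (hst : s ≠ t') (hts : t ≠ s')
    (hA : ¬((s ∈ A.1 ∧ t ∉ A.1) ∧ (s' ∈ A.1 ∧ t' ∉ A.1))) :
    moveOp h I s t (moveOp h' I' s' t' (Finsupp.single A 1)) = 0 := by
  by_cases h' : s' ∈ A.1 ∧ t' ∉ A.1
  · rw [moveOp_single_of h'.1 h'.2, single_eq_smul, map_smul, moveOp_single_of_not, smul_zero]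
    simp only [Maya.mem_move]
    tauto
  · rw [moveOp_single_of_not h', map_zero]

theorem Maya.move_comm (A : Maya) (hst : s ≠ t') (hts : t ≠ s') :
    (A.move s' t').move s t = (A.move s t).move s' t' :=
  Maya.ext' fun x => by
    simp only [Maya.mem_move]
    constructor
    · rintro (rfl | ⟨rfl | ⟨h1, h2⟩, h3⟩) <;> tauto
    · rintro (rfl | ⟨rfl | ⟨h1, h2⟩, h3⟩) <;> tauto

/-- Two moves between four different sites commute up to the factors that they exchange. -/
theorem moveOp_mul_eq_smul (hss : s ≠ s') (hst : s ≠ t') (hts : t ≠ s') (htt : t ≠ t') (c : K)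
    (hc : ∀ A : Maya, s ∈ A.1 → t ∉ A.1 → s' ∈ A.1 → t' ∉ A.1 →
      passWeight h' I' A * passWeight h I (A.move s' t') =
        c * (passWeight h I A * passWeight h' I' (A.move s t))) :
    moveOp h I s t * moveOp h' I' s' t' = c • (moveOp h' I' s' t' * moveOp h I s t) := by
  refine maya_end_ext fun A => ?_
  simp only [Module.End.mul_apply, LinearMap.smul_apply]
  by_cases hA : (s ∈ A.1 ∧ t ∉ A.1) ∧ (s' ∈ A.1 ∧ t' ∉ A.1)
  · obtain ⟨⟨h1, h2⟩, h3, h4⟩ := hA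
    rw [moveOp_comp_single_of hss htt h1 h2 h3 h4,
      moveOp_comp_single_of hss.symm htt.symm h3 h4 h1 h2,
      Maya.move_comm A hst hts, hc A h1 h2 h3 h4, Finsupp.smul_single, smul_eq_mul]
  · rw [moveOp_comp_single_of_not hst hts hA,
      moveOp_comp_single_of_not hts.symm hst.symm (by tauto), smul_zero]

open Classical in
/-- The operator that acts on a Maya diagram by a scalar. -/
noncomputable def diagOp (f : Maya → K) : Module.End K (Maya →₀ K) :=
  Finsupp.linearCombination K fun A => Finsupp.single A (f A)

theorem diagOp_single (f : Maya → K) (A : Maya) :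
    diagOp f (Finsupp.single A 1) = Finsupp.single A (f A) := by
  simp [diagOp]

theorem diagOp_single' (f : Maya → K) (A : Maya) (c : K) :
    diagOp f (Finsupp.single A c) = Finsupp.single A (c * f A) := by
  simp [diagOp]

end Single

/-! ### The local operators x_e, y_e and their commutation relations. -/

section Ops

variable {K : Type*} [Field K] {n : ℕ} {q : K}

/-- The geometric sum `1 + v + ⋯ + v ^ (j - 1)`. -/
def geomSum (v : K) (j : ℕ) : K := ∑ i ∈ Finset.range j, v ^ i

theorem geomSum_succ (v : K) (j : ℕ) : geomSum v (j + 1) = geomSum v j + v ^ j :=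
  Finset.sum_range_succ _ _

theorem geomSum_zero (v : K) : geomSum v 0 = 0 := by simp [geomSum]

theorem Twist.cast_ne_zero {d : ℤ} (h0 : d ≠ 0) (h1 : -n < d) (h2 : d < n) :
    ((d : ℤ) : ZMod n) ≠ 0 := by
  rw [Ne, CharP.intCast_eq_zero_iff (ZMod n) n]
  exact fun h => h0 (Int.eq_zero_of_abs_lt_dvd h (abs_lt.mpr ⟨h1, h2⟩))

theorem Twist.mul_swap (g : Twist n q) {a b : ℤ} (h0 : a ≠ b) (h1 : a < b + n) (h2 : b < a + n) :
    g.g ((a - b : ℤ) : ZMod n) * g.g ((b - a : ℤ) : ZMod n) = q ^ 2 := by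
  have := g.g_mul_neg ((a - b : ℤ) : ZMod n)
    (Twist.cast_ne_zero (by omega) (by omega) (by omega))
  rwa [← Int.cast_neg, neg_sub] at this

/-- Lower the particle at `e` by `n`. -/
noncomputable def lowerOp (g : Twist n q) (e : ℤ) : Module.End K (Maya →₀ K) :=
  moveOp (fun b => g.g ((e - b : ℤ) : ZMod n)) (Finset.Ioo (e - n) e) e (e - n)

/-- Raise the particle at `e - n` by `n`. -/
noncomputable def raiseOp (g : Twist n q) (e : ℤ) : Module.End K (Maya →₀ K) :=
  moveOp (fun b => g.g ((b - e : ℤ) : ZMod n)) (Finset.Ioo (e - n) e) (e - n) e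

open Classical in
theorem passWeight_mul_swap (g : Twist n q) (e : ℤ) (A : Maya) :
    passWeight (fun b => g.g ((e - b : ℤ) : ZMod n)) (Finset.Ioo (e - n) e) A *
      passWeight (fun b => g.g ((b - e : ℤ) : ZMod n)) (Finset.Ioo (e - n) e) A =
      (q ^ 2) ^ ((Finset.Ioo (e - n) e).filter (· ∈ A.1)).card := by
  rw [passWeight, passWeight, ← Finset.prod_mul_distrib, Finset.card_eq_sum_ones,
    Finset.sum_filter, ← Finset.prod_pow_eq_pow_sum]
  refine Finset.prod_congr rfl fun b hb => ?_
  rw [Finset.mem_Ioo] at hb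
  split_ifs
  · rw [g.mul_swap (by omega) (by omega) (by omega), pow_one]
  · simp

variable [NeZero n] (g : Twist n q)

theorem lowerOp_comm_of_lt {a b : ℤ} (h : b + n < a) :
    lowerOp g a * lowerOp g b = lowerOp g b * lowerOp g a := by
  have hn := NeZero.pos n
  have := moveOp_mul_eq_smul (h := fun x => g.g ((a - x : ℤ) : ZMod n))
    (h' := fun x => g.g ((b - x : ℤ) : ZMod n)) (I := Finset.Ioo (a - n) a)
    (I' := Finset.Ioo (b - n) b) (s := a) (t := a - n) (s' := b) (t' := b - n) (by omega)
    (by omega) (by omega) (by omega) 1 (fun A _ _ _ _ => by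
      rw [passWeight_move, passWeight_move]
      · ring
      all_goals simp only [Finset.mem_Ioo]; omega)
  rwa [one_smul] at this

theorem lowerOp_comm_of_far {a b : ℤ} (h : b + n < a ∨ a + n < b) :
    lowerOp g a * lowerOp g b = lowerOp g b * lowerOp g a := by
  rcases h with h | h
  · exact lowerOp_comm_of_lt g h
  · exact (lowerOp_comm_of_lt g h).symm

/-- If `a` moves first, it passes `b`, and then `b` passes the new position `a - n`: the factors
g(a-b) and g(b-a) multiply to `q ^ 2`. If `b` moves first, the two particles never pass each other.
-/
theorem lowerOp_mul_near {a b : ℤ} (h1 : b < a) (h2 : a < b + n) :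
    lowerOp g b * lowerOp g a = q ^ 2 • (lowerOp g a * lowerOp g b) := by
  have hn := NeZero.pos n
  refine moveOp_mul_eq_smul (by omega) (by omega) (by omega) (by omega) _
    (fun A h3 h4 h5 h6 => ?_)
  rw [passWeight_move_target (I := Finset.Ioo (b - n) b) (by simp only [Finset.mem_Ioo]; omega) (by simp only [Finset.mem_Ioo]; omega) h6,
    passWeight_move_source (I := Finset.Ioo (a - n) a) (t := b - n) (by simp only [Finset.mem_Ioo]; omega)
      (by simp only [Finset.mem_Ioo]; omega) h3,
    ← g.mul_swap (a := a) (b := b) (by omega) (by omega) (by omega)]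
  · have : ((b - (a - n) : ℤ) : ZMod n) = ((b - a : ℤ) : ZMod n) := by push_cast; simp
    rw [this]
    ring

/-- If a = b + n the two moves share their target, and if b = a + n they share their source, so both
products vanish. Otherwise, when the intervals overlap, the moves pass each other at the same
relative residue in either order, and the same factor g(a-b) appears or disappears on both sides. -/
theorem lowerOp_raiseOp_comm {a b : ℤ} (hab : a ≠ b) :
    lowerOp g a * raiseOp g b = raiseOp g b * lowerOp g a := by
  have hn := NeZero.pos n
  by_cases h1 : a = b + n
  · subst h1
    refine maya_end_ext fun A => ?_
    rw [Module.End.mul_apply, Module.End.mul_apply, lowerOp, raiseOp]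
    trans (0 : Maya →₀ K)
    · by_cases hA : b - n ∈ A.1 ∧ b ∉ A.1
      · rw [moveOp_single_of hA.1 hA.2, single_eq_smul, map_smul, moveOp_single_of_not, smul_zero]
        simp [Maya.mem_move]
      · rw [moveOp_single_of_not hA, map_zero]
    · by_cases hA : b + n ∈ A.1 ∧ b + n - n ∉ A.1
      · rw [moveOp_single_of hA.1 hA.2, single_eq_smul, map_smul, moveOp_single_of_not, smul_zero]
        simp [Maya.mem_move]
      · rw [moveOp_single_of_not hA, map_zero]
  by_cases h2 : b = a + n
  · subst h2
    refine maya_end_ext fun A => ?_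
    rw [Module.End.mul_apply, Module.End.mul_apply, lowerOp, raiseOp]
    trans (0 : Maya →₀ K)
    · by_cases hA : a + n - n ∈ A.1 ∧ a + n ∉ A.1
      · rw [moveOp_single_of hA.1 hA.2, single_eq_smul, map_smul, moveOp_single_of_not, smul_zero]
        simp only [Maya.mem_move]
        rintro ⟨h | h, -⟩
        · omega
        · exact h.2 (by omega)
      · rw [moveOp_single_of_not hA, map_zero]
    · by_cases hA : a ∈ A.1 ∧ a - n ∉ A.1
      · rw [moveOp_single_of hA.1 hA.2, single_eq_smul, map_smul, moveOp_single_of_not, smul_zero]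
        simp only [Maya.mem_move]
        rintro ⟨h | h, -⟩
        · omega
        · exact h.2 (by omega)
      · rw [moveOp_single_of_not hA, map_zero]
  have key := moveOp_mul_eq_smul (h := fun x => g.g ((a - x : ℤ) : ZMod n))
    (h' := fun x => g.g ((x - b : ℤ) : ZMod n)) (I := Finset.Ioo (a - n) a)
    (I' := Finset.Ioo (b - n) b) (s := a) (t := a - n) (s' := b - n) (t' := b) (by omega)
    (by omega) (by omega) (by omega) 1 (fun A h3 h4 h5 h6 => by
      rcases lt_or_gt_of_ne hab with h | h
      · by_cases hf : b < a + n
        · rw [passWeight_move_source (I := Finset.Ioo (a - n) a) (A := A) (s := b - n) (t := b)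
            (by simp only [Finset.mem_Ioo]; omega) (by simp only [Finset.mem_Ioo]; omega) h5,
            passWeight_move_source (I := Finset.Ioo (b - n) b) (A := A) (s := a) (t := a - n)
            (by simp only [Finset.mem_Ioo]; omega) (by simp only [Finset.mem_Ioo]; omega) h3]
          have : ((a - (b - n) : ℤ) : ZMod n) = ((a - b : ℤ) : ZMod n) := by push_cast; simp
          rw [this]
          ring
        · rw [passWeight_move, passWeight_move]
          · ring
          all_goals simp only [Finset.mem_Ioo]; omega
      · by_cases hf : a < b + n
        · rw [passWeight_move_target (I := Finset.Ioo (a - n) a) (A := A) (s := b - n) (t := b)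
            (by simp only [Finset.mem_Ioo]; omega) (by simp only [Finset.mem_Ioo]; omega) h6,
            passWeight_move_target (I := Finset.Ioo (b - n) b) (A := A) (s := a) (t := a - n)
            (by simp only [Finset.mem_Ioo]; omega) (by simp only [Finset.mem_Ioo]; omega) h4]
          have : ((a - n - b : ℤ) : ZMod n) = ((a - b : ℤ) : ZMod n) := by push_cast; simp
          rw [this]
          ring
        · rw [passWeight_move, passWeight_move]
          · ring
          all_goals simp only [Finset.mem_Ioo]; omega)
  rwa [one_smul] at key

open Classical in
/-- The number of particles in `[e - n, e)`. -/
noncomputable def windowCount (n : ℕ) (e : ℤ) (A : Maya) : ℕ :=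
  ((Finset.Ico (e - n) e).filter (· ∈ A.1)).card

/-- The diagonal operator `1 + v + ⋯ + v ^ (j - 1)`, where `j` is the number of particles in
`[e - n, e)` and `v = q ^ 2`. -/
noncomputable def windowOp (n : ℕ) (q : K) (e : ℤ) : Module.End K (Maya →₀ K) :=
  diagOp fun A => geomSum (q ^ 2) (windowCount n e A)

open Classical in
theorem windowCount_eq (e : ℤ) (A : Maya) :
    windowCount n e A = ((Finset.Ioo (e - n) e).filter (· ∈ A.1)).card +
      if e - n ∈ A.1 then 1 else 0 := by
  have hn := NeZero.pos n
  rw [windowCount, ← Finset.Ioo_insert_left (by omega : e - n < e), Finset.filter_insert]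
  split_ifs
  · rw [Finset.card_insert_of_notMem (by simp)]
  · simp

open Classical in
theorem windowCount_succ_eq (e : ℤ) (A : Maya) :
    windowCount n (e + 1) A = ((Finset.Ioo (e - n) e).filter (· ∈ A.1)).card +
      if e ∈ A.1 then 1 else 0 := by
  have hn := NeZero.pos n
  have : Finset.Ico (e + 1 - n : ℤ) (e + 1) = insert e (Finset.Ioo (e - n : ℤ) e) := by
    ext x; simp only [Finset.mem_Ico, Finset.mem_insert, Finset.mem_Ioo]; omega
  rw [windowCount, this, Finset.filter_insert]
  split_ifs
  · rw [Finset.card_insert_of_notMem (by simp)]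
  · simp

theorem move_move_cancel {A : Maya} {s t : ℤ} (hs : s ∈ A.1) (ht : t ∉ A.1) :
    (A.move s t).move t s = A :=
  Maya.ext' fun x => by
    simp only [Maya.mem_move]
    constructor
    · rintro (rfl | ⟨rfl | h, h'⟩)
      · exact hs
      · exact absurd rfl h'
      · exact h.1
    · intro hx
      by_cases hxs : x = s
      · exact Or.inl hxs
      · exact Or.inr ⟨Or.inr ⟨hx, hxs⟩, fun e => ht (e ▸ hx)⟩

/-- Moving forth and back is diagonal with eigenvalue v^c, where c counts the particles strictly
between e - n and e. Such a power is the difference of two consecutive geometric sums, and the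
occupation of e - n and of e decides which one survives. In this form the commutators telescope when
they are summed over e. -/
theorem lowerOp_raiseOp_commutator (e : ℤ) :
    lowerOp g e * raiseOp g e - raiseOp g e * lowerOp g e =
      windowOp n q e - windowOp n q (e + 1) := by
  classical
  have hn := NeZero.pos n
  refine maya_end_ext fun A => ?_
  have hI1 : e - n ∉ Finset.Ioo (e - n : ℤ) e := by simp
  have hI2 : e ∉ Finset.Ioo (e - n : ℤ) e := by simp
  simp only [LinearMap.sub_apply, Module.End.mul_apply, windowOp, diagOp_single, lowerOp, raiseOp]
  rw [windowCount_eq, windowCount_succ_eq]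
  by_cases h1 : e ∈ A.1 <;> by_cases h2 : e - n ∈ A.1
  · rw [moveOp_single_of_not (by tauto), moveOp_single_of_not (by tauto)]
    simp [h1, h2]
  · rw [moveOp_single_of_not (by tauto), moveOp_single_of h1 h2, single_eq_smul, map_smul,
      moveOp_single_of (by simp [Maya.mem_move])
        (by simp only [Maya.mem_move]; rintro (h | h); · omega
            · exact h.2 rfl),
      move_move_cancel h1 h2, passWeight_move hI2 hI1, Finsupp.smul_single, smul_eq_mul,
      passWeight_mul_swap g, if_pos h1, if_neg h2, geomSum_succ, map_zero, ← Finsupp.single_sub,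
      zero_sub, ← Finsupp.single_neg]
    congr 1
    ring_nf
  · rw [moveOp_single_of h2 h1, moveOp_single_of_not (s := e) (by tauto), single_eq_smul, map_smul,
      moveOp_single_of (by simp [Maya.mem_move])
        (by simp only [Maya.mem_move]; rintro (h | h); · omega
            · exact h.2 rfl),
      move_move_cancel h2 h1, passWeight_move hI1 hI2, Finsupp.smul_single, smul_eq_mul,
      mul_comm, passWeight_mul_swap g, if_pos h2, if_neg h1, geomSum_succ, map_zero,
      ← Finsupp.single_sub, sub_zero]
    congr 1
    ring_nf
  · rw [moveOp_single_of_not (by tauto), moveOp_single_of_not (by tauto)]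
    simp [h1, h2]

/-- The move empties e - n and fills e, so the window [e+1-n, e] before it and the window [e-n, e)
after it contain exactly the same particles. -/
theorem raiseOp_windowOp (e : ℤ) :
    raiseOp g e * windowOp n q (e + 1) = windowOp n q e * raiseOp g e := by
  classical
  have hn := NeZero.pos n
  refine maya_end_ext fun A => ?_
  simp only [Module.End.mul_apply, windowOp, diagOp_single, raiseOp]
  rw [single_eq_smul, map_smul]
  by_cases hA : e - n ∈ A.1 ∧ e ∉ A.1
  · rw [moveOp_single_of hA.1 hA.2, diagOp_single', windowCount_succ_eq, windowCount_eq,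
      if_neg hA.2, if_neg, Finsupp.smul_single, smul_eq_mul, mul_comm]
    · congr 5
      refine Finset.filter_congr fun b hb => ?_
      rw [Finset.mem_Ioo] at hb
      simp only [Maya.mem_move]
      constructor
      · exact fun h => Or.inr ⟨h, by omega⟩
      · rintro (h | h)
        · omega
        · exact h.1
    · simp only [Maya.mem_move]
      rintro (h | h)
      · omega
      · exact h.2 rfl
  · rw [moveOp_single_of_not hA, map_zero, smul_zero]

end Ops

/-! ### Ordered products, and operators on spans of sets of diagrams. -/

section Products

/-- The product of `x s` over `s ∈ S`, from the largest to the smallest `s`. -/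
def descProd {M : Type*} [Monoid M] (x : ℤ → M) (S : Finset ℤ) : M :=
  ((S.sort (· ≥ ·)).map x).prod

theorem descProd_empty {M : Type*} [Monoid M] (x : ℤ → M) : descProd x ∅ = 1 := by
  simp [descProd]

theorem descProd_insert {M : Type*} [Monoid M] (x : ℤ → M) {m : ℤ} {S : Finset ℤ}
    (h : ∀ s ∈ S, s < m) : descProd x (insert m S) = x m * descProd x S := by
  rw [descProd, Finset.sort_insert _ (fun b hb => (h b hb).le) (fun hm => (h m hm).false),
    List.map_cons, List.prod_cons, descProd]

theorem map_mem_of_mem_supported {K V : Type*} [Field K] [AddCommGroup V] [Module K V]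
    {f : (Maya →₀ K) →ₗ[K] V} {N : Submodule K V} {P : Set Maya} {v : Maya →₀ K}
    (hv : v ∈ Finsupp.supported K K P) (h : ∀ A ∈ P, f (Finsupp.single A 1) ∈ N) : f v ∈ N := by
  rw [Finsupp.supported_eq_span_single] at hv
  induction hv using Submodule.span_induction with
  | mem x hx => obtain ⟨A, hA, rfl⟩ := hx; exact h A hA
  | zero => rw [map_zero]; exact N.zero_mem
  | add x y _ _ hx hy => rw [map_add]; exact N.add_mem hx hy
  | smul c x _ hx => rw [map_smul]; exact N.smul_mem c hx

theorem eq_of_mem_supported {K V : Type*} [Field K] [AddCommGroup V] [Module K V]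
    {f f' : (Maya →₀ K) →ₗ[K] V} {P : Set Maya} {v : Maya →₀ K}
    (hv : v ∈ Finsupp.supported K K P)
    (h : ∀ A ∈ P, f (Finsupp.single A 1) = f' (Finsupp.single A 1)) : f v = f' v := by
  have := map_mem_of_mem_supported (f := f - f') (N := ⊥) hv fun A hA => by
    rw [LinearMap.sub_apply, h A hA, sub_self]; exact Submodule.zero_mem _
  rwa [Submodule.mem_bot, LinearMap.sub_apply, sub_eq_zero] at this

theorem eq_zero_of_mem_supported {K V : Type*} [Field K] [AddCommGroup V] [Module K V]
    {f : (Maya →₀ K) →ₗ[K] V} {P : Set Maya} {v : Maya →₀ K}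
    (hv : v ∈ Finsupp.supported K K P) (h : ∀ A ∈ P, f (Finsupp.single A 1) = 0) : f v = 0 :=
  eq_of_mem_supported (f' := 0) hv h

theorem single_mem_supported {K : Type*} [Field K] {P : Set Maya} {A : Maya} (hA : A ∈ P) (c : K) :
    Finsupp.single A c ∈ Finsupp.supported K K P :=
  Finsupp.single_mem_supported K c hA

theorem moveOp_mem_supported {K : Type*} [Field K] {h : ℤ → K} {I : Finset ℤ} {s t : ℤ}
    {P P' : Set Maya} {v : Maya →₀ K} (hv : v ∈ Finsupp.supported K K P)
    (hP : ∀ A ∈ P, s ∈ A.1 → t ∉ A.1 → A.move s t ∈ P') :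
    moveOp h I s t v ∈ Finsupp.supported K K P' :=
  map_mem_of_mem_supported hv fun A hA => by
    by_cases hst : s ∈ A.1 ∧ t ∉ A.1
    · rw [moveOp_single_of hst.1 hst.2]
      exact single_mem_supported (hP A hA hst.1 hst.2) _
    · rw [moveOp_single_of_not hst]
      exact Submodule.zero_mem _

theorem moveOp_eq_zero {K : Type*} [Field K] {h : ℤ → K} {I : Finset ℤ} {s t : ℤ}
    {P : Set Maya} {v : Maya →₀ K} (hv : v ∈ Finsupp.supported K K P)
    (hP : ∀ A ∈ P, ¬(s ∈ A.1 ∧ t ∉ A.1)) : moveOp h I s t v = 0 :=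
  eq_zero_of_mem_supported hv fun A hA => moveOp_single_of_not (hP A hA)

theorem mem_supported_univ {K : Type*} [Field K] (v : Maya →₀ K) :
    v ∈ Finsupp.supported K K (Set.univ : Set Maya) := by
  rw [Finsupp.supported_univ]; trivial

end Products

/-! ### Ordered products x_S, and the commutation of E_1 with E_r. -/

section Lower

variable {K : Type*} [Field K] {n : ℕ} {q : K} (g : Twist n q)

/-- Lower the particles at the sites `S` by `n`, starting with the lowest one. -/
noncomputable def lowerSet (S : Finset ℤ) : Module.End K (Maya →₀ K) := descProd (lowerOp g) S

theorem lowerSet_insert {m : ℤ} {S : Finset ℤ} (h : ∀ s ∈ S, s < m) :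
    lowerSet g (insert m S) = lowerOp g m * lowerSet g S := descProd_insert _ h

theorem lowerSet_empty : lowerSet g ∅ = 1 := descProd_empty _

theorem lowerSet_singleton (e : ℤ) : lowerSet g {e} = lowerOp g e := by
  rw [← insert_empty_eq, lowerSet_insert g (by simp), lowerSet_empty, mul_one]

variable [NeZero n]

/-- After x_e the site e is empty. The factors of x_S that act before its own x_e belong to smaller
sites and drop their particles below e, so e is still empty when x_e acts again. -/
theorem lowerSet_mul_lowerOp_of_mem {e : ℤ} {S : Finset ℤ} (he : e ∈ S) :
    lowerSet g S * lowerOp g e = 0 := by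
  have hn := NeZero.pos n
  have key : ∀ S : Finset ℤ, e ∈ S → ∀ v ∈ Finsupp.supported K K {A : Maya | e ∉ A.1},
      lowerSet g S v = 0 := by
    intro S
    induction S using Finset.induction_on_max with
    | empty => simp
    | insert m S hm ih =>
      intro he v hv
      rw [lowerSet_insert g hm, Module.End.mul_apply]
      by_cases hem : e ∈ S
      · rw [ih hem v hv, map_zero]
      · obtain rfl : e = m := by simpa [hem] using he
        have : ∀ T : Finset ℤ, (∀ s ∈ T, s < e) →
            lowerSet g T v ∈ Finsupp.supported K K {A : Maya | e ∉ A.1} := by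
          intro T
          induction T using Finset.induction_on_max with
          | empty => intro _; rw [lowerSet_empty]; exact hv
          | insert k T hk ih' =>
            intro hT
            rw [lowerSet_insert g hk, Module.End.mul_apply]
            have hke := hT k (Finset.mem_insert_self _ _)
            refine moveOp_mem_supported (ih' fun s hs => hT s (Finset.mem_insert_of_mem hs))
              fun A hA _ _ => ?_
            simp only [Set.mem_ofPred_eq, Maya.mem_move] at hA ⊢
            rintro (h | h)
            · omega
            · exact hA h.1
        exact moveOp_eq_zero (this S hm) fun A hA h => hA h.1
  refine LinearMap.ext fun v => key S he _ (moveOp_mem_supported (mem_supported_univ v)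
    fun A _ _ _ => ?_)
  simp only [Set.mem_ofPred_eq, Maya.mem_move]
  rintro (h | h)
  · omega
  · exact h.2 rfl

/-- Once x_e has acted inside x_S, the site e - n is filled, and the remaining factors belong to
larger sites and cannot empty it; so another x_e has no room. -/
theorem lowerOp_mul_lowerSet_of_mem {e : ℤ} {S : Finset ℤ} (he : e ∈ S) :
    lowerOp g e * lowerSet g S = 0 := by
  have hn := NeZero.pos n
  have key : ∀ S : Finset ℤ, e ∈ S → ∀ v,
      lowerSet g S v ∈ Finsupp.supported K K {A : Maya | e - n ∈ A.1} := by
    intro S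
    induction S using Finset.induction_on_max with
    | empty => simp
    | insert m S hm ih =>
      intro he v
      rw [lowerSet_insert g hm, Module.End.mul_apply]
      by_cases hem : e ∈ S
      · have := hm e hem
        refine moveOp_mem_supported (ih hem v) fun A hA _ _ => ?_
        simp only [Set.mem_ofPred_eq, Maya.mem_move] at hA ⊢
        exact Or.inr ⟨hA, by omega⟩
      · obtain rfl : e = m := by simpa [hem] using he
        exact moveOp_mem_supported (mem_supported_univ _)
          fun A _ _ _ => Maya.mem_move.mpr (Or.inl rfl)
  exact LinearMap.ext fun v => moveOp_eq_zero (key S he v) fun A hA h => h.2 hA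

/-- Adding a site on the left. -/
theorem lowerOp_mul_lowerSet {e : ℤ} {S : Finset ℤ} (he : e ∉ S) (hen : e + n ∉ S) :
    lowerOp g e * lowerSet g S =
      (q ^ 2) ^ (S.filter (· ∈ Finset.Ioo e (e + n))).card • lowerSet g (insert e S) := by
  induction S using Finset.induction_on_max with
  | empty => simp [lowerSet_singleton, lowerSet_empty]
  | insert m S hm ih =>
    simp only [Finset.mem_insert, not_or] at he hen
    rcases lt_or_gt_of_ne he.1 with hlt | hgt
    · have hm' : ∀ s ∈ insert e S, s < m := by
        intro s hs
        rcases Finset.mem_insert.mp hs with rfl | hs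
        · exact hlt
        · exact hm s hs
      rw [lowerSet_insert g hm, Finset.insert_comm, lowerSet_insert g hm', ← mul_assoc,
        Finset.filter_insert]
      by_cases hmn : m < e + n
      · rw [if_pos (by simp only [Finset.mem_Ioo]; omega), lowerOp_mul_near g hlt hmn,
          smul_mul_assoc, mul_assoc, ih he.2 hen.2, mul_smul_comm, smul_smul,
          Finset.card_insert_of_notMem (fun h => (hm m (Finset.mem_filter.mp h).1).false),
          pow_succ' (q ^ 2)]
      · rw [if_neg (by simp only [Finset.mem_Ioo]; omega),
          lowerOp_comm_of_far g (by omega), mul_assoc, ih he.2 hen.2, mul_smul_comm]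
    · have he' : ∀ s ∈ insert m S, s < e := by
        intro s hs
        rcases Finset.mem_insert.mp hs with rfl | hs
        · exact hgt
        · exact (hm s hs).trans hgt
      rw [lowerSet_insert g he', Finset.filter_false_of_mem, Finset.card_empty, pow_zero, one_smul]
      intro s hs
      have := he' s hs
      simp only [Finset.mem_Ioo]
      omega

/-- Adding a site on the right. -/
theorem lowerSet_mul_lowerOp {e : ℤ} {S : Finset ℤ} (he : e ∉ S) (hen : e - n ∉ S) :
    lowerSet g S * lowerOp g e =
      (q ^ 2) ^ (S.filter (· ∈ Finset.Ioo (e - n) e)).card • lowerSet g (insert e S) := by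
  induction S using Finset.induction_on_max with
  | empty => simp [lowerSet_singleton, lowerSet_empty]
  | insert m S hm ih =>
    simp only [Finset.mem_insert, not_or] at he hen
    rw [lowerSet_insert g hm, mul_assoc, ih he.2 hen.2, mul_smul_comm]
    rcases lt_or_gt_of_ne he.1 with hlt | hgt
    · have hm' : ∀ s ∈ insert e S, s < m := by
        intro s hs
        rcases Finset.mem_insert.mp hs with rfl | hs
        · exact hlt
        · exact hm s hs
      rw [Finset.insert_comm, lowerSet_insert g hm', Finset.filter_insert,
        if_neg (by simp only [Finset.mem_Ioo]; omega)]
    · have he' : ∀ s ∈ insert m S, s < e := by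
        intro s hs
        rcases Finset.mem_insert.mp hs with rfl | hs
        · exact hgt
        · exact (hm s hs).trans hgt
      rw [lowerSet_insert g he', lowerSet_insert g hm,
        lowerSet_insert g (fun s hs => he' s (Finset.mem_insert_of_mem hs)), ← mul_assoc,
        ← mul_assoc, Finset.filter_insert]
      by_cases hmn : e - n < m
      · rw [if_pos (by simp only [Finset.mem_Ioo]; omega), lowerOp_mul_near g hgt (by omega),
          Finset.card_insert_of_notMem (fun h => (hm m (Finset.mem_filter.mp h).1).false),
          pow_succ (q ^ 2), smul_mul_assoc, smul_smul]
      · rw [if_neg (by simp only [Finset.mem_Ioo]; omega), lowerOp_comm_of_far g (by omega)]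

theorem lowerSet_comm_of_far {e : ℤ} {S : Finset ℤ} (h : ∀ s ∈ S, s + n < e) :
    lowerSet g S * lowerOp g e = lowerOp g e * lowerSet g S := by
  induction S using Finset.induction_on_max with
  | empty => simp [lowerSet_empty]
  | insert m S hm ih =>
    rw [lowerSet_insert g hm, mul_assoc, ih fun s hs => h s (Finset.mem_insert_of_mem hs),
      ← mul_assoc, lowerOp_comm_of_far g (Or.inr (h m (Finset.mem_insert_self _ _))), mul_assoc]

/-- The site `e` crosses the site `e + n`. -/
theorem lowerOp_mul_lowerSet_insert (hq : q ≠ 0) {e : ℤ} {T : Finset ℤ} (he : e ∉ T)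
    (hen : e + n ∉ T) :
    lowerOp g e * lowerSet g (insert (e + n) T) = lowerSet g (insert e T) * lowerOp g (e + n) := by
  have hn := NeZero.pos n
  have hlow : ∀ T : Finset ℤ, (∀ s ∈ T, s < e + n) → e ∉ T →
      lowerOp g e * (lowerOp g (e + n) * lowerSet g T) =
        lowerSet g (insert e T) * lowerOp g (e + n) := by
    intro T
    induction T using Finset.induction_on_max with
    | empty => intro _ _; simp [lowerSet_singleton, lowerSet_empty]
    | insert m S hm ih =>
      intro hT he
      simp only [Finset.mem_insert, not_or] at he
      have hmn := hT m (Finset.mem_insert_self _ _)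
      rcases lt_or_gt_of_ne he.1 with hlt | hgt
      · have hm' : ∀ s ∈ insert e S, s < m := by
          intro s hs
          rcases Finset.mem_insert.mp hs with rfl | hs
          · exact hlt
          · exact hm s hs
        rw [Finset.insert_comm, lowerSet_insert g hm', mul_assoc,
          ← ih (fun s hs => hT s (Finset.mem_insert_of_mem hs)) he.2, lowerSet_insert g hm]
        have h1 := lowerOp_mul_near g hlt hmn
        have h2 := lowerOp_mul_near g hmn (a := e + n) (by omega)
        -- For e < m < e + n the operator x_m is near both x_e and x_{e+n}, and the two factors v
        -- have opposite effects. They cancel because q ≠ 0, so x_m commutes with the product x_e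
        -- x_{e+n}.
        have h3 : q ^ 2 • (lowerOp g e * (lowerOp g (e + n) * lowerOp g m)) =
            q ^ 2 • (lowerOp g m * (lowerOp g e * lowerOp g (e + n))) := by
          rw [← mul_smul_comm, ← h2, ← mul_assoc, h1, smul_mul_assoc, mul_assoc]
        have h4 := (smul_right_injective _ (pow_ne_zero 2 hq)) h3
        calc lowerOp g e * (lowerOp g (e + n) * (lowerOp g m * lowerSet g S))
            = lowerOp g e * (lowerOp g (e + n) * lowerOp g m) * lowerSet g S := by
              simp only [mul_assoc]
          _ = _ := by rw [h4]; simp only [mul_assoc]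
      · have he' : ∀ s ∈ insert m S, s < e := by
          intro s hs
          rcases Finset.mem_insert.mp hs with rfl | hs
          · exact hgt
          · exact (hm s hs).trans hgt
        rw [lowerSet_insert g he', mul_assoc,
          lowerSet_comm_of_far g (fun s hs => by have := he' s hs; omega)]
  induction T using Finset.induction_on_max with
  | empty => simp [lowerSet_singleton]
  | insert m S hm ih =>
    simp only [Finset.mem_insert, not_or] at he hen
    by_cases hmn : m < e + n
    · have h1 : ∀ s ∈ insert m S, s < e + n := by
        intro s hs
        rcases Finset.mem_insert.mp hs with rfl | hs
        · exact hmn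
        · exact (hm s hs).trans hmn
      rw [lowerSet_insert g h1]
      exact hlow _ h1 (by simp only [Finset.mem_insert, not_or]; exact he)
    · have h1 : ∀ s ∈ insert (e + n) S, s < m := by
        intro s hs
        rcases Finset.mem_insert.mp hs with rfl | hs
        · omega
        · exact hm s hs
      have h2 : ∀ s ∈ insert e S, s < m := by
        intro s hs
        rcases Finset.mem_insert.mp hs with rfl | hs
        · omega
        · exact hm s hs
      rw [Finset.insert_comm, lowerSet_insert g h1, Finset.insert_comm, lowerSet_insert g h2,
        ← mul_assoc, lowerOp_comm_of_far g (by omega), mul_assoc, ih he.2 hen.2, mul_assoc]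

/-- The sum of `φ (#S) x_S` over the subsets `S` of `W`. -/
noncomputable def lowerSum (φ : ℕ → K) (W : Finset ℤ) : Module.End K (Maya →₀ K) :=
  ∑ S ∈ W.powerset, φ S.card • lowerSet g S

/-- The sum of `φ (#S) (1 + v + ⋯ + v ^ (j - 1)) x_S` over the subsets `S` of `W`, where `j` is the
number of elements of `S` in `[e, e + n)`. -/
noncomputable def lowerWindowSum (φ : ℕ → K) (W : Finset ℤ) (e : ℤ) : Module.End K (Maya →₀ K) :=
  ∑ S ∈ W.powerset,
    (φ S.card * geomSum (q ^ 2) (S.filter (· ∈ Finset.Ico e (e + n))).card) • lowerSet g S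

/-- The windows [e, e+n) and [e+1, e+1+n) differ only in their end points, so the difference of
geometric sums is zero or a signed power of v counting the common interior. These are exactly the
coefficients created by multiplying x_S by x_e on the left or by x_{e+n} on the right. -/
theorem geomSum_window_sub {S : Finset ℤ} (v : K) (e : ℤ) :
    geomSum v (S.filter (· ∈ Finset.Ico e (e + n))).card -
      geomSum v (S.filter (· ∈ Finset.Ico (e + 1) (e + 1 + n))).card =
    if e ∈ S then if e + n ∈ S then 0 else v ^ (S.filter (· ∈ Finset.Ioo e (e + n))).card
    else if e + n ∈ S then -v ^ (S.filter (· ∈ Finset.Ioo e (e + n))).card else 0 := by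
  have hn := NeZero.pos n
  have h1 : (S.filter (· ∈ Finset.Ico e (e + n))).card =
      (S.filter (· ∈ Finset.Ioo e (e + n))).card + if e ∈ S then 1 else 0 := by
    split_ifs with he
    · rw [← Finset.card_insert_of_notMem (a := e) (by simp)]
      congr 1
      ext x
      simp only [Finset.mem_filter, Finset.mem_Ico, Finset.mem_insert, Finset.mem_Ioo]
      constructor
      · rintro ⟨h1, h2, h3⟩
        by_cases hx : x = e
        · exact Or.inl hx
        · exact Or.inr ⟨h1, by omega, h3⟩
      · rintro (rfl | ⟨h1, h2, h3⟩)
        · exact ⟨he, by omega, by omega⟩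
        · exact ⟨h1, by omega, h3⟩
    · congr 1
      refine Finset.filter_congr fun x hx => ?_
      have : x ≠ e := fun h => he (h ▸ hx)
      simp only [Finset.mem_Ico, Finset.mem_Ioo]
      omega
  have h2 : (S.filter (· ∈ Finset.Ico (e + 1) (e + 1 + n))).card =
      (S.filter (· ∈ Finset.Ioo e (e + n))).card + if e + n ∈ S then 1 else 0 := by
    split_ifs with he
    · rw [← Finset.card_insert_of_notMem (a := e + n) (by simp)]
      congr 1
      ext x
      simp only [Finset.mem_filter, Finset.mem_Ico, Finset.mem_insert, Finset.mem_Ioo]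
      constructor
      · rintro ⟨h1, h2, h3⟩
        by_cases hx : x = e + n
        · exact Or.inl hx
        · exact Or.inr ⟨h1, by omega, by omega⟩
      · rintro (rfl | ⟨h1, h2, h3⟩)
        · exact ⟨he, by omega, by omega⟩
        · exact ⟨h1, by omega, by omega⟩
    · congr 1
      refine Finset.filter_congr fun x hx => ?_
      have : x ≠ e + n := fun h => he (h ▸ hx)
      simp only [Finset.mem_Ico, Finset.mem_Ioo]
      omega
  rw [h1, h2]
  split_ifs <;> simp [geomSum_succ]

/-- The terms of the difference of two consecutive window sums. -/
noncomputable def lowerWindowDiff (φ : ℕ → K) (W : Finset ℤ) (e : ℤ) : Module.End K (Maya →₀ K) :=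
  ∑ S ∈ W.powerset, (φ S.card *
    (if e ∈ S then if e + n ∈ S then 0 else
      (q ^ 2) ^ (S.filter (· ∈ Finset.Ioo e (e + n))).card
    else if e + n ∈ S then
      -(q ^ 2) ^ (S.filter (· ∈ Finset.Ioo e (e + n))).card else 0)) • lowerSet g S

theorem lowerWindowSum_eq_add (φ : ℕ → K) (W : Finset ℤ) (e : ℤ) :
    lowerWindowSum g φ W e = lowerWindowSum g φ W (e + 1) + lowerWindowDiff g φ W e := by
  rw [lowerWindowSum, lowerWindowSum, lowerWindowDiff, ← Finset.sum_add_distrib]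
  refine Finset.sum_congr rfl fun S _ => ?_
  rw [← geomSum_window_sub, ← add_smul]
  congr 1
  ring

/-- A local conservation law: the failure of x_e on the left to agree with x_{e+n} on the right is a
difference of consecutive window sums. The weight is shifted to `φ (k + 1)` because multiplication
by one x enlarges S by one element. -/
theorem lowerOp_mul_lowerSum (hq : q ≠ 0) (φ : ℕ → K) (W : Finset ℤ) (e : ℤ) :
    (if e ∈ W then lowerOp g e * lowerSum g (fun k => φ (k + 1)) W else 0) =
      (if e + n ∈ W then lowerSum g (fun k => φ (k + 1)) W * lowerOp g (e + n) else 0) +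
        lowerWindowDiff g φ W e := by
  have hn := NeZero.pos n
  have hee : e ≠ e + n := by omega
  have hA : ∀ T : Finset ℤ, (insert e T).filter (· ∈ Finset.Ioo e (e + n)) =
      T.filter (· ∈ Finset.Ioo e (e + n)) := fun T => by
    rw [Finset.filter_insert, if_neg (by simp)]
  have hB : ∀ T : Finset ℤ, (insert (e + n) T).filter (· ∈ Finset.Ioo e (e + n)) =
      T.filter (· ∈ Finset.Ioo e (e + n)) := fun T => by
    rw [Finset.filter_insert, if_neg (by simp)]
  rw [lowerWindowDiff, lowerSum, Finset.mul_sum, Finset.sum_mul]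
  have hnot : ∀ {x : ℤ} {T U : Finset ℤ}, x ∉ U → T ∈ U.powerset → x ∉ T :=
    fun hx hT h => hx (Finset.mem_powerset.mp hT h)
  have hR : ∀ T : Finset ℤ, e ∉ T → e + n ∉ T → lowerSet g T * lowerOp g (e + n) =
      (q ^ 2) ^ (T.filter (· ∈ Finset.Ioo e (e + n))).card • lowerSet g (insert (e + n) T) := by
    intro T h1 h2
    have := lowerSet_mul_lowerOp g h2 (by simpa using h1)
    simpa using this
  by_cases h1 : e ∈ W <;> by_cases h2 : e + n ∈ W
  · obtain ⟨W', rfl, h3⟩ : ∃ W', W = insert e W' ∧ e ∉ W' :=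
      ⟨W.erase e, (Finset.insert_erase h1).symm, Finset.notMem_erase _ _⟩
    have h2' : e + n ∈ W' := by simpa [hee.symm] using h2
    obtain ⟨U, rfl, h4⟩ : ∃ U, W' = insert (e + n) U ∧ e + n ∉ U :=
      ⟨W'.erase (e + n), (Finset.insert_erase h2').symm, Finset.notMem_erase _ _⟩
    have h5 : e ∉ U := fun h => h3 (Finset.mem_insert_of_mem h)
    rw [if_pos h1, if_pos h2, Finset.sum_powerset_insert h3, Finset.sum_powerset_insert h4,
      Finset.sum_powerset_insert h4, Finset.sum_powerset_insert h3, Finset.sum_powerset_insert h4,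
      Finset.sum_powerset_insert h4, Finset.sum_powerset_insert h3, Finset.sum_powerset_insert h4,
      Finset.sum_powerset_insert h4]
    simp only [← Finset.sum_add_distrib]
    refine Finset.sum_congr rfl fun T hT => ?_
    have h6 := hnot h5 hT
    have h7 := hnot h4 hT
    have h8 : e ∉ insert (e + n : ℤ) T := by simp [h6, hee]
    have h9 : e + n ∉ insert e T := by simp [h7, hee.symm]
    simp only [mul_smul_comm, smul_mul_assoc]
    -- For T without e and e + n, the terms of T and of T with either or both sites added are
    -- compared together. Repeated sites give zero. The terms x_e x_{T ∪ {e+n}} and x_{T ∪ {e}}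
    -- x_{e+n} are equal and cancel. The two remaining products are v^c x_{T ∪ {e}} and v^c x_{T ∪
    -- {e+n}}, the two terms of the window difference.
    rw [lowerOp_mul_lowerSet g h6 h7, lowerOp_mul_lowerSet_insert g hq h6 h7,
      lowerOp_mul_lowerSet_of_mem g (Finset.mem_insert_self e T),
      lowerOp_mul_lowerSet_of_mem g (Finset.mem_insert_self e (insert (e + n : ℤ) T)),
      lowerSet_mul_lowerOp_of_mem g (Finset.mem_insert_self (e + n : ℤ) T),
      lowerSet_mul_lowerOp_of_mem g (S := insert e (insert (e + n : ℤ) T)) (e := e + n)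
        (by simp), hR T h6 h7, hA, hB, if_neg h6, if_neg h7, if_neg h8,
      if_pos (Finset.mem_insert_self _ _), if_pos (Finset.mem_insert_self _ _), if_neg h9,
      if_pos (Finset.mem_insert_self _ _), if_pos (by simp), Finset.card_insert_of_notMem h6,
      Finset.card_insert_of_notMem h7]
    simp only [smul_zero, smul_smul, mul_zero, zero_smul]
    module
  · obtain ⟨W', rfl, h3⟩ : ∃ W', W = insert e W' ∧ e ∉ W' :=
      ⟨W.erase e, (Finset.insert_erase h1).symm, Finset.notMem_erase _ _⟩
    have h4 : e + n ∉ W' := fun h => h2 (Finset.mem_insert_of_mem h)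
    rw [if_pos h1, if_neg h2, Finset.sum_powerset_insert h3, Finset.sum_powerset_insert h3, zero_add]
    simp only [← Finset.sum_add_distrib]
    refine Finset.sum_congr rfl fun T hT => ?_
    have h6 := hnot h3 hT
    have h7 := hnot h4 hT
    simp only [mul_smul_comm]
    rw [lowerOp_mul_lowerSet g h6 h7, lowerOp_mul_lowerSet_of_mem g (Finset.mem_insert_self e T),
      hA, if_neg h6, if_neg h7, if_pos (Finset.mem_insert_self _ _),
      if_neg (by simp [h7, hee.symm]), Finset.card_insert_of_notMem h6]
    simp only [smul_zero, smul_smul, mul_zero, zero_smul]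
    module
  · obtain ⟨W', rfl, h3⟩ : ∃ W', W = insert (e + n : ℤ) W' ∧ e + n ∉ W' :=
      ⟨W.erase (e + n), (Finset.insert_erase h2).symm, Finset.notMem_erase _ _⟩
    have h4 : e ∉ W' := fun h => h1 (Finset.mem_insert_of_mem h)
    rw [if_pos h2, if_neg h1, Finset.sum_powerset_insert h3, Finset.sum_powerset_insert h3]
    simp only [← Finset.sum_add_distrib]
    symm
    refine Finset.sum_eq_zero fun T hT => ?_
    have h6 := hnot h4 hT
    have h7 := hnot h3 hT
    simp only [smul_mul_assoc]
    rw [hR T h6 h7, lowerSet_mul_lowerOp_of_mem g (Finset.mem_insert_self (e + n : ℤ) T),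
      hB, if_neg h6, if_neg h7, if_neg (by simp [h6, hee]),
      if_pos (Finset.mem_insert_self _ _), Finset.card_insert_of_notMem h7]
    simp only [smul_zero, smul_smul, mul_zero, zero_smul]
    module
  · rw [if_neg h1, if_neg h2, zero_add]
    symm
    refine Finset.sum_eq_zero fun T hT => ?_
    rw [if_neg (hnot h1 hT), if_neg (hnot h2 hT), mul_zero, zero_smul]

/-- Summing the local law over all e telescopes: the window sum vanishes once its window lies to the
left or to the right of W. -/
theorem lowerSum_comm (hq : q ≠ 0) (φ : ℕ → K) (a : ℤ) (k : ℕ) :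
    (∑ e ∈ Finset.Ico a (a + k), lowerOp g e) *
        lowerSum g (fun k => φ (k + 1)) (Finset.Ico a (a + k)) =
      lowerSum g (fun k => φ (k + 1)) (Finset.Ico a (a + k)) *
        ∑ e ∈ Finset.Ico a (a + k), lowerOp g e := by
  set W := Finset.Ico a (a + k)
  set E := lowerSum g (fun k => φ (k + 1)) W
  have hzero : ∀ e, e + n ≤ a ∨ a + k ≤ e → lowerWindowSum g φ W e = 0 := by
    intro e he
    refine Finset.sum_eq_zero fun S hS => ?_
    rw [Finset.filter_false_of_mem, Finset.card_empty, geomSum_zero, mul_zero, zero_smul]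
    intro x hx
    have := Finset.mem_Ico.mp (Finset.mem_powerset.mp hS hx)
    simp only [Finset.mem_Ico]
    omega
  refine LinearMap.ext fun v => ?_
  -- The sum starts at a - n, where the window still ends before W, and has n + k steps, after which
  -- the window starts behind W.
  have htel := Finset.sum_range_sub' (fun i : ℕ => lowerWindowSum g φ W (a - n + i) v) (n + k)
  rw [hzero _ (by push_cast; omega), hzero _ (by push_cast; omega), LinearMap.zero_apply,
    sub_zero] at htel
  have hite : ∀ (p : Prop) [Decidable p] (f : Module.End K (Maya →₀ K)),
      (if p then f else 0) v = if p then f v else 0 := by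
    intro p _ f
    split_ifs <;> rfl
  have hstep : ∀ i : ℕ,
      lowerWindowSum g φ W (a - n + i) v - lowerWindowSum g φ W (a - n + (i + 1 : ℕ)) v =
      (if a - n + i ∈ W then lowerOp g (a - n + i) (E v) else 0) -
        (if a + i ∈ W then E (lowerOp g (a + i) v) else 0) := by
    intro i
    have h1 := DFunLike.congr_fun (lowerOp_mul_lowerSum g hq φ W (a - n + i)) v
    have h2 := DFunLike.congr_fun (lowerWindowSum_eq_add g φ W (a - n + i)) v
    rw [show (a - n + i + n : ℤ) = a + i by ring, LinearMap.add_apply, hite, hite] at h1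
    rw [h2, Nat.cast_succ, ← add_assoc, LinearMap.add_apply, add_sub_cancel_left]
    exact (sub_eq_of_eq_add' h1).symm
  rw [Finset.sum_congr rfl fun i _ => hstep i, Finset.sum_sub_distrib, sub_eq_zero] at htel
  have hW : ∀ (f : ℤ → Maya →₀ K) (b : ℤ) (N : ℕ), b ≤ a → a + k ≤ b + N →
      ∑ i ∈ Finset.range N, (if b + i ∈ W then f (b + i) else 0) = ∑ e ∈ W, f e := by
    intro f b N hb hN
    rw [← Finset.sum_filter]
    refine Finset.sum_nbij' (fun i => b + i) (fun e => (e - b).toNat) ?_ ?_ ?_ ?_ ?_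
    · intro i hi
      exact (Finset.mem_filter.mp hi).2
    · intro e he
      have he' := Finset.mem_Ico.mp he
      simp only [Finset.mem_filter, Finset.mem_range]
      refine ⟨by omega, ?_⟩
      rwa [show b + ((e - b).toNat : ℤ) = e by omega]
    · intro i _; simp
    · intro e he
      have he' := Finset.mem_Ico.mp he
      change b + ((e - b).toNat : ℤ) = e
      omega
    · intro i _; rfl
  rw [hW (fun e => lowerOp g e (E v)) (a - n) (n + k) (by omega) (by push_cast; omega),
    hW (fun e => E (lowerOp g e v)) a (n + k) le_rfl (by push_cast; omega)] at htel
  simp only [Module.End.mul_apply, LinearMap.sum_apply, map_sum]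
  exact htel

end Lower

/-! ### Transposition with respect to the orthonormal basis. -/

section Pairing

variable {ι R : Type*} [CommRing R]

/-- The bilinear form for which the basis is orthonormal. -/
noncomputable def dot : (ι →₀ R) →ₗ[R] (ι →₀ R) →ₗ[R] R :=
  Finsupp.linearCombination R fun i => Finsupp.lapply i

theorem dot_single_left (i : ι) (c : R) (w : ι →₀ R) : dot (Finsupp.single i c) w = c * w i := by
  simp [dot]

theorem dot_comm (v w : ι →₀ R) : dot v w = dot w v := by
  induction v using Finsupp.induction_linear with
  | zero => simp
  | add v v' h h' => rw [map_add, LinearMap.add_apply, h, h', map_add]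
  | single i c =>
    induction w using Finsupp.induction_linear with
    | zero => simp
    | add w w' h h' => rw [map_add, h, h', map_add, LinearMap.add_apply]
    | single j d =>
      rw [dot_single_left, dot_single_left]
      by_cases h : i = j
      · subst h; simp [mul_comm]
      · simp [h, Ne.symm h]

theorem dot_single_right (i : ι) (c : R) (w : ι →₀ R) : dot w (Finsupp.single i c) = c * w i := by
  rw [dot_comm, dot_single_left]

/-- `P` and `Q` are transposes of each other. -/
def IsTranspose (P Q : Module.End R (ι →₀ R)) : Prop := ∀ v w, dot (P v) w = dot v (Q w)

variable {P P' Q Q' : Module.End R (ι →₀ R)}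

theorem IsTranspose.of_single
    (h : ∀ i j, P (Finsupp.single i 1) j = Q (Finsupp.single j 1) i) : IsTranspose P Q := by
  intro v w
  induction v using Finsupp.induction_linear with
  | zero => simp
  | add v v' h h' => simp only [map_add, LinearMap.add_apply, h, h']
  | single i c =>
    induction w using Finsupp.induction_linear with
    | zero => simp
    | add w w' h h' => simp only [map_add, h, h']
    | single j d =>
      have h1 : Finsupp.single i c = c • Finsupp.single i (1 : R) := by simp
      have h2 : Finsupp.single j d = d • Finsupp.single j (1 : R) := by simp
      rw [h1, h2]
      simp only [map_smul, LinearMap.smul_apply, dot_single_left, dot_single_right, h i j]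

theorem IsTranspose.apply_single (h : IsTranspose P Q) (i j : ι) :
    P (Finsupp.single i 1) j = Q (Finsupp.single j 1) i := by
  have := h (Finsupp.single i 1) (Finsupp.single j 1)
  rwa [dot_single_left, dot_single_right, one_mul, one_mul] at this

theorem IsTranspose.mul (h : IsTranspose P Q) (h' : IsTranspose P' Q') :
    IsTranspose (P * P') (Q' * Q) := fun v w => by
  rw [Module.End.mul_apply, h, h', Module.End.mul_apply]

theorem IsTranspose.smul (h : IsTranspose P Q) (c : R) : IsTranspose (c • P) (c • Q) :=
  fun v w => by simp only [LinearMap.smul_apply, map_smul, h v w]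

theorem isTranspose_one : IsTranspose (1 : Module.End R (ι →₀ R)) 1 := fun _ _ => rfl

theorem isTranspose_sum {κ : Type*} (s : Finset κ) {P Q : κ → Module.End R (ι →₀ R)}
    (h : ∀ k ∈ s, IsTranspose (P k) (Q k)) : IsTranspose (∑ k ∈ s, P k) (∑ k ∈ s, Q k) := by
  intro v w
  simp only [LinearMap.sum_apply, map_sum]
  exact Finset.sum_congr rfl fun k hk => h k hk v w

/-- This carries an identity between products of operators over to the products of their transposes.
-/
theorem IsTranspose.unique (h : IsTranspose P Q) (h' : IsTranspose P Q') : Q = Q' := by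
  refine Finsupp.lhom_ext' fun j => LinearMap.ext_ring (Finsupp.ext fun i => ?_)
  exact (h.apply_single i j).symm.trans (h'.apply_single i j)

theorem IsTranspose.symm (h : IsTranspose P Q) : IsTranspose Q P := fun v w => by
  rw [dot_comm, ← h, dot_comm]

end Pairing

/-! ### E_r and F_r on a finite window, and the commutator of E_1 with F_{r+1}. -/

section Raise

variable {K : Type*} [Field K] {n : ℕ} {q : K} (g : Twist n q)

/-- Raise by `n` the particles at the sites `s - n`, `s ∈ S`, starting with the highest one. -/
noncomputable def raiseSet (S : Finset ℤ) : Module.End K (Maya →₀ K) :=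
  (descProd (fun e => MulOpposite.op (raiseOp g e)) S).unop

theorem raiseSet_insert {m : ℤ} {S : Finset ℤ} (h : ∀ s ∈ S, s < m) :
    raiseSet g (insert m S) = raiseSet g S * raiseOp g m := by
  rw [raiseSet, descProd_insert _ h]; rfl

theorem raiseSet_empty : raiseSet g ∅ = 1 := by rw [raiseSet, descProd_empty]; rfl

/-- The sum of the operators `lowerSet g S` over the subsets `S` of `W` with `r` elements. -/
noncomputable def lowerElem (W : Finset ℤ) (r : ℕ) : Module.End K (Maya →₀ K) :=
  ∑ S ∈ W.powersetCard r, lowerSet g S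

/-- The sum of the operators `raiseSet g S` over the subsets `S` of `W` with `r` elements. -/
noncomputable def raiseElem (W : Finset ℤ) (r : ℕ) : Module.End K (Maya →₀ K) :=
  ∑ S ∈ W.powersetCard r, raiseSet g S

theorem lowerElem_one (W : Finset ℤ) : lowerElem g W 1 = ∑ e ∈ W, lowerOp g e := by
  rw [lowerElem, Finset.powersetCard_one, Finset.sum_map]
  exact Finset.sum_congr rfl fun e _ => lowerSet_singleton g e

theorem lowerElem_zero (W : Finset ℤ) : lowerElem g W 0 = 1 := by
  rw [lowerElem, Finset.powersetCard_zero, Finset.sum_singleton, lowerSet_empty]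

theorem raiseElem_zero (W : Finset ℤ) : raiseElem g W 0 = 1 := by
  rw [raiseElem, Finset.powersetCard_zero, Finset.sum_singleton, raiseSet_empty]

theorem sum_powersetCard_succ_insert {V : Type*} [AddCommMonoid V] {m : ℤ} {W : Finset ℤ}
    (hm : m ∉ W) (r : ℕ) (f : Finset ℤ → V) :
    ∑ S ∈ (insert m W).powersetCard (r + 1), f S =
      ∑ S ∈ W.powersetCard (r + 1), f S + ∑ S ∈ W.powersetCard r, f (insert m S) := by
  have hsub : ∀ S ∈ W.powersetCard r, m ∉ S := fun S hS hmS =>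
    hm ((Finset.mem_powersetCard.mp hS).1 hmS)
  rw [Finset.powersetCard_succ_insert hm, Finset.sum_union, Finset.sum_image]
  · intro S hS T hT hST
    rw [← Finset.erase_insert (hsub S hS), ← Finset.erase_insert (hsub T hT), hST]
  · rw [Finset.disjoint_left]
    intro S hS hS'
    obtain ⟨T, _, rfl⟩ := Finset.mem_image.mp hS'
    exact hm ((Finset.mem_powersetCard.mp hS).1 (Finset.mem_insert_self _ _))

theorem lowerElem_insert {m : ℤ} {W : Finset ℤ} (h : ∀ s ∈ W, s < m) (r : ℕ) :
    lowerElem g (insert m W) (r + 1) = lowerElem g W (r + 1) + lowerOp g m * lowerElem g W r := by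
  have hm : m ∉ W := fun hm => (h m hm).false
  rw [lowerElem, sum_powersetCard_succ_insert hm, lowerElem, lowerElem, Finset.mul_sum]
  congr 1
  exact Finset.sum_congr rfl fun S hS => lowerSet_insert g fun s hs =>
    h s ((Finset.mem_powersetCard.mp hS).1 hs)

theorem raiseElem_insert {m : ℤ} {W : Finset ℤ} (h : ∀ s ∈ W, s < m) (r : ℕ) :
    raiseElem g (insert m W) (r + 1) = raiseElem g W (r + 1) + raiseElem g W r * raiseOp g m := by
  have hm : m ∉ W := fun hm => (h m hm).false
  rw [raiseElem, sum_powersetCard_succ_insert hm, raiseElem, raiseElem, Finset.sum_mul]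
  congr 1
  exact Finset.sum_congr rfl fun S hS => raiseSet_insert g fun s hs =>
    h s ((Finset.mem_powersetCard.mp hS).1 hs)

variable [NeZero n]

theorem lowerElem_comm (hq : q ≠ 0) (a : ℤ) (k r : ℕ) :
    lowerElem g (Finset.Ico a (a + k)) 1 * lowerElem g (Finset.Ico a (a + k)) r =
      lowerElem g (Finset.Ico a (a + k)) r * lowerElem g (Finset.Ico a (a + k)) 1 := by
  -- The weight that is 1 at r + 1 and 0 elsewhere isolates the sets with r elements, after the
  -- shift by one in `lowerSum_comm`.
  have key : ∀ W : Finset ℤ, lowerElem g W r =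
      lowerSum g (fun j => (fun i => if i = r + 1 then (1 : K) else 0) (j + 1)) W := by
    intro W
    simp only [lowerSum, ite_smul, one_smul, zero_smul, add_left_inj]
    rw [← Finset.sum_filter, lowerElem, Finset.powersetCard_eq_filter]
  rw [lowerElem_one, key]
  exact lowerSum_comm g hq (fun i => if i = r + 1 then 1 else 0) a k

theorem commute_raiseElem {a : ℤ} {W : Finset ℤ} (h : a ∉ W) (r : ℕ) :
    lowerOp g a * raiseElem g W r = raiseElem g W r * lowerOp g a := by
  have key : ∀ S : Finset ℤ, a ∉ S → lowerOp g a * raiseSet g S = raiseSet g S * lowerOp g a := by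
    intro S
    induction S using Finset.induction_on_max with
    | empty => intro _; rw [raiseSet_empty, mul_one, one_mul]
    | insert m S hm ih =>
      intro ha
      simp only [Finset.mem_insert, not_or] at ha
      rw [raiseSet_insert g hm, ← mul_assoc, ih ha.2, mul_assoc, lowerOp_raiseOp_comm g ha.1,
        mul_assoc]
  rw [raiseElem, Finset.mul_sum, Finset.sum_mul]
  exact Finset.sum_congr rfl fun S hS => key S fun ha => h ((Finset.mem_powersetCard.mp hS).1 ha)

/-- Only x_e and y_e with the same e fail to commute, and each commutator is a difference of window
operators. Because y_e carries the window operator at e + 1 to the one at e, these differences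
telescope through the ordered product, and only the operators at the two ends of the interval
survive. The proof adds sites at the right end one at a time. -/
theorem lowerElem_raiseElem (a : ℤ) (k r : ℕ) :
    lowerElem g (Finset.Ico a (a + k)) 1 * raiseElem g (Finset.Ico a (a + k)) (r + 1) +
        raiseElem g (Finset.Ico a (a + k)) r * windowOp n q (a + k) =
      raiseElem g (Finset.Ico a (a + k)) (r + 1) * lowerElem g (Finset.Ico a (a + k)) 1 +
        windowOp n q a * raiseElem g (Finset.Ico a (a + k)) r := by
  simp only [lowerElem_one]
  induction k generalizing r with
  | zero =>
    have h : raiseElem g (∅ : Finset ℤ) (r + 1) = 0 := by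
      rw [raiseElem, Finset.powersetCard_eq_empty.mpr (by simp), Finset.sum_empty]
    simp only [Nat.cast_zero, add_zero, Finset.Ico_self, Finset.sum_empty, zero_mul, h, zero_add]
    cases r with
    | zero => rw [raiseElem_zero, one_mul, mul_one]
    | succ r =>
      rw [raiseElem, Finset.powersetCard_eq_empty.mpr (by simp), Finset.sum_empty, zero_mul, mul_zero]
  | succ k ih =>
    have hI : Finset.Ico a (a + (k + 1 : ℕ)) = insert (a + k : ℤ) (Finset.Ico a (a + k)) := by
      ext x; simp only [Finset.mem_Ico, Finset.mem_insert]; push_cast; omega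
    have hlt : ∀ s ∈ Finset.Ico a (a + k), s < a + k := fun s hs => (Finset.mem_Ico.mp hs).2
    have hm : a + k ∉ Finset.Ico a (a + k) := by simp
    rw [hI, Finset.sum_insert hm, raiseElem_insert g hlt, Nat.cast_succ, ← add_assoc a]
    have h1 := commute_raiseElem g hm
    have h2 : (∑ e ∈ Finset.Ico a (a + k), lowerOp g e) * raiseOp g (a + k) =
        raiseOp g (a + k) * ∑ e ∈ Finset.Ico a (a + k), lowerOp g e := by
      rw [Finset.sum_mul, Finset.mul_sum]
      exact Finset.sum_congr rfl fun e he => lowerOp_raiseOp_comm g fun h => hm (h ▸ he)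
    have h3 : lowerOp g (a + k) * raiseOp g (a + k) + windowOp n q (a + k + 1) =
        raiseOp g (a + k) * lowerOp g (a + k) + windowOp n q (a + k) := by
      refine LinearMap.ext fun v => ?_
      have := DFunLike.congr_fun (lowerOp_raiseOp_commutator g (a + k)) v
      simp only [LinearMap.sub_apply] at this
      simp only [LinearMap.add_apply]
      rw [sub_eq_sub_iff_add_eq_add] at this
      rw [this, _root_.add_comm]
    have h4 := raiseOp_windowOp g (a + k)
    set X := ∑ e ∈ Finset.Ico a (a + k), lowerOp g e
    set x := lowerOp g (a + k)
    set y := raiseOp g (a + k)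
    set D := windowOp n q (a + k)
    set D' := windowOp n q (a + k + 1)
    set Y := raiseElem g (Finset.Ico a (a + k))
    set D0 := windowOp n q a
    have ih' := ih r
    cases r with
    | zero =>
      simp only [raiseElem_zero]
      have e0 : Y 0 = 1 := raiseElem_zero g _
      simp only [e0, one_mul, mul_one, zero_add] at ih' ⊢
      calc (x + X) * (Y 1 + y) + D' = (X * Y 1 + X * y + x * Y 1) + (x * y + D') := by
            simp only [mul_add, add_mul]; abel
        _ = (X * Y 1 + D) + (X * y + x * Y 1 + y * x) := by rw [h3]; abel
        _ = _ := by rw [ih', h1, h2]; simp only [mul_add, add_mul]; abel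
    | succ r =>
      rw [raiseElem_insert g hlt]
      have ih'' := ih r
      calc (x + X) * (Y (r + 1 + 1) + Y (r + 1) * y) + (Y (r + 1) + Y r * y) * D'
          = X * Y (r + 1 + 1) + X * Y (r + 1) * y + x * Y (r + 1 + 1) + x * Y (r + 1) * y +
              Y (r + 1) * D' + Y r * (y * D') := by
            simp only [mul_add, add_mul, mul_assoc]; abel
        _ = X * Y (r + 1 + 1) + (X * Y (r + 1) + Y r * D) * y + Y (r + 1 + 1) * x +
              Y (r + 1) * (x * y + D') := by
            rw [h4, h1, h1]; simp only [mul_add, add_mul, mul_assoc]; abel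
        _ = (X * Y (r + 1 + 1) + Y (r + 1) * D) + (Y (r + 1) * X + D0 * Y r) * y +
              Y (r + 1 + 1) * x + Y (r + 1) * (y * x) := by
            rw [ih'', h3]; simp only [mul_add]; abel
        _ = _ := by
            rw [ih', add_mul, mul_assoc, h2]; simp only [mul_add, add_mul, mul_assoc]; abel

end Raise

/-! ### From finite windows to operators on all sites. -/

section Local

variable {K : Type*} [Field K] {n : ℕ} {q : K}

/-- The span of the Maya diagrams between the bounds `a` and `b`. -/
def withinSub (K : Type*) [Field K] (a b : ℤ) : Submodule K (Maya →₀ K) :=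
  Finsupp.supported K K {A | A.Within a b}

theorem withinSub_mono {a b a' b' : ℤ} (ha : a' ≤ a) (hb : b ≤ b') :
    withinSub K a b ≤ withinSub K a' b' :=
  Finsupp.supported_mono fun _ hA => Maya.Within.mono hA ha hb

theorem single_mem_withinSub {a b : ℤ} {A : Maya} (h : A.Within a b) (c : K) :
    Finsupp.single A c ∈ withinSub K a b := single_mem_supported h c

theorem exists_mem_withinSub (v : Maya →₀ K) : ∃ a b, v ∈ withinSub K a b := by
  induction v using Finsupp.induction_linear with
  | zero => exact ⟨0, 0, Submodule.zero_mem _⟩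
  | add v w hv hw =>
    obtain ⟨a, b, hv⟩ := hv
    obtain ⟨a', b', hw⟩ := hw
    exact ⟨min a a', max b b', Submodule.add_mem _
      (withinSub_mono (min_le_left _ _) (le_max_left _ _) hv)
      (withinSub_mono (min_le_right _ _) (le_max_right _ _) hw)⟩
  | single A c =>
    obtain ⟨a, b, h⟩ := A.exists_within
    exact ⟨a, b, single_mem_withinSub h c⟩

variable (g : Twist n q)

theorem lowerOp_mem {a b : ℤ} (e : ℤ) {v : Maya →₀ K} (hv : v ∈ withinSub K a b) :
    lowerOp g e v ∈ withinSub K a b := by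
  refine moveOp_mem_supported hv fun A hA h1 h2 => ⟨fun x hx => ?_, fun x hx => ?_⟩
  · have h3 : a ≤ e - n := le_of_not_gt fun h => h2 (hA.1 _ h)
    exact Maya.mem_move.mpr (Or.inr ⟨hA.1 x hx, by omega⟩)
  · rcases Maya.mem_move.mp hx with rfl | hx
    · have := hA.2 e h1; omega
    · exact hA.2 x hx.1

theorem lowerOp_eq_zero {a b : ℤ} {e : ℤ} (he : e ∉ Finset.Ico a b) {v : Maya →₀ K}
    (hv : v ∈ withinSub K a b) : lowerOp g e v = 0 := by
  refine moveOp_eq_zero hv fun A hA h => he (Finset.mem_Ico.mpr ⟨?_, hA.2 e h.1⟩)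
  by_contra hlt
  exact h.2 (hA.1 _ (by omega))

theorem raiseOp_mem {a b : ℤ} (e : ℤ) {v : Maya →₀ K} (hv : v ∈ withinSub K a b) :
    raiseOp g e v ∈ withinSub K (a - n) (b + n) := by
  refine moveOp_mem_supported hv fun A hA h1 h2 => ⟨fun x hx => ?_, fun x hx => ?_⟩
  · have h3 : a ≤ e := le_of_not_gt fun h => h2 (hA.1 _ h)
    exact Maya.mem_move.mpr (Or.inr ⟨hA.1 x (by omega), by omega⟩)
  · rcases Maya.mem_move.mp hx with rfl | hx
    · have := hA.2 _ h1; omega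
    · have := hA.2 x hx.1; omega

theorem raiseOp_eq_zero {a b : ℤ} {e : ℤ} (he : e ∉ Finset.Ico (a - n) (b + n)) {v : Maya →₀ K}
    (hv : v ∈ withinSub K a b) : raiseOp g e v = 0 := by
  refine moveOp_eq_zero hv fun A hA h => he (Finset.mem_Ico.mpr ⟨?_, ?_⟩)
  · by_contra hlt
    exact h.2 (hA.1 _ (by omega))
  · have := hA.2 _ h.1; omega

theorem lowerSet_mem {a b : ℤ} (S : Finset ℤ) {v : Maya →₀ K} (hv : v ∈ withinSub K a b) :
    lowerSet g S v ∈ withinSub K a b := by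
  induction S using Finset.induction_on_max with
  | empty => rwa [lowerSet_empty]
  | insert m S hm ih => rw [lowerSet_insert g hm]; exact lowerOp_mem g m ih

theorem lowerSet_eq_zero {a b : ℤ} {S : Finset ℤ} (hS : ¬S ⊆ Finset.Ico a b) {v : Maya →₀ K}
    (hv : v ∈ withinSub K a b) : lowerSet g S v = 0 := by
  induction S using Finset.induction_on_max with
  | empty => simp at hS
  | insert m S hm ih =>
    rw [lowerSet_insert g hm, Module.End.mul_apply]
    by_cases h : S ⊆ Finset.Ico a b
    · refine lowerOp_eq_zero g (fun hm' => hS ?_) (lowerSet_mem g S hv)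
      exact Finset.insert_subset hm' h
    · rw [ih h, map_zero]

theorem raiseSet_mem {a b : ℤ} (S : Finset ℤ) {v : Maya →₀ K} (hv : v ∈ withinSub K a b) :
    raiseSet g S v ∈ withinSub K (a - S.card * n) (b + S.card * n) := by
  induction S using Finset.induction_on_max generalizing a b v with
  | empty => simpa [raiseSet_empty] using hv
  | insert m S hm ih =>
    rw [raiseSet_insert g hm, Finset.card_insert_of_notMem fun h => (hm m h).false]
    refine withinSub_mono ?_ ?_ (ih (raiseOp_mem g m hv)) <;> push_cast <;> linarith

/-- Each raise widens the bounds of a diagram by n on both sides, so `S.card` raises reach no site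
outside the enlarged interval. -/
theorem raiseSet_eq_zero {a b : ℤ} {S : Finset ℤ}
    (hS : ¬S ⊆ Finset.Ico (a - S.card * n) (b + S.card * n)) {v : Maya →₀ K}
    (hv : v ∈ withinSub K a b) : raiseSet g S v = 0 := by
  induction S using Finset.induction_on_max generalizing a b v with
  | empty => simp at hS
  | insert m S hm ih =>
    rw [raiseSet_insert g hm, Module.End.mul_apply]
    rw [Finset.card_insert_of_notMem fun h => (hm m h).false] at hS
    have hc : (0 : ℤ) ≤ S.card * n := by positivity
    by_cases h : S ⊆ Finset.Ico (a - n - S.card * n) (b + n + S.card * n)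
    · by_cases hm' : m ∈ Finset.Ico (a - n) (b + n)
      · refine absurd ?_ hS
        refine Finset.insert_subset ?_ (h.trans ?_)
        · rw [Finset.mem_Ico] at hm' ⊢
          push_cast
          constructor <;> linarith
        · refine Finset.Ico_subset_Ico ?_ ?_ <;> push_cast <;> linarith
      · rw [raiseOp_eq_zero g hm' hv, map_zero]
    · exact ih h (raiseOp_mem g m hv)

/-- Makes `lowerAll` and `raiseAll` independent of the bounds `Maya.lo` and `Maya.hi`, which are
chosen arbitrarily for each diagram. -/
theorem sum_powersetCard_eq {V : Type*} [AddCommMonoid V] (f : Finset ℤ → V) {W W' : Finset ℤ}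
    {r : ℕ} (h : ∀ S, S.card = r → f S ≠ 0 → S ⊆ W) (h' : ∀ S, S.card = r → f S ≠ 0 → S ⊆ W') :
    ∑ S ∈ W.powersetCard r, f S = ∑ S ∈ W'.powersetCard r, f S := by
  have key : ∀ U U' : Finset ℤ, (∀ S, S.card = r → f S ≠ 0 → S ⊆ U) → U ⊆ U' →
      ∑ S ∈ U.powersetCard r, f S = ∑ S ∈ U'.powersetCard r, f S := by
    intro U U' hU hUU'
    refine Finset.sum_subset (Finset.powersetCard_mono hUU') fun S hS hS' => ?_
    by_contra hne
    have hc := (Finset.mem_powersetCard.mp hS).2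
    exact hS' (Finset.mem_powersetCard.mpr ⟨hU S hc hne, hc⟩)
  rw [key W (W ∪ W') h Finset.subset_union_left, key W' (W ∪ W') h' Finset.subset_union_right]

/-- A lower bound of a Maya diagram. -/
noncomputable def Maya.lo (A : Maya) : ℤ := A.exists_within.choose

/-- An upper bound of a Maya diagram. -/
noncomputable def Maya.hi (A : Maya) : ℤ := A.exists_within.choose_spec.choose

theorem Maya.within_lo_hi (A : Maya) : A.Within A.lo A.hi :=
  A.exists_within.choose_spec.choose_spec

/-- The sum of the operators `lowerSet g S` over all sets `S` with `r` elements: lower `r` particles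
simultaneously. -/
noncomputable def lowerAll (r : ℕ) : Module.End K (Maya →₀ K) :=
  Finsupp.linearCombination K fun A =>
    lowerElem g (Finset.Ico A.lo A.hi) r (Finsupp.single A 1)

/-- The sum of the operators `raiseSet g S` over all sets `S` with `r` elements: raise `r` particles
simultaneously. -/
noncomputable def raiseAll (r : ℕ) : Module.End K (Maya →₀ K) :=
  Finsupp.linearCombination K fun A =>
    raiseElem g (Finset.Ico (A.lo - r * n) (A.hi + r * n)) r (Finsupp.single A 1)

theorem lowerAll_apply {a b : ℤ} {W : Finset ℤ} (hW : Finset.Ico a b ⊆ W) (r : ℕ) {v : Maya →₀ K}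
    (hv : v ∈ withinSub K a b) : lowerAll g r v = lowerElem g W r v := by
  refine eq_of_mem_supported hv fun A hA => ?_
  rw [lowerAll, Finsupp.linearCombination_single, one_smul, lowerElem, lowerElem,
    LinearMap.sum_apply, LinearMap.sum_apply]
  refine sum_powersetCard_eq _ (fun S _ hne => ?_) fun S _ hne => ?_
  · by_contra h
    exact hne (lowerSet_eq_zero g h (single_mem_withinSub A.within_lo_hi 1))
  · by_contra h
    exact hne (lowerSet_eq_zero g (fun h' => h (h'.trans hW)) (single_mem_withinSub hA 1))

theorem raiseAll_apply {a b : ℤ} {W : Finset ℤ} (r : ℕ)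
    (hW : Finset.Ico (a - r * n) (b + r * n) ⊆ W) {v : Maya →₀ K}
    (hv : v ∈ withinSub K a b) : raiseAll g r v = raiseElem g W r v := by
  refine eq_of_mem_supported hv fun A hA => ?_
  rw [raiseAll, Finsupp.linearCombination_single, one_smul, raiseElem, raiseElem,
    LinearMap.sum_apply, LinearMap.sum_apply]
  refine sum_powersetCard_eq _ (fun S hc hne => ?_) fun S hc hne => ?_
  · by_contra h
    exact hne (raiseSet_eq_zero g (hc ▸ h) (single_mem_withinSub A.within_lo_hi 1))
  · by_contra h
    exact hne (raiseSet_eq_zero g (fun h' => h (by rw [hc] at h'; exact h'.trans hW))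
      (single_mem_withinSub hA 1))

theorem lowerElem_mem {a b : ℤ} (W : Finset ℤ) (r : ℕ) {v : Maya →₀ K}
    (hv : v ∈ withinSub K a b) : lowerElem g W r v ∈ withinSub K a b := by
  rw [lowerElem, LinearMap.sum_apply]
  exact Submodule.sum_mem _ fun S _ => lowerSet_mem g S hv

theorem raiseElem_mem {a b : ℤ} (W : Finset ℤ) (r : ℕ) {v : Maya →₀ K}
    (hv : v ∈ withinSub K a b) : raiseElem g W r v ∈ withinSub K (a - r * n) (b + r * n) := by
  rw [raiseElem, LinearMap.sum_apply]
  refine Submodule.sum_mem _ fun S hS => ?_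
  have := raiseSet_mem g S hv
  rwa [(Finset.mem_powersetCard.mp hS).2] at this

theorem lowerAll_mem {a b : ℤ} (r : ℕ) {v : Maya →₀ K} (hv : v ∈ withinSub K a b) :
    lowerAll g r v ∈ withinSub K a b := by
  rw [lowerAll_apply g le_rfl r hv]
  exact lowerElem_mem g _ r hv

theorem raiseAll_mem {a b : ℤ} (r : ℕ) {v : Maya →₀ K} (hv : v ∈ withinSub K a b) :
    raiseAll g r v ∈ withinSub K (a - r * n) (b + r * n) := by
  rw [raiseAll_apply g r le_rfl hv]
  exact raiseElem_mem g _ r hv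

theorem lowerAll_zero : lowerAll g 0 = 1 := by
  refine LinearMap.ext fun v => ?_
  obtain ⟨a, b, hv⟩ := exists_mem_withinSub v
  rw [lowerAll_apply g le_rfl 0 hv, lowerElem_zero]

theorem raiseAll_zero : raiseAll g 0 = 1 := by
  refine LinearMap.ext fun v => ?_
  obtain ⟨a, b, hv⟩ := exists_mem_withinSub v
  rw [raiseAll_apply g 0 le_rfl hv, raiseElem_zero]

theorem windowOp_eq_zero {a b e : ℤ} (h : b + n ≤ e) {v : Maya →₀ K}
    (hv : v ∈ withinSub K a b) : windowOp n q e v = 0 := by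
  classical
  refine eq_zero_of_mem_supported hv fun A hA => ?_
  rw [windowOp, diagOp_single, windowCount, Finset.filter_false_of_mem, Finset.card_empty,
    geomSum_zero, Finsupp.single_zero]
  intro x hx hxA
  have := hA.2 x hxA
  have := Finset.mem_Ico.mp hx
  omega

theorem windowOp_eq_smul {a b e : ℤ} (h : e ≤ a) {v : Maya →₀ K}
    (hv : v ∈ withinSub K a b) : windowOp n q e v = geomSum (q ^ 2) n • v := by
  classical
  refine eq_of_mem_supported (f' := geomSum (q ^ 2) n • LinearMap.id) hv fun A hA => ?_
  rw [windowOp, diagOp_single, windowCount, Finset.filter_true_of_mem, Int.card_Ico]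
  · simp
  · intro x hx
    have := Finset.mem_Ico.mp hx
    exact hA.1 x (by omega)

variable [NeZero n]

theorem lowerAll_one_comm (hq : q ≠ 0) (r : ℕ) :
    lowerAll g 1 * lowerAll g r = lowerAll g r * lowerAll g 1 := by
  refine LinearMap.ext fun v => ?_
  obtain ⟨a, b, hv⟩ := exists_mem_withinSub v
  have hW : Finset.Ico a b ⊆ Finset.Ico a (a + (b - a).toNat) :=
    Finset.Ico_subset_Ico le_rfl (by omega)
  have := DFunLike.congr_fun (lowerElem_comm g hq a (b - a).toNat r) v
  rw [Module.End.mul_apply, Module.End.mul_apply] at this ⊢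
  rwa [lowerAll_apply g hW r hv, lowerAll_apply g hW 1 hv,
    lowerAll_apply g hW 1 (lowerElem_mem g _ r hv), lowerAll_apply g hW r (lowerElem_mem g _ 1 hv)]

/-- The finite identity is applied on an interval larger than the diagrams. The window at its right
end contains no particle and contributes 0; the window at its left end is full and contributes 1 + v
+ ⋯ + v^{n-1}. -/
theorem lowerAll_one_raiseAll (r : ℕ) :
    lowerAll g 1 * raiseAll g (r + 1) =
      raiseAll g (r + 1) * lowerAll g 1 + geomSum (q ^ 2) n • raiseAll g r := by
  refine LinearMap.ext fun v => ?_
  obtain ⟨a, b, hv⟩ := exists_mem_withinSub v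
  have hrn : (0 : ℤ) ≤ r * n := by positivity
  -- The interval allows for r + 1 raises at both ends, so that all truncations below are exact at
  -- once.
  set a' := a - (r + 1) * n with ha'
  set k : ℕ := (b + (r + 1) * n - a').toNat with hk
  have hbk : b + (r + 1) * n ≤ a' + k := by omega
  have hW : Finset.Ico (a - (r + 1 : ℕ) * n) (b + (r + 1 : ℕ) * n) ⊆ Finset.Ico a' (a' + k) := by
    refine Finset.Ico_subset_Ico ?_ ?_ <;> push_cast <;> omega
  have hW' : Finset.Ico (a - r * n) (b + r * n) ⊆ Finset.Ico a' (a' + k) := by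
    refine Finset.Ico_subset_Ico ?_ ?_ <;> linarith
  have hW'' : Finset.Ico a b ⊆ Finset.Ico a' (a' + k) := by
    refine Finset.Ico_subset_Ico ?_ ?_ <;> linarith
  have := DFunLike.congr_fun (lowerElem_raiseElem g a' k r) v
  simp only [LinearMap.add_apply, Module.End.mul_apply, LinearMap.smul_apply] at this ⊢
  rw [raiseAll_apply g (r + 1) hW hv, raiseAll_apply g r hW' hv, lowerAll_apply g hW'' 1 hv,
    lowerAll_apply g hW 1 (raiseElem_mem g _ (r + 1) hv),
    raiseAll_apply g (r + 1) hW (lowerElem_mem g _ 1 hv)]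
  rwa [windowOp_eq_zero (by linarith) hv, map_zero, add_zero,
    windowOp_eq_smul (by linarith) (raiseElem_mem g _ r hv)] at this


end Local

/-! ### Lowering for g is transposed to raising for the dual twist. -/

section Transpose

variable {K : Type*} [Field K] {n : ℕ} {q : K} (g : Twist n q)

/-- The reversed move passes the same particles, and its factor for a particle at b is ĝ(b-e) =
g(e-b); passing to the dual twist is forced by this sign. -/
theorem lowerOp_transpose [NeZero n] (e : ℤ) : IsTranspose (lowerOp g e) (raiseOp g.dual e) := by
  have hn := NeZero.pos n
  have hI1 : e - n ∉ Finset.Ioo (e - n : ℤ) e := by simp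
  have hI2 : e ∉ Finset.Ioo (e - n : ℤ) e := by simp
  have hg : (fun b : ℤ => g.dual.g ((b - e : ℤ) : ZMod n)) =
      fun b : ℤ => g.g ((e - b : ℤ) : ZMod n) := by
    funext b
    change g.g (-((b - e : ℤ) : ZMod n)) = _
    rw [← Int.cast_neg, neg_sub]
  classical
  refine .of_single fun A B => ?_
  rw [lowerOp, raiseOp, hg]
  by_cases hA : e ∈ A.1 ∧ e - n ∉ A.1 ∧ A.move e (e - n) = B
  · obtain ⟨h1, h2, rfl⟩ := hA
    rw [moveOp_single_of h1 h2, moveOp_single_of (by simp [Maya.mem_move])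
      (by simp only [Maya.mem_move]; rintro (h | h); · omega
          · exact h.2 rfl),
      move_move_cancel h1 h2, passWeight_move hI2 hI1, Finsupp.single_eq_same,
      Finsupp.single_eq_same]
  · by_cases hB : e - n ∈ B.1 ∧ e ∉ B.1 ∧ B.move (e - n) e = A
    · obtain ⟨h1, h2, rfl⟩ := hB
      refine absurd ⟨by simp [Maya.mem_move], ?_, move_move_cancel h1 h2⟩ hA
      simp only [Maya.mem_move]
      rintro (h | h)
      · omega
      · exact h.2 rfl
    · trans (0 : K)
      · by_cases h : e ∈ A.1 ∧ e - n ∉ A.1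
        · rw [moveOp_single_of h.1 h.2, Finsupp.single_apply, if_neg (by tauto)]
        · rw [moveOp_single_of_not h]; rfl
      · by_cases h : e - n ∈ B.1 ∧ e ∉ B.1
        · rw [moveOp_single_of h.1 h.2, Finsupp.single_apply, if_neg (by tauto)]
        · rw [moveOp_single_of_not h]; rfl

theorem lowerSet_transpose [NeZero n] (S : Finset ℤ) :
    IsTranspose (lowerSet g S) (raiseSet g.dual S) := by
  induction S using Finset.induction_on_max with
  | empty => rw [lowerSet_empty, raiseSet_empty]; exact isTranspose_one
  | insert m S hm ih =>
    rw [lowerSet_insert g hm, raiseSet_insert _ hm]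
    exact (lowerOp_transpose g m).mul ih

theorem lowerAll_transpose [NeZero n] (r : ℕ) :
    IsTranspose (lowerAll g r) (raiseAll g.dual r) := by
  refine .of_single fun A B => ?_
  have hA := single_mem_withinSub (K := K) A.within_lo_hi 1
  have hB := single_mem_withinSub (K := K) B.within_lo_hi 1
  rw [lowerAll_apply g (Finset.subset_union_left) r hA,
    raiseAll_apply g.dual r (Finset.subset_union_right) hB]
  exact (isTranspose_sum _ fun S _ => lowerSet_transpose g S).apply_single A B

end Transpose

/-! ### The operators ψ_m of wedging with u_m, and their commutation with E_r and F_r. -/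

section Wedge

variable {K : Type*} [Field K] {n : ℕ} {q : K}

/-- Add a particle at `m`; this is meant for diagrams all of whose particles are below `m`. -/
noncomputable def addOp (K : Type*) [Field K] (m : ℤ) : Module.End K (Maya →₀ K) :=
  Finsupp.linearCombination K fun A => Finsupp.single (A.add m) 1

theorem addOp_single (m : ℤ) (A : Maya) (c : K) :
    addOp K m (Finsupp.single A c) = Finsupp.single (A.add m) c := by
  simp [addOp]

theorem addOp_mem {a b m : ℤ} (hm : b ≤ m) {v : Maya →₀ K} (hv : v ∈ withinSub K a b) :
    addOp K m v ∈ withinSub K a (m + 1) :=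
  map_mem_of_mem_supported hv fun A hA => by
    rw [addOp_single]; exact single_mem_withinSub (Maya.Within.add hA hm) 1

theorem passWeight_add {h : ℤ → K} {I : Finset ℤ} {A : Maya} {m : ℤ} (hm : m ∉ I) :
    passWeight h I (A.add m) = passWeight h I A :=
  passWeight_congr fun b hb => by
    have : b ≠ m := fun h => hm (h ▸ hb)
    simp [Maya.mem_add, this]

theorem passWeight_eq_one {h : ℤ → K} {I : Finset ℤ} {A : Maya} (hI : ∀ b ∈ I, b ∉ A.1) :
    passWeight h I A = 1 := by
  classical
  exact Finset.prod_eq_one fun b hb => if_neg (hI b hb)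

theorem Maya.add_move {A : Maya} {m s t : ℤ} (hs : m ≠ s) :
    (A.add m).move s t = (A.move s t).add m :=
  Maya.ext' fun x => by
    simp only [Maya.mem_move, Maya.mem_add]
    constructor
    · tauto
    · rintro (rfl | rfl | h)
      · exact Or.inr ⟨Or.inl rfl, hs⟩
      · exact Or.inl rfl
      · exact Or.inr ⟨Or.inr h.1, h.2⟩

theorem Maya.add_move_self {A : Maya} {m t : ℤ} (hm : m ∉ A.1) : (A.add m).move m t = A.add t :=
  Maya.ext' fun x => by
    simp only [Maya.mem_move, Maya.mem_add]
    constructor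
    · tauto
    · rintro (rfl | h)
      · exact Or.inl rfl
      · exact Or.inr ⟨Or.inr h, fun e => hm (e ▸ h)⟩

theorem moveOp_addOp_single {h : ℤ → K} {I : Finset ℤ} {s t m : ℤ} {A : Maya} (hs : m ≠ s)
    (ht : m ≠ t) (hI : m ∉ I) :
    moveOp h I s t (Finsupp.single (A.add m) 1) =
      addOp K m (moveOp h I s t (Finsupp.single A 1)) := by
  by_cases hA : s ∈ A.1 ∧ t ∉ A.1
  · rw [moveOp_single_of hA.1 hA.2, addOp_single, moveOp_single_of, passWeight_add hI,
      Maya.add_move hs]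
    · exact Maya.mem_add.mpr (Or.inr hA.1)
    · rw [Maya.mem_add]
      rintro (h | h)
      · exact ht h.symm
      · exact hA.2 h
  · rw [moveOp_single_of_not hA, map_zero, moveOp_single_of_not]
    simp only [Maya.mem_add]
    rintro ⟨h1 | h1, h2⟩
    · exact hs h1.symm
    · exact hA ⟨h1, fun h3 => h2 (Or.inr h3)⟩

variable (g : Twist n q)

theorem lowerOp_addOp {a m e : ℤ} (he : e < m) {v : Maya →₀ K} (hv : v ∈ withinSub K a m) :
    lowerOp g e (addOp K m v) = addOp K m (lowerOp g e v) := by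
  refine eq_of_mem_supported (f := lowerOp g e ∘ₗ addOp K m) (f' := addOp K m ∘ₗ lowerOp g e) hv
    fun A _ => ?_
  rw [LinearMap.comp_apply, LinearMap.comp_apply, addOp_single]
  exact moveOp_addOp_single (by omega) (by omega) (by simp only [Finset.mem_Ioo]; omega)

theorem lowerElem_addOp {a b m : ℤ} (r : ℕ) {v : Maya →₀ K} (hv : v ∈ withinSub K a m) :
    lowerElem g (Finset.Ico b m) r (addOp K m v) =
      addOp K m (lowerElem g (Finset.Ico b m) r v) := by
  have key : ∀ S : Finset ℤ, S ⊆ Finset.Ico b m →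
      lowerSet g S (addOp K m v) = addOp K m (lowerSet g S v) := by
    intro S
    induction S using Finset.induction_on_max with
    | empty => intro _; simp [lowerSet_empty]
    | insert k S hk ih =>
      intro hS
      have hkm := (Finset.mem_Ico.mp (hS (Finset.mem_insert_self _ _))).2
      rw [lowerSet_insert g hk, Module.End.mul_apply, Module.End.mul_apply,
        ih fun s hs => hS (Finset.mem_insert_of_mem hs), lowerOp_addOp g hkm (lowerSet_mem g S hv)]
  rw [lowerElem, LinearMap.sum_apply, LinearMap.sum_apply, map_sum]
  exact Finset.sum_congr rfl fun S hS => key S (Finset.mem_powersetCard.mp hS).1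

/-- The site m lies above all the others, so x_m is the leftmost factor of every product containing
it: the new particle is lowered last or not at all. -/
theorem lowerAll_addOp {a m : ℤ} (r : ℕ) {v : Maya →₀ K} (hv : v ∈ withinSub K a m) :
    lowerAll g (r + 1) (addOp K m v) =
      addOp K m (lowerAll g (r + 1) v) + lowerOp g m (addOp K m (lowerAll g r v)) := by
  have hv' : v ∈ withinSub K (min a m) m := withinSub_mono (min_le_left _ _) le_rfl hv
  have hI : Finset.Ico (min a m) (m + 1) = insert m (Finset.Ico (min a m) m) := by
    ext x
    have := min_le_right a m
    simp only [Finset.mem_Ico, Finset.mem_insert]; omega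
  rw [lowerAll_apply g le_rfl (r + 1) (addOp_mem le_rfl hv'), hI, lowerElem_insert g
    (fun s hs => (Finset.mem_Ico.mp hs).2), LinearMap.add_apply, Module.End.mul_apply,
    lowerElem_addOp g _ hv', lowerElem_addOp g _ hv', lowerAll_apply g le_rfl (r + 1) hv',
    lowerAll_apply g le_rfl r hv']

variable [NeZero n]

/-- With all other particles below m - n, the added particle passes nothing, and its weight is 1. -/
theorem lowerOp_addOp_self {a b m : ℤ} (hb : b + n ≤ m) {v : Maya →₀ K}
    (hv : v ∈ withinSub K a b) : lowerOp g m (addOp K m v) = addOp K (m - n) v := by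
  have hn := NeZero.pos n
  refine eq_of_mem_supported (f := lowerOp g m ∘ₗ addOp K m) hv fun A hA => ?_
  have hlt : ∀ x, m - n ≤ x → x ∉ A.1 := fun x hx h => by have := hA.2 x h; omega
  rw [LinearMap.comp_apply, addOp_single, addOp_single, lowerOp,
    moveOp_single_of (Maya.mem_add.mpr (Or.inl rfl)), Maya.add_move_self (hlt m (by omega)),
    passWeight_add (by simp), passWeight_eq_one]
  · intro b hb
    exact hlt b (by rw [Finset.mem_Ioo] at hb; omega)
  · rw [Maya.mem_add]
    rintro (h | h)
    · omega
    · exact hlt _ le_rfl h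

theorem lowerAll_addOp_of_le {a b m : ℤ} (hb : b + n ≤ m) (r : ℕ) {v : Maya →₀ K}
    (hv : v ∈ withinSub K a b) :
    lowerAll g (r + 1) (addOp K m v) =
      addOp K m (lowerAll g (r + 1) v) + addOp K (m - n) (lowerAll g r v) := by
  rw [lowerAll_addOp g r (withinSub_mono le_rfl (by omega) hv),
    lowerOp_addOp_self g hb (lowerAll_mem g r hv)]

theorem raiseOp_addOp {a b m e : ℤ} (hb : b + n ≤ m) (he : e ≠ m + n) {v : Maya →₀ K}
    (hv : v ∈ withinSub K a b) : raiseOp g e (addOp K m v) = addOp K m (raiseOp g e v) := by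
  have hn := NeZero.pos n
  refine eq_of_mem_supported (f := raiseOp g e ∘ₗ addOp K m) (f' := addOp K m ∘ₗ raiseOp g e) hv
    fun A hA => ?_
  rw [LinearMap.comp_apply, LinearMap.comp_apply, addOp_single]
  by_cases hem : e < m
  · exact moveOp_addOp_single (by omega) (by omega) (by simp only [Finset.mem_Ioo]; omega)
  · have h1 : e - n ∉ A.1 := fun h => by have := hA.2 _ h; omega
    rw [raiseOp, moveOp_single_of_not, moveOp_single_of_not, map_zero]
    · tauto
    · rw [Maya.mem_add]
      rintro ⟨h | h, -⟩
      · omega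
      · exact h1 h

theorem raiseOp_addOp_self {a b m : ℤ} (hb : b ≤ m) {v : Maya →₀ K}
    (hv : v ∈ withinSub K a b) : raiseOp g (m + n) (addOp K m v) = addOp K (m + n) v := by
  have hn := NeZero.pos n
  refine eq_of_mem_supported (f := raiseOp g (m + n) ∘ₗ addOp K m) hv fun A hA => ?_
  have hlt : ∀ x, m ≤ x → x ∉ A.1 := fun x hx h => by have := hA.2 x h; omega
  rw [LinearMap.comp_apply, addOp_single, addOp_single, raiseOp, add_sub_cancel_right,
    moveOp_single_of (Maya.mem_add.mpr (Or.inl rfl)), Maya.add_move_self (hlt m le_rfl),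
    passWeight_add (by simp), passWeight_eq_one]
  · intro b hb
    exact hlt b (by rw [Finset.mem_Ioo] at hb; omega)
  · rw [Maya.mem_add]
    rintro (h | h)
    · omega
    · exact hlt _ (by omega) h

theorem raiseElem_addOp {a b m : ℤ} {W : Finset ℤ} (hW : m + n ∉ W) {r : ℕ} (hb : b + r * n ≤ m)
    {v : Maya →₀ K} (hv : v ∈ withinSub K a b) :
    raiseElem g W r (addOp K m v) = addOp K m (raiseElem g W r v) := by
  have key : ∀ (S : Finset ℤ) (a b : ℤ) (v : Maya →₀ K), S ⊆ W → b + S.card * n ≤ m →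
      v ∈ withinSub K a b → raiseSet g S (addOp K m v) = addOp K m (raiseSet g S v) := by
    intro S
    induction S using Finset.induction_on_max with
    | empty => intro a b v _ _ _; simp [raiseSet_empty]
    | insert k S hk ih =>
      intro a b v hS hbm hv
      rw [Finset.card_insert_of_notMem fun h => (hk k h).false] at hbm
      push_cast at hbm
      have hc : (0 : ℤ) ≤ S.card * n := by positivity
      rw [raiseSet_insert g hk, Module.End.mul_apply, Module.End.mul_apply,
        raiseOp_addOp g (by linarith) (fun h => hW (h ▸ hS (Finset.mem_insert_self _ _))) hv]
      exact ih _ _ _ (fun s hs => hS (Finset.mem_insert_of_mem hs)) (by linarith)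
        (raiseOp_mem g k hv)
  rw [raiseElem, LinearMap.sum_apply, LinearMap.sum_apply, map_sum]
  refine Finset.sum_congr rfl fun S hS => ?_
  rw [Finset.mem_powersetCard] at hS
  exact key S a b v hS.1 (by rw [hS.2]; exact hb) hv

-- The upper end need only exceed the particles by n, not by r n: in y_S the highest site acts
-- first, so it must already be in reach of the original diagram, and the other sites of S lie below
-- it.
omit [NeZero n] in
theorem raiseAll_apply_Ico {a b lo hi : ℤ} (r : ℕ) (hlo : lo ≤ a - r * n) (hhi : b + n ≤ hi)
    {v : Maya →₀ K} (hv : v ∈ withinSub K a b) :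
    raiseAll g r v = raiseElem g (Finset.Ico lo hi) r v := by
  have key : ∀ k : ℕ, raiseElem g (Finset.Ico lo (hi + k)) r v =
      raiseElem g (Finset.Ico lo hi) r v := by
    intro k
    induction k with
    | zero => simp
    | succ k ih =>
      rw [← ih]
      by_cases h : lo ≤ hi + k
      · have hI : Finset.Ico lo (hi + (k + 1 : ℕ)) = insert (hi + k : ℤ) (Finset.Ico lo (hi + k)) := by
          ext x; simp only [Finset.mem_Ico, Finset.mem_insert]; push_cast; omega
        cases r with
        | zero => rw [raiseElem_zero, raiseElem_zero]
        | succ r =>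
          rw [hI, raiseElem_insert g fun s hs => (Finset.mem_Ico.mp hs).2, LinearMap.add_apply,
            Module.End.mul_apply, raiseOp_eq_zero g (by simp only [Finset.mem_Ico]; omega) hv,
            map_zero, add_zero]
      · rw [Finset.Ico_eq_empty (by push_cast; omega), Finset.Ico_eq_empty (by omega)]
  rw [← key (b + r * n - hi).toNat]
  exact raiseAll_apply g r (Finset.Ico_subset_Ico hlo (by omega)) hv

/-- The site m + n is the highest that can act and therefore acts first, directly on the new
particle. The gap (r+1) n keeps the remaining raises away from that particle. -/
theorem raiseAll_addOp_of_le {a b m : ℤ} (r : ℕ) (hb : b + (r + 1) * n ≤ m) {v : Maya →₀ K}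
    (hv : v ∈ withinSub K a b) :
    raiseAll g (r + 1) (addOp K m v) =
      addOp K m (raiseAll g (r + 1) v) + addOp K (m + n) (raiseAll g r v) := by
  have hn := NeZero.pos n
  have hrn : (0 : ℤ) ≤ r * n := by positivity
  have hbm : b ≤ m := by linarith
  set lo := min (a - (r + 1) * n) m with hlo
  have h1 := min_le_left (a - (r + 1) * n) m
  have h2 := min_le_right (a - (r + 1) * n) m
  have hI : Finset.Ico lo (m + n + 1) = insert (m + n : ℤ) (Finset.Ico lo (m + n)) := by
    ext x; simp only [Finset.mem_Ico, Finset.mem_insert]; omega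
  rw [raiseAll_apply_Ico g (r + 1) (lo := lo) (hi := m + n + 1) (by push_cast; exact h1) (by omega)
    (addOp_mem hbm hv), hI, raiseElem_insert g fun s hs => (Finset.mem_Ico.mp hs).2,
    LinearMap.add_apply, Module.End.mul_apply, raiseOp_addOp_self g hbm hv,
    raiseElem_addOp g (by simp) (by push_cast; linarith) hv,
    raiseElem_addOp g (by simp only [Finset.mem_Ico]; omega) (by linarith) hv,
    raiseAll_apply_Ico g (r + 1) (lo := lo) (hi := m + n) (by push_cast; exact h1) (by linarith) hv,
    raiseAll_apply_Ico g r (lo := lo) (hi := m + n) (by linarith) (by linarith) hv]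

/-- The iterated commutator of `lowerAll g 1` with `addOp K (m + k n)`. -/
noncomputable def addIter : ℕ → ℤ → Module.End K (Maya →₀ K)
  | 0, m => addOp K m
  | k + 1, m => lowerAll g 1 * addIter k (m + n) - addIter k (m + n) * lowerAll g 1

omit [NeZero n] in
theorem addIter_succ_apply (k : ℕ) (m : ℤ) (v : Maya →₀ K) :
    addIter g (k + 1) m v =
      lowerAll g 1 (addIter g k (m + n) v) - addIter g k (m + n) (lowerAll g 1 v) := rfl

/-- For a particle far above the rest, the commutator with E_1 just lowers it by n. Hence the
iterated commutators become stationary, and ψ_m does not depend on how far up the iteration starts.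
-/
theorem addIter_succ_eq {a b m : ℤ} {k : ℕ} (h : b ≤ m + k * n) {v : Maya →₀ K}
    (hv : v ∈ withinSub K a b) : addIter g (k + 1) m v = addIter g k m v := by
  induction k generalizing m v with
  | zero =>
    rw [addIter_succ_apply, addIter, addIter,
      lowerAll_addOp_of_le g (by simpa using h) 0 hv, lowerAll_zero, add_sub_cancel_left,
      add_sub_cancel_right, Module.End.one_apply]
  | succ k ih =>
    have h' : b ≤ m + n + k * n := by push_cast at h; linarith
    rw [addIter_succ_apply, ih h' hv, ih h' (lowerAll_mem g 1 hv), addIter_succ_apply]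

theorem addIter_add_eq {a b m : ℤ} {k : ℕ} (h : b ≤ m + k * n) {v : Maya →₀ K}
    (hv : v ∈ withinSub K a b) (j : ℕ) : addIter g (k + j) m v = addIter g k m v := by
  induction j with
  | zero => rfl
  | succ j ih =>
    have : (0 : ℤ) ≤ j * n := by positivity
    rw [← add_assoc, addIter_succ_eq g (by push_cast; linarith) hv, ih]

/-- The operator `w ↦ u_m ∧ w`. -/
noncomputable def wedgeOp (m : ℤ) : Module.End K (Maya →₀ K) :=
  Finsupp.linearCombination K fun A => addIter g (A.hi - m).toNat m (Finsupp.single A 1)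

theorem wedgeOp_apply {a b m : ℤ} {k : ℕ} (h : b ≤ m + k * n) {v : Maya →₀ K}
    (hv : v ∈ withinSub K a b) : wedgeOp g m v = addIter g k m v := by
  have hn := NeZero.pos n
  refine eq_of_mem_supported hv fun A hA => ?_
  rw [wedgeOp, Finsupp.linearCombination_single, one_smul]
  have h1 : A.hi ≤ m + (A.hi - m).toNat * n := by
    have : ((A.hi - m).toNat : ℤ) * 1 ≤ (A.hi - m).toNat * n :=
      mul_le_mul_of_nonneg_left (by omega) (by omega)
    omega
  rw [← addIter_add_eq g h1 (single_mem_withinSub A.within_lo_hi 1) k, add_comm,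
    addIter_add_eq g h (single_mem_withinSub hA 1)]

theorem wedgeOp_of_le {a b m : ℤ} (h : b ≤ m) {v : Maya →₀ K} (hv : v ∈ withinSub K a b) :
    wedgeOp g m v = addOp K m v :=
  wedgeOp_apply g (k := 0) (by simpa using h) hv

/-- This is the recursion ψ_{m-n} = [E_1, ψ_m] by which ψ was defined; stabilisation makes it valid
for every vector. -/
theorem lowerAll_one_wedgeOp (m : ℤ) (v : Maya →₀ K) :
    lowerAll g 1 (wedgeOp g m v) = wedgeOp g m (lowerAll g 1 v) + wedgeOp g (m - n) v := by
  have hn := NeZero.pos n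
  obtain ⟨a, b, hv⟩ := exists_mem_withinSub v
  set k := (b - m).toNat
  have h1 : b ≤ m + k * n := by
    have : (k : ℤ) * 1 ≤ k * n := mul_le_mul_of_nonneg_left (by omega) (by omega)
    omega
  rw [wedgeOp_apply g h1 hv, wedgeOp_apply g h1 (lowerAll_mem g 1 hv),
    wedgeOp_apply g (m := m - n) (k := k + 1) (by push_cast; linarith) hv, addIter_succ_apply,
    sub_add_cancel, add_sub_cancel]

/-- The relation is visible when m is far above the particles. It descends from m + n to m by
writing ψ_m = [E_1, ψ_{m+n}] and moving E_{r+1} through, since E_1 commutes with E_{r+1} and E_r. -/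
theorem lowerAll_wedgeOp (hq : q ≠ 0) (r : ℕ) (m : ℤ) (v : Maya →₀ K) :
    lowerAll g (r + 1) (wedgeOp g m v) =
      wedgeOp g m (lowerAll g (r + 1) v) + wedgeOp g (m - n) (lowerAll g r v) := by
  have hn := NeZero.pos n
  obtain ⟨a, b, hv⟩ := exists_mem_withinSub v
  have key : ∀ (k : ℕ) (m : ℤ) (v : Maya →₀ K), v ∈ withinSub K a b → b + n ≤ m + k * n →
      lowerAll g (r + 1) (wedgeOp g m v) =
        wedgeOp g m (lowerAll g (r + 1) v) + wedgeOp g (m - n) (lowerAll g r v) := by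
    intro k
    induction k with
    | zero =>
      intro m v hv h
      simp only [Nat.cast_zero, zero_mul, add_zero] at h
      rw [wedgeOp_of_le g (by omega) hv, wedgeOp_of_le g (by omega) (lowerAll_mem g _ hv),
        wedgeOp_of_le g (by omega) (lowerAll_mem g _ hv), lowerAll_addOp_of_le g h r hv]
    | succ k ih =>
      intro m v hv h
      have h' : b + n ≤ m + n + k * n := by push_cast at h; linarith
      have e1 := ih (m + n) v hv h'
      have e2 := ih (m + n) _ (lowerAll_mem g 1 hv) h'
      have c := fun w => DFunLike.congr_fun (lowerAll_one_comm g hq (r + 1)) w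
      have c' := fun w => DFunLike.congr_fun (lowerAll_one_comm g hq r) w
      simp only [Module.End.mul_apply] at c c'
      have d1 := lowerAll_one_wedgeOp g (m + n) v
      have d2 := lowerAll_one_wedgeOp g (m + n) (lowerAll g (r + 1) v)
      have d3 := lowerAll_one_wedgeOp g m (lowerAll g r v)
      rw [add_sub_cancel_right] at d1 d2 e1 e2
      have f := congrArg (lowerAll g (r + 1)) d1
      rw [map_add, ← c, e1, e2, map_add, d2, d3, ← c, ← c'] at f
      rw [add_assoc, add_assoc] at f
      have f1 := add_left_cancel f
      rw [add_left_comm] at f1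
      exact (add_left_cancel f1).symm
  refine key (b + n - m).toNat m v hv ?_
  have : ((b + n - m).toNat : ℤ) * 1 ≤ (b + n - m).toNat * n :=
    mul_le_mul_of_nonneg_left (by omega) (by omega)
  omega

/-- The same descent, except that E_1 and F_{r+1} commute only up to a multiple of F_r. The
correction terms cancel by the relation for smaller r, hence the strong induction. -/
theorem raiseAll_wedgeOp (r : ℕ) (m : ℤ) (v : Maya →₀ K) :
    raiseAll g (r + 1) (wedgeOp g m v) =
      wedgeOp g m (raiseAll g (r + 1) v) + wedgeOp g (m + n) (raiseAll g r v) := by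
  have hn := NeZero.pos n
  induction r using Nat.strong_induction_on generalizing m v with
  | _ r ihr =>
  obtain ⟨a, b, hv⟩ := exists_mem_withinSub v
  have hrn : (0 : ℤ) ≤ r * n := by positivity
  have key : ∀ (k : ℕ) (m : ℤ) (v : Maya →₀ K), v ∈ withinSub K a b →
      b + (r + 1) * n ≤ m + k * n →
      raiseAll g (r + 1) (wedgeOp g m v) =
        wedgeOp g m (raiseAll g (r + 1) v) + wedgeOp g (m + n) (raiseAll g r v) := by
    intro k
    induction k with
    | zero =>
      intro m v hv h
      simp only [Nat.cast_zero, zero_mul, add_zero] at h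
      rw [wedgeOp_of_le g (by linarith) hv,
        wedgeOp_of_le g (by push_cast; linarith) (raiseAll_mem g _ hv),
        wedgeOp_of_le g (by linarith) (raiseAll_mem g _ hv), raiseAll_addOp_of_le g r h hv]
    | succ k ih =>
      intro m v hv h
      have h' : b + (r + 1) * n ≤ m + n + k * n := by push_cast at h; linarith
      have e1 := ih (m + n) v hv h'
      have e2 := ih (m + n) _ (lowerAll_mem g 1 hv) h'
      have c := fun w => DFunLike.congr_fun (lowerAll_one_raiseAll g r) w
      simp only [Module.End.mul_apply, LinearMap.add_apply, LinearMap.smul_apply] at c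
      have d1 := lowerAll_one_wedgeOp g (m + n) v
      have d2 := lowerAll_one_wedgeOp g (m + n) (raiseAll g (r + 1) v)
      have d3 := lowerAll_one_wedgeOp g (m + n + n) (raiseAll g r v)
      rw [add_sub_cancel_right] at d1 d2 d3
      have f := congrArg (raiseAll g (r + 1)) d1
      have c1 := c (wedgeOp g (m + n) v)
      have c2 := congrArg (wedgeOp g (m + n)) (c v)
      rw [map_add, map_smul] at c2
      rw [map_add, e2] at f
      rw [e1, map_add, d2, d3, c2] at c1
      -- This is the cancellation of the correction terms: for r > 0 the commutator [E_1, F_r]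
      -- yields a multiple of F_{r-1}, which the relation for r - 1 turns into the commutator of F_r
      -- with ψ_{m+n}.
      have hs : wedgeOp g (m + n + n) (lowerAll g 1 (raiseAll g r v)) +
          geomSum (q ^ 2) n • wedgeOp g (m + n) (raiseAll g r v) =
          wedgeOp g (m + n + n) (raiseAll g r (lowerAll g 1 v)) +
          geomSum (q ^ 2) n • raiseAll g r (wedgeOp g (m + n) v) := by
        cases r with
        | zero => simp only [raiseAll_zero, Module.End.one_apply]
        | succ r =>
          have c' := DFunLike.congr_fun (lowerAll_one_raiseAll g r) v
          simp only [Module.End.mul_apply, LinearMap.add_apply, LinearMap.smul_apply] at c'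
          rw [c', ihr r (by omega) (m + n) v, map_add, map_smul, smul_add]
          abel
      have c3 := sub_eq_zero.mpr c1
      have f3 := sub_eq_zero.mpr f
      have s3 := sub_eq_zero.mpr hs
      rw [← sub_eq_zero]
      have : ∀ x y z w : Maya →₀ K, x = 0 → y = 0 → z = 0 → w = z - y - x → w = 0 := by
        rintro x y z w rfl rfl rfl rfl; simp
      refine this _ _ _ _ c3 f3 s3 ?_
      abel
  refine key (b + (r + 1) * n - m).toNat m v hv ?_
  have : ((b + (r + 1) * n - m).toNat : ℤ) * 1 ≤ (b + (r + 1) * n - m).toNat * n :=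
    mul_le_mul_of_nonneg_left (by omega) (by omega)
  omega

/-- An operator that commutes with all `wedgeOp`s and kills all vacua is zero. -/
theorem eq_zero_of_commute {Z : Module.End K (Maya →₀ K)}
    (h : ∀ m v, Z (wedgeOp g m v) = wedgeOp g m (Z v))
    (h0 : ∀ c, Z (Finsupp.single (Maya.sea c) 1) = 0) : Z = 0 := by
  refine maya_end_ext fun A => ?_
  rw [LinearMap.zero_apply]
  induction A using Maya.induction_top with
  | h0 c => exact h0 c
  | h1 A m hA ih =>
    obtain ⟨a, b, h'⟩ := A.exists_within
    have := h m (Finsupp.single A 1)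
    rwa [wedgeOp_of_le g le_rfl (single_mem_withinSub (a := a) (b := m) ⟨h'.1, hA⟩ 1),
      addOp_single, ih, map_zero] at this

end Wedge

/-! ### Normal ordering from symmetrised two-term relations. -/

section OrderPair

variable {K : Type*} [Field K] {n : ℕ} {q : K} {V : Type*} [AddCommGroup V]
  [Module K V]

/-- A summand of the normal ordering relation. -/
def orderTerm (n : ℕ) (B : ℤ → ℤ → V) (γ : K) (l m : ℤ) (t : ℕ) : V :=
  (if l + t * n + (m - l) % n < m - t * n - (m - l) % n then
    B (m - t * n - (m - l) % n) (l + t * n + (m - l) % n) else 0) +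
  (if l + (t + 1) * n < m - (t + 1) * n then γ • B (m - (t + 1) * n) (l + (t + 1) * n) else 0)

theorem orderTerm_eq_zero {B : ℤ → ℤ → V} {γ : K} {l m : ℤ} {t : ℕ} [NeZero n]
    (h : m - l ≤ 2 * (t * n) + 2 * ((m - l) % n)) : orderTerm n B γ l m t = 0 := by
  have h1 := Int.emod_lt_of_pos (m - l) (b := n) (by have := NeZero.pos n; omega)
  rw [orderTerm, if_neg (by omega), if_neg (by rw [add_one_mul]; omega), add_zero]

theorem orderTerm_succ {B : ℤ → ℤ → V} {γ : K} {l m : ℤ} {t : ℕ} :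
    orderTerm n B γ l m (t + 1) = orderTerm n B γ (l + n) (m - n) t := by
  have h0 : (m - n - (l + n)) % n = (m - l) % n := by
    rw [show m - n - (l + n) = m - l - n * 2 by ring, Int.sub_mul_emod_self_left]
  have h1 : m - n - t * n = m - ((t + 1 : ℕ) : ℤ) * n := by push_cast; ring
  have h2 : l + n + t * n = l + ((t + 1 : ℕ) : ℤ) * n := by push_cast; ring
  have h3 : m - n - (t + 1) * n = m - (((t + 1 : ℕ) : ℤ) + 1) * n := by push_cast; ring
  have h4 : l + n + (t + 1) * n = l + (((t + 1 : ℕ) : ℤ) + 1) * n := by push_cast; ring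
  rw [orderTerm, orderTerm, h0, h1, h2, h3, h4]

theorem linearCombination_orderPair (g : Twist n q) (B : ℤ → ℤ → V) {l m : ℤ}
    (h : ((l - m : ℤ) : ZMod n) ≠ 0) :
    Finsupp.linearCombination K (fun p : ℤ × ℤ => B p.1 p.2) (orderPair g l m) =
      g.g ((l - m : ℤ) : ZMod n) • B m l + (q ^ 2 - 1) • ∑ t ∈ Finset.range (m - l).toNat,
        (q ^ 2) ^ t • orderTerm n B (g.g ((l - m : ℤ) : ZMod n)) l m t := by
  rw [orderPair, if_neg h, map_add, map_smul, map_sum, Finsupp.linearCombination_single]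
  congr 2
  refine Finset.sum_congr rfl fun t _ => ?_
  rw [map_smul, map_add, orderTerm]
  congr 2 <;> split_ifs <;> simp

variable [NeZero n] [CharZero K]

/-- The normal ordering relations follow from their symmetrised two-term versions. -/
theorem eq_linearCombination_orderPair (g : Twist n q) (B : ℤ → ℤ → V)
    (h0 : ∀ l m : ℤ, ((l - m : ℤ) : ZMod n) = 0 → B l m + B m l = 0)
    (hs : ∀ l m : ℤ, ((l - m : ℤ) : ZMod n) ≠ 0 →
      B l m + B (m - (m - l) % n) (l + (m - l) % n) =
        g.g ((l - m : ℤ) : ZMod n) • (B m l + B (l + (m - l) % n) (m - (m - l) % n)))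
    {l m : ℤ} (hlm : l ≤ m) :
    B l m = Finsupp.linearCombination K (fun p : ℤ × ℤ => B p.1 p.2) (orderPair g l m) := by
  have hn := NeZero.pos n
  by_cases h : ((l - m : ℤ) : ZMod n) = 0
  · rw [orderPair, if_pos h, map_neg, Finsupp.linearCombination_single, one_smul,
      eq_neg_iff_add_eq_zero]
    exact h0 l m h
  rw [linearCombination_orderPair g B h]
  have key : ∀ (D : ℕ) (l m : ℤ), l ≤ m → m - l ≤ D → ((l - m : ℤ) : ZMod n) ≠ 0 →
      B l m = g.g ((l - m : ℤ) : ZMod n) • B m l + (q ^ 2 - 1) • ∑ t ∈ Finset.range D,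
        (q ^ 2) ^ t • orderTerm n B (g.g ((l - m : ℤ) : ZMod n)) l m t := by
    intro D
    induction D with
    | zero =>
      intro l m h1 h2 h3
      exact absurd (by rw [show l = m by push_cast at h2; omega, sub_self, Int.cast_zero]) h3
    | succ D ih =>
      intro l m hlm hD h
      set γ := g.g ((l - m : ℤ) : ZMod n) with hγ
      have hdvd : ¬(n : ℤ) ∣ m - l := fun hd => h (by
        rw [← neg_sub, Int.cast_neg, neg_eq_zero]
        exact (ZMod.intCast_zmod_eq_zero_iff_dvd _ n).mpr hd)
      have hi0 := Int.emod_nonneg (m - l) (b := n) (by omega)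
      have hi1 := Int.emod_lt_of_pos (m - l) (b := n) (by omega)
      have hi2 : (m - l) % n ≠ 0 := fun hz => hdvd (Int.dvd_of_emod_eq_zero hz)
      set i := (m - l) % n with hi
      have hdm := Int.emod_add_mul_ediv (m - l) n
      set k := (m - l) / n with hk
      have hcast : ((m - l : ℤ) : ZMod n) = (i : ZMod n) := by
        rw [← hdm]; push_cast; simp [hi]
      have hγi : γ = g.g (-(i : ZMod n)) := by
        rw [hγ, ← hcast, ← Int.cast_neg, neg_sub]
      have hprod : γ * g.g (i : ZMod n) = q ^ 2 := by
        rw [hγi, mul_comm]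
        refine g.g_mul_neg _ ?_
        rw [← hcast]
        exact fun hz => h (by rw [← neg_sub, Int.cast_neg, hz, neg_zero])
      have h2 : ∀ x y : V, x + x = y + y → x = y := fun x y hxy => by
        rw [← two_smul K x, ← two_smul K y] at hxy
        exact smul_right_injective V (two_ne_zero (α := K)) hxy
      have s1 := hs l m h
      rw [← hi, ← hγ] at s1
      have hk0 : 0 ≤ k := Int.ediv_nonneg (by omega) (by omega)
      -- The hypothesis is used a second time, at (l+i, m-i), whose residue is n - i. Multiplied by
      -- γ = g(l-m), with γ g(i) = v, it removes the unordered term B (l+i) (m-i), at the cost of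
      -- one involving (l+n, m-n).
      have s2 : B (l + i) (m - i) + B (m - n) (l + n) =
          g.g (i : ZMod n) • (B (m - i) (l + i) + B (l + n) (m - n)) := by
        have e : ((l + i - (m - i) : ℤ) : ZMod n) = (i : ZMod n) := by
          rw [show l + i - (m - i) = -(m - l) + i + i by ring]
          push_cast
          rw [← Int.cast_sub, hcast]; ring
        have e2 : (m - i - (l + i)) % n = n - i := by
          rw [show m - i - (l + i) = (n - i) + n * (k - 1) by linear_combination -hdm,
            Int.add_mul_emod_self_left]
          exact Int.emod_eq_of_lt (by omega) (by omega)
        have := hs (l + i) (m - i) (by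
          rw [e, ← hcast]
          exact fun hz => h (by rw [← neg_sub, Int.cast_neg, hz, neg_zero]))
        rw [e, e2] at this
        rw [show m - n = m - i - (n - i) by ring, show l + n = l + i + (n - i) by ring]
        exact this
      have hB : γ • (B (l + i) (m - i) + B (m - n) (l + n)) =
          (q ^ 2) • (B (m - i) (l + i) + B (l + n) (m - n)) := by
        rw [s2, smul_smul, hprod]
      -- If k = 0 the two terms on each side of the first relation coincide, and if k = 1 this
      -- happens in the second one; dividing by 2 ends the expansion. For k ≥ 2 the term B (l+n)
      -- (m-n) is still unordered and is expanded by induction.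
      rcases (by omega : k = 0 ∨ k = 1 ∨ 2 ≤ k) with h3 | h3 | h3
      · rw [h3] at hdm
        rw [Finset.sum_eq_zero, smul_zero, add_zero]
        · rw [show m - i = l by omega, show l + i = m by omega, smul_add] at s1
          exact h2 _ _ s1
        · intro t _
          have : (0 : ℤ) ≤ t * n := by positivity
          rw [orderTerm_eq_zero (by omega), smul_zero]
      · rw [h3] at hdm
        rw [Finset.sum_range_succ', Finset.sum_eq_zero, pow_zero, one_smul, orderTerm,
          if_pos (by push_cast; omega), if_neg (by push_cast; omega)]
        · rw [show m - i = l + n by omega, show l + i = m - n by omega] at s1 hB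
          rw [← hi, show m - (0 : ℕ) * n - i = l + n by push_cast; omega,
            show l + (0 : ℕ) * n + i = m - n by push_cast; omega]
          rw [smul_add, smul_add] at hB
          have hB' := h2 _ _ hB
          rw [smul_add, hB'] at s1
          rw [eq_sub_of_add_eq s1]
          module
        · intro t _
          have : (0 : ℤ) ≤ t * n := by positivity
          rw [orderTerm_eq_zero (by push_cast; rw [add_one_mul]; omega), smul_zero]
      · have hnk : (n : ℤ) * 2 ≤ n * k := mul_le_mul_of_nonneg_left h3 (by omega)
        have e : ((l + n - (m - n) : ℤ) : ZMod n) = ((l - m : ℤ) : ZMod n) := by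
          push_cast; simp
        have ih' := ih (l + n) (m - n) (by omega) (by push_cast at hD; omega) (by rw [e]; exact h)
        rw [e, ← hγ] at ih'
        rw [Finset.sum_range_succ', pow_zero, one_smul, orderTerm,
          if_pos (by push_cast; omega), if_pos (by push_cast; omega), ← hi]
        have hsum : ∑ t ∈ Finset.range D, (q ^ 2) ^ (t + 1) • orderTerm n B γ l m (t + 1) =
            (q ^ 2) • ∑ t ∈ Finset.range D, (q ^ 2) ^ t • orderTerm n B γ (l + n) (m - n) t := by
          rw [Finset.smul_sum]
          refine Finset.sum_congr rfl fun t _ => ?_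
          rw [orderTerm_succ, smul_smul, pow_succ']
        rw [hsum]
        set S := ∑ t ∈ Finset.range D, (q ^ 2) ^ t • orderTerm n B γ (l + n) (m - n) t
        simp only [Nat.cast_zero, zero_mul, zero_add, one_mul, sub_zero, add_zero]
        have ih2 : (q ^ 2) • B (l + n) (m - n) - (q ^ 2) • γ • B (m - n) (l + n) =
            (q ^ 2) • (q ^ 2 - 1) • S := by rw [ih']; module
        -- Here v B(l+n, m-n) - γ B(m-n, l+n) becomes (v-1) γ B(m-n, l+n) plus v times the remaining
        -- sum, which gives both the new ordered term and the geometric weights.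
        rw [smul_add, smul_smul, mul_comm, ← smul_smul, ← ih2, eq_sub_of_add_eq s1]
        have hB' := sub_eq_zero.mpr hB
        rw [← sub_eq_zero, ← hB']
        module
  exact key _ l m hlm (by omega) h

end OrderPair

/-! ### The exchange relations of ψ_l and ψ_m. -/

section TwoBody

variable {K : Type*} [Field K] {n : ℕ} {q : K} [NeZero n] (g : Twist n q)

/-- Only one commutator is needed: l + n is already above m, so ψ_l is [E_1, ·] of adding a particle
at l + n, and the surviving part is the move of this top particle. -/
theorem wedgeOp_wedgeOp_of_le {a b l m : ℤ} (hb : b ≤ l) (hlm : l ≤ m) (hm : m < l + n)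
    {v : Maya →₀ K} (hv : v ∈ withinSub K a b) :
    wedgeOp g l (wedgeOp g m v) = lowerOp g (l + n) (addOp K (l + n) (addOp K m v)) := by
  have h1 := addOp_mem (hb.trans hlm) hv
  rw [wedgeOp_of_le g (hb.trans hlm) hv, wedgeOp_apply g (k := 1) (by push_cast; omega) h1,
    addIter_succ_apply, addIter, lowerAll_addOp g 0 (withinSub_mono le_rfl (by omega) h1),
    lowerAll_zero, Module.End.one_apply, add_sub_cancel_left]

/-- The particle lowered from l + n to l passes only the particle at m, whose factor is g(l+n-m) =
g(l-m). -/
theorem wedgeOp_wedgeOp_near {a b l m : ℤ} (hb : b ≤ l) (hlm : l < m) (hm : m < l + n)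
    {v : Maya →₀ K} (hv : v ∈ withinSub K a b) :
    wedgeOp g l (wedgeOp g m v) = g.g ((l - m : ℤ) : ZMod n) • wedgeOp g m (wedgeOp g l v) := by
  classical
  rw [wedgeOp_wedgeOp_of_le g hb hlm.le hm hv, wedgeOp_of_le g hb hv,
    wedgeOp_of_le g (by omega) (addOp_mem hb hv)]
  refine eq_of_mem_supported (f := lowerOp g (l + n) ∘ₗ addOp K (l + n) ∘ₗ addOp K m)
    (f' := g.g ((l - m : ℤ) : ZMod n) • addOp K m ∘ₗ addOp K l) hv fun A hA => ?_
  have hlt : ∀ x, l ≤ x → x ∉ A.1 := fun x hx h => by have := hA.2 x h; omega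
  have hn : l + n ∉ (A.add m).1 := by
    rw [Maya.mem_add]
    rintro (h | h)
    · omega
    · exact hlt _ (by omega) h
  simp only [LinearMap.comp_apply, LinearMap.smul_apply, addOp_single]
  rw [lowerOp, moveOp_single_of (Maya.mem_add.mpr (Or.inl rfl)), Maya.add_move_self hn,
    add_sub_cancel_right, A.add_comm]
  · rw [passWeight, Finset.prod_eq_single m]
    · rw [if_pos (by simp [Maya.mem_add])]
      push_cast
      simp
    · intro x hx hxm
      rw [Finset.mem_Ioo] at hx
      refine if_neg ?_
      simp only [Maya.mem_add]
      rintro (h | h | h)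
      · omega
      · exact hxm h
      · exact hlt _ (by omega) h
    · intro h
      exact absurd (Finset.mem_Ioo.mpr ⟨by omega, hm⟩) h
  · simp only [Maya.mem_add]
    rintro (h | h | h)
    · omega
    · omega
    · exact hlt _ (by omega) h

theorem wedgeOp_wedgeOp_self_of_le {a b l : ℤ} (hb : b ≤ l) {v : Maya →₀ K}
    (hv : v ∈ withinSub K a b) : wedgeOp g l (wedgeOp g l v) = 0 := by
  have hn := NeZero.pos n
  rw [wedgeOp_wedgeOp_of_le g hb le_rfl (by omega) hv]
  refine eq_zero_of_mem_supported (f := lowerOp g (l + n) ∘ₗ addOp K (l + n) ∘ₗ addOp K l) hv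
    fun A hA => ?_
  simp only [LinearMap.comp_apply, addOp_single]
  rw [lowerOp, moveOp_single_of_not]
  rintro ⟨-, h⟩
  exact h (by simp [Maya.mem_add])

/-- The defect of a symmetrised exchange relation. -/
noncomputable def exchange (κ : K) (l m : ℤ) (i j : ℕ) (v : Maya →₀ K) : Maya →₀ K :=
  (wedgeOp g (l - i * n) (wedgeOp g (m - j * n) v) +
    wedgeOp g (l - j * n) (wedgeOp g (m - i * n) v)) -
  κ • (wedgeOp g (m - i * n) (wedgeOp g (l - j * n) v) +
    wedgeOp g (m - j * n) (wedgeOp g (l - i * n) v))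

omit [NeZero n] in
theorem exchange_symm (κ : K) (l m : ℤ) (i j : ℕ) (v : Maya →₀ K) :
    exchange g κ l m i j v = exchange g κ l m j i v := by
  rw [exchange, exchange, add_comm, add_comm (wedgeOp g (m - i * n) _)]

omit [NeZero n] in
theorem sub_succ_mul (l : ℤ) (i : ℕ) : l - i * (n : ℤ) - n = l - ((i + 1 : ℕ) : ℤ) * n := by
  push_cast; ring

theorem lowerAll_one_exchange (κ : K) (l m : ℤ) (i j : ℕ) (v : Maya →₀ K) :
    lowerAll g 1 (exchange g κ l m i j v) = exchange g κ l m i j (lowerAll g 1 v) +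
      (exchange g κ l m (i + 1) j v + exchange g κ l m i (j + 1) v) := by
  simp only [exchange, map_sub, map_add, map_smul, lowerAll_one_wedgeOp, sub_succ_mul]
  module

theorem lowerAll_two_exchange (hq : q ≠ 0) (κ : K) (l m : ℤ) (i j : ℕ) (v : Maya →₀ K) :
    lowerAll g 2 (exchange g κ l m i j v) = exchange g κ l m i j (lowerAll g 2 v) +
      exchange g κ l m (i + 1) (j + 1) v +
      (exchange g κ l m (i + 1) j (lowerAll g 1 v) + exchange g κ l m i (j + 1) (lowerAll g 1 v)) := by
  have h2 : ∀ m v, lowerAll g 2 (wedgeOp g m v) =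
      wedgeOp g m (lowerAll g 2 v) + wedgeOp g (m - n) (lowerAll g 1 v) :=
    fun m v => lowerAll_wedgeOp g hq 1 m v
  simp only [exchange, map_sub, map_add, map_smul, h2, lowerAll_one_wedgeOp, sub_succ_mul]
  module

theorem exists_shift_ge (b l : ℤ) : ∃ k : ℕ, b ≤ l + k * n := by
  have hn := NeZero.pos n
  refine ⟨(b - l).toNat, ?_⟩
  have : ((b - l).toNat : ℤ) * 1 ≤ (b - l).toNat * n :=
    mul_le_mul_of_nonneg_left (by omega) (by omega)
  omega

variable [CharZero K]

/-- Write X_{ij} for the defect. The commutator with E_1 produces X_{i+1,j} + X_{i,j+1}; with E_2 it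
produces X_{i+1,j+1} plus terms of the former kind. So E_2 moves the vanishing of X_{00} along the
diagonal. E_1 then moves it away from the diagonal, where the symmetry X_{ij} = X_{ji} and division
by 2 give the first step. -/
theorem exchange_eq_zero (hq : q ≠ 0) {κ : K} {l m b : ℤ}
    (h : ∀ a, ∀ v ∈ withinSub K a b, wedgeOp g l (wedgeOp g m v) = κ • wedgeOp g m (wedgeOp g l v))
    (i j : ℕ) {a : ℤ} {v : Maya →₀ K} (hv : v ∈ withinSub K a b) :
    exchange g κ l m i j v = 0 := by
  have h00 : ∀ a, ∀ v ∈ withinSub K a b, exchange g κ l m 0 0 v = 0 := fun a v hv => by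
    simp only [exchange, Nat.cast_zero, zero_mul, sub_zero, h a v hv, smul_add, sub_self]
  have h1 : ∀ i j, (∀ a, ∀ v ∈ withinSub K a b, exchange g κ l m i j v = 0) →
      ∀ a, ∀ v ∈ withinSub K a b,
        exchange g κ l m (i + 1) j v + exchange g κ l m i (j + 1) v = 0 := fun i j hij a v hv => by
    have := lowerAll_one_exchange g κ l m i j v
    rwa [hij a v hv, hij _ _ (lowerAll_mem g 1 hv), map_zero, zero_add, eq_comm] at this
  have h2 : ∀ i j, (∀ a, ∀ v ∈ withinSub K a b, exchange g κ l m i j v = 0) →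
      ∀ a, ∀ v ∈ withinSub K a b, exchange g κ l m (i + 1) (j + 1) v = 0 := fun i j hij a v hv => by
    have := lowerAll_two_exchange g hq κ l m i j v
    rwa [hij a v hv, hij _ _ (lowerAll_mem g 2 hv), h1 i j hij _ _ (lowerAll_mem g 1 hv),
      map_zero, zero_add, add_zero, eq_comm] at this
  have hd : ∀ i a, ∀ v ∈ withinSub K a b, exchange g κ l m i i v = 0 := fun i => by
    induction i with
    | zero => exact h00
    | succ i ih => exact h2 i i ih
  have key : ∀ d i a, ∀ v ∈ withinSub K a b, exchange g κ l m (i + d) i v = 0 := by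
    intro d
    induction d using Nat.strong_induction_on with
    | _ d ih =>
      intro i a v hv
      match d with
      | 0 => exact hd i a v hv
      | 1 =>
        have := h1 i i (hd i) a v hv
        rw [exchange_symm g κ l m i (i + 1), ← two_smul K, smul_eq_zero] at this
        exact this.resolve_left two_ne_zero
      | d + 2 =>
        have := h1 (i + (d + 1)) i (ih (d + 1) (by omega) i) a v hv
        rwa [show i + (d + 1) = i + 1 + d by ring, ih d (by omega) (i + 1) a v hv, add_zero,
          show i + 1 + d + 1 = i + (d + 2) by ring] at this
  rcases le_total j i with hij | hij
  · obtain ⟨d, rfl⟩ := Nat.exists_eq_add_of_le hij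
    exact key d j a v hv
  · obtain ⟨d, rfl⟩ := Nat.exists_eq_add_of_le hij
    rw [exchange_symm]
    exact key d i a v hv

theorem wedgeOp_swap_of_eq (hq : q ≠ 0) {l m : ℤ} (h : ((l - m : ℤ) : ZMod n) = 0)
    (v : Maya →₀ K) :
    wedgeOp g l (wedgeOp g m v) + wedgeOp g m (wedgeOp g l v) = 0 := by
  obtain ⟨a, b, hv⟩ := exists_mem_withinSub v
  obtain ⟨k, hk⟩ := exists_shift_ge (n := n) b l
  obtain ⟨d, hd⟩ : (n : ℤ) ∣ m - l := (ZMod.intCast_zmod_eq_zero_iff_dvd _ n).mp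
    (by rw [← neg_sub, Int.cast_neg, h, neg_zero])
  -- Both indices are shifts, by multiples of n, of one index L above all particles; the positive
  -- and negative parts of d keep both numbers of shifts natural.
  have hL : ∃ i j : ℕ, ∃ L, b ≤ L ∧ l = L - i * n ∧ m = L - j * n := by
    refine ⟨k + d.toNat, k + (-d).toNat, l + (k + d.toNat) * n, ?_, ?_, ?_⟩
    · have : (0 : ℤ) ≤ d.toNat * n := by positivity
      linarith
    · push_cast; ring
    · have h1 : (d.toNat : ℤ) - (-d).toNat = d := by omega
      rw [eq_add_of_sub_eq hd]
      push_cast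
      linear_combination (-n : ℤ) * h1
  obtain ⟨i, j, L, hbL, rfl, rfl⟩ := hL
  have := exchange_eq_zero g hq (κ := -1) (l := L) (m := L) (b := b) (fun a v hv => by
    rw [wedgeOp_wedgeOp_self_of_le g hbL hv, smul_zero]) i j hv
  rw [exchange, neg_smul, one_smul, sub_neg_eq_add, ← two_smul K, smul_eq_zero] at this
  exact this.resolve_left two_ne_zero

theorem wedgeOp_swap_of_ne (hq : q ≠ 0) {l m : ℤ} (h : ((l - m : ℤ) : ZMod n) ≠ 0)
    (v : Maya →₀ K) :
    wedgeOp g l (wedgeOp g m v) +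
        wedgeOp g (m - (m - l) % n) (wedgeOp g (l + (m - l) % n) v) =
      g.g ((l - m : ℤ) : ZMod n) • (wedgeOp g m (wedgeOp g l v) +
        wedgeOp g (l + (m - l) % n) (wedgeOp g (m - (m - l) % n) v)) := by
  have hn := NeZero.pos n
  obtain ⟨a, b, hv⟩ := exists_mem_withinSub v
  have hdvd : ¬(n : ℤ) ∣ m - l := fun hd => h (by
    rw [← neg_sub, Int.cast_neg, neg_eq_zero]
    exact (ZMod.intCast_zmod_eq_zero_iff_dvd _ n).mpr hd)
  have hi0 := Int.emod_nonneg (m - l) (b := n) (by omega)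
  have hi1 := Int.emod_lt_of_pos (m - l) (b := n) (by omega)
  have hi2 : (m - l) % n ≠ 0 := fun hz => hdvd (Int.dvd_of_emod_eq_zero hz)
  set e := (m - l) % n with he
  have hdm := Int.emod_add_mul_ediv (m - l) n
  set d := (m - l) / n with hd
  obtain ⟨k, hk⟩ := exists_shift_ge (n := n) b l
  -- With i - j = d, the pair (l, m) consists of shifts of the neighbouring pair (L, L + e), and the
  -- symmetrised partner is (m - e, l + e).
  set i := k + d.toNat
  set j := k + (-d).toNat
  set L := l + i * n with hL
  have hbL : b ≤ L := by
    have : (0 : ℤ) ≤ d.toNat * n := by positivity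
    simp only [hL, i]; push_cast; linarith
  have h1 : (i : ℤ) - j = d := by simp only [i, j]; push_cast; omega
  have e1 : l = L - i * n := by rw [hL]; ring
  have e2 : m = L + e - j * n := by rw [hL]; linear_combination -hdm - (n : ℤ) * h1
  have e3 : m - e = L - j * n := by rw [e2]; ring
  have e4 : l + e = L + e - i * n := by rw [hL]; ring
  have ec : ((l - m : ℤ) : ZMod n) = ((L - (L + e) : ℤ) : ZMod n) := by
    rw [e2]
    rw [hL]; push_cast; simp
  have := exchange_eq_zero g hq (κ := g.g ((l - m : ℤ) : ZMod n)) (l := L) (m := L + e) (b := b)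
    (fun a v hv => by
      rw [ec]
      exact wedgeOp_wedgeOp_near g hbL (by omega) (by omega) hv) i j hv
  rw [exchange, sub_eq_zero, ← e3, ← e4, ← e1, ← e2] at this
  rw [this, add_comm (wedgeOp g m _)]

/-- The operators `wedgeOp` satisfy the normal ordering relations. -/
theorem wedgeOp_orderPair (hq : q ≠ 0) {l m : ℤ} (hlm : l ≤ m) (v : Maya →₀ K) :
    wedgeOp g l (wedgeOp g m v) =
      Finsupp.linearCombination K (fun p : ℤ × ℤ => wedgeOp g p.1 (wedgeOp g p.2 v))
        (orderPair g l m) :=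
  eq_linearCombination_orderPair g (fun l m => wedgeOp g l (wedgeOp g m v))
    (fun _ _ h => wedgeOp_swap_of_eq g hq h v) (fun _ _ h => wedgeOp_swap_of_ne g hq h v) hlm

end TwoBody

/-! ### Newton's identities for operators. -/

section Newton

variable {K A : Type*} [CommRing K] [Ring A] [Algebra K A]

/-- The (signed) power sums attached to a sequence of elementary symmetric functions by Newton's
identities: `newton K U k` is `(-1) ^ k p_{k + 1}` when `U r` is `e_r`. -/
def newton (K : Type*) {A : Type*} [CommRing K] [Ring A] [Algebra K A] (U : ℕ → A) (k : ℕ) : A :=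
  (k + 1 : K) • U (k + 1) - ∑ i : Fin k, U (k - i) * newton K U i
termination_by k
decreasing_by exact i.2

theorem newton_eq (U : ℕ → A) (k : ℕ) :
    newton K U k = (k + 1 : K) • U (k + 1) -
      ∑ i ∈ Finset.range k, U (k - i) * newton K U i := by
  rw [newton, Finset.sum_range]

theorem newton_sum {U : ℕ → A} (h0 : U 0 = 1) (k : ℕ) :
    ∑ i ∈ Finset.range (k + 1), U (k - i) * newton K U i = (k + 1 : K) • U (k + 1) := by
  rw [Finset.sum_range_succ, Nat.sub_self, h0, one_mul, newton_eq U k, add_sub_cancel]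

/-- If ∑ U_r t^r multiplies the generating function of ψ by 1 + t·(shift), its logarithmic
derivative acts on ψ as a derivation. No commutativity of the U_r is needed: in the recursion the
cross terms telescope, and what is left of them is absorbed by Newton's identity for k - 1. -/
theorem newton_mul_shift {U : ℕ → A} (h0 : U 0 = 1) {ψ : ℤ → A} {s : ℤ}
    (h : ∀ r m, U (r + 1) * ψ m = ψ m * U (r + 1) + ψ (m - s) * U r) (k : ℕ) (m : ℤ) :
    newton K U k * ψ m = ψ m * newton K U k + (-1 : K) ^ k • ψ (m - (k + 1) * s) := by
  induction k using Nat.strong_induction_on generalizing m with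
  | _ k ih =>
  have hterm : ∀ i ∈ Finset.range k, U (k - i) * newton K U i * ψ m =
      ψ m * (U (k - i) * newton K U i) + ψ (m - s) * (U (k - 1 - i) * newton K U i) +
      ((-1 : K) ^ i • (ψ (m - ((i : ℕ) + 1) * s) * U (k - i)) -
        (-1 : K) ^ (i + 1) • (ψ (m - ((i + 1 : ℕ) + 1) * s) * U (k - (i + 1)))) := by
    intro i hi
    rw [Finset.mem_range] at hi
    obtain ⟨r, rfl⟩ : ∃ r, k = i + (r + 1) := ⟨k - i - 1, by omega⟩
    have e1 : i + (r + 1) - i = r + 1 := by omega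
    have e2 : i + (r + 1) - 1 - i = r := by omega
    have e3 : i + (r + 1) - (i + 1) = r := by omega
    have e4 : m - (i + 1) * s - s = m - ((i + 1 : ℕ) + 1) * s := by push_cast; ring
    rw [e1, e2, e3, mul_assoc, ih i hi m, mul_add, mul_smul_comm, h, ← mul_assoc, h, e4, add_mul,
      mul_assoc, mul_assoc, pow_succ]
    module
  rw [newton_eq U k, sub_mul, smul_mul_assoc, h, Finset.sum_mul, Finset.sum_congr rfl hterm,
    Finset.sum_add_distrib, Finset.sum_add_distrib,
    Finset.sum_range_sub' (fun i : ℕ => (-1 : K) ^ i • (ψ (m - ((i : ℕ) + 1) * s) * U (k - i))),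
    ← Finset.mul_sum, ← Finset.mul_sum]
  have hk : ∑ i ∈ Finset.range k, U (k - 1 - i) * newton K U i = (k : K) • U k := by
    cases k with
    | zero => simp
    | succ k =>
      rw [Nat.add_sub_cancel, newton_sum h0]
      push_cast; rfl
  rw [hk, Nat.sub_self, h0, pow_zero, one_smul, mul_one, Nat.sub_zero, Nat.cast_zero, zero_add,
    one_mul, mul_sub, mul_smul_comm, mul_smul_comm]
  module

end Newton

/-! ### Power sums of the E_r and of the F_r, their commutation and transposition. -/

section Current

variable {K : Type*} [Field K] {n : ℕ} {q : K} (g : Twist n q)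

/-- The operator that lowers one particle by `(k + 1) n`, up to the sign `(-1) ^ k`. -/
noncomputable def lowerCur (k : ℕ) : Module.End K (Maya →₀ K) :=
  newton K (lowerAll g) k

/-- The operator that raises one particle by `(k + 1) n`, up to the sign `(-1) ^ k`. -/
noncomputable def raiseCur (k : ℕ) : Module.End K (Maya →₀ K) :=
  newton K (raiseAll g) k

theorem lowerCur_sum (k : ℕ) (v : Maya →₀ K) :
    ∑ i ∈ Finset.range (k + 1), lowerAll g (k - i) (lowerCur g i v) =
      ((k : K) + 1) • lowerAll g (k + 1) v := by
  have := DFunLike.congr_fun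
    (newton_sum (K := K) (U := lowerAll g) (lowerAll_zero g) k) v
  rwa [LinearMap.sum_apply] at this

theorem raiseCur_sum (k : ℕ) (v : Maya →₀ K) :
    ∑ i ∈ Finset.range (k + 1), raiseAll g (k - i) (raiseCur g i v) =
      ((k : K) + 1) • raiseAll g (k + 1) v := by
  have := DFunLike.congr_fun
    (newton_sum (K := K) (U := raiseAll g) (raiseAll_zero g) k) v
  rwa [LinearMap.sum_apply] at this

theorem lowerCur_apply (k : ℕ) (v : Maya →₀ K) :
    lowerCur g k v = ((k : K) + 1) • lowerAll g (k + 1) v -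
      ∑ i ∈ Finset.range k, lowerAll g (k - i) (lowerCur g i v) := by
  rw [← lowerCur_sum, Finset.sum_range_succ, Nat.sub_self, lowerAll_zero, Module.End.one_apply,
    add_sub_cancel_left]

theorem raiseCur_apply (k : ℕ) (v : Maya →₀ K) :
    raiseCur g k v = ((k : K) + 1) • raiseAll g (k + 1) v -
      ∑ i ∈ Finset.range k, raiseAll g (k - i) (raiseCur g i v) := by
  rw [← raiseCur_sum, Finset.sum_range_succ, Nat.sub_self, raiseAll_zero, Module.End.one_apply,
    add_sub_cancel_left]

theorem lowerCur_eq_zero {v : Maya →₀ K} (h : ∀ r, lowerAll g (r + 1) v = 0) (k : ℕ) :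
    lowerCur g k v = 0 := by
  induction k using Nat.strong_induction_on with
  | _ k ih =>
    rw [lowerCur_apply, h, smul_zero, Finset.sum_eq_zero, sub_zero]
    intro i hi
    rw [ih i (Finset.mem_range.mp hi), map_zero]

theorem lowerAll_sea (r : ℕ) (c : ℤ) : lowerAll g (r + 1) (Finsupp.single (Maya.sea c) 1) = 0 := by
  rw [lowerAll_apply g (W := ∅) (by simp) (r + 1)
    (single_mem_withinSub (Maya.sea_within c) 1), lowerElem, Finset.powersetCard_eq_empty.mpr
    (by simp), Finset.sum_empty, LinearMap.zero_apply]

theorem lowerCur_sea (k : ℕ) (c : ℤ) : lowerCur g k (Finsupp.single (Maya.sea c) 1) = 0 :=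
  lowerCur_eq_zero g (fun r => lowerAll_sea g r c) k

variable [NeZero n]

theorem lowerCur_wedgeOp (hq : q ≠ 0) (k : ℕ) (m : ℤ) (v : Maya →₀ K) :
    lowerCur g k (wedgeOp g m v) =
      wedgeOp g m (lowerCur g k v) + (-1 : K) ^ k • wedgeOp g (m - (k + 1) * n) v := by
  have := DFunLike.congr_fun (newton_mul_shift (K := K) (U := lowerAll g) (lowerAll_zero g) (ψ := wedgeOp g) (s := n)
    (fun r m => LinearMap.ext fun v => lowerAll_wedgeOp g hq r m v) k m) v
  exact this

theorem raiseCur_wedgeOp (k : ℕ) (m : ℤ) (v : Maya →₀ K) :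
    raiseCur g k (wedgeOp g m v) =
      wedgeOp g m (raiseCur g k v) + (-1 : K) ^ k • wedgeOp g (m + (k + 1) * n) v := by
  have := DFunLike.congr_fun (newton_mul_shift (K := K) (U := raiseAll g) (raiseAll_zero g) (ψ := wedgeOp g) (s := -n)
    (fun r m => LinearMap.ext fun v => by
      rw [sub_neg_eq_add]; exact raiseAll_wedgeOp g r m v) k m) v
  rwa [mul_neg, sub_neg_eq_add] at this

/-- `eq_zero_of_commute` for a commutator: two operators commute once their commutator passes
through all ψ_m and they commute on vacua. -/
theorem comm_of_comm_wedgeOp {P Q : Module.End K (Maya →₀ K)}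
    (h : ∀ m v, P (Q (wedgeOp g m v)) - Q (P (wedgeOp g m v)) = wedgeOp g m (P (Q v) - Q (P v)))
    (h0 : ∀ c, P (Q (Finsupp.single (Maya.sea c) 1)) = Q (P (Finsupp.single (Maya.sea c) 1)))
    (v : Maya →₀ K) : P (Q v) = Q (P v) := by
  have : P * Q - Q * P = 0 := eq_zero_of_commute g h fun c => sub_eq_zero.mpr (h0 c)
  exact sub_eq_zero.mp (DFunLike.congr_fun this v)

/-- In the commutator with ψ_m the terms in which both operators act on ψ_m cancel. The terms in
which E_{r+1} shifts ψ_m leave a commutator with E_r, zero by induction. -/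
theorem lowerAll_lowerCur (hq : q ≠ 0) (r k : ℕ) (v : Maya →₀ K) :
    lowerAll g r (lowerCur g k v) = lowerCur g k (lowerAll g r v) := by
  induction r generalizing v with
  | zero => rw [lowerAll_zero]; rfl
  | succ r ih =>
    refine comm_of_comm_wedgeOp g (fun m v => ?_) (fun c => ?_) v
    · simp only [lowerCur_wedgeOp g hq, lowerAll_wedgeOp g hq, map_add, map_smul, map_sub, ih]
      rw [sub_right_comm m]
      module
    · rw [lowerCur_sea, map_zero, lowerAll_sea, map_zero]

theorem lowerCur_comm (hq : q ≠ 0) (k l : ℕ) (v : Maya →₀ K) :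
    lowerCur g k (lowerCur g l v) = lowerCur g l (lowerCur g k v) := by
  refine comm_of_comm_wedgeOp g (fun m v => ?_) (fun c => ?_) v
  · simp only [lowerCur_wedgeOp g hq, map_add, map_smul, map_sub]
    rw [sub_right_comm m, smul_add, smul_add, smul_comm]
    module
  · rw [lowerCur_sea, map_zero, lowerCur_sea, map_zero]

omit [NeZero n] in
theorem Twist.dual_dual : g.dual.dual = g := by
  cases g; simp [Twist.dual]

/-- Transposition reverses the products E_{k-i} p_i in Newton's recursion; they regain the original
order because E and p commute. -/
theorem lowerCur_transpose (hq : q ≠ 0) (k : ℕ) :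
    IsTranspose (lowerCur g k) (raiseCur g.dual k) := by
  induction k using Nat.strong_induction_on with
  | _ k ih =>
    intro v w
    rw [raiseCur_apply, lowerCur_apply, map_sub, map_sub, LinearMap.sub_apply, map_smul, map_smul,
      LinearMap.smul_apply, lowerAll_transpose g (k + 1) v w, map_sum, map_sum, LinearMap.sum_apply]
    congr 1
    refine Finset.sum_congr rfl fun i hi => ?_
    rw [lowerAll_lowerCur g hq, ih i (Finset.mem_range.mp hi), lowerAll_transpose]

theorem raiseCur_transpose (hq : q ≠ 0) (k : ℕ) :
    IsTranspose (raiseCur g k) (lowerCur g.dual k) := by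
  have := (lowerCur_transpose g.dual hq k).symm
  rwa [Twist.dual_dual] at this

/-- Raising operators do not kill vacua, so this is taken from the lowering operators of the dual
twist by transposition. -/
theorem raiseCur_comm (hq : q ≠ 0) (k l : ℕ) (v : Maya →₀ K) :
    raiseCur g k (raiseCur g l v) = raiseCur g l (raiseCur g k v) := by
  have h1 := (raiseCur_transpose g hq k).mul (raiseCur_transpose g hq l)
  have h2 := (raiseCur_transpose g hq l).mul (raiseCur_transpose g hq k)
  have h3 : lowerCur g.dual l * lowerCur g.dual k = lowerCur g.dual k * lowerCur g.dual l :=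
    LinearMap.ext fun v => lowerCur_comm g.dual hq l k v
  rw [h3] at h1
  exact DFunLike.congr_fun (h1.symm.unique h2.symm) v

/-- Both act on ψ_m by shifts of the index, and shifts commute; so the commutator passes through
ψ_m, whatever its value. -/
theorem lowerCur_raiseCur_wedgeOp (hq : q ≠ 0) (k l : ℕ) (m : ℤ) (v : Maya →₀ K) :
    lowerCur g k (raiseCur g l (wedgeOp g m v)) - raiseCur g l (lowerCur g k (wedgeOp g m v)) =
      wedgeOp g m (lowerCur g k (raiseCur g l v) - raiseCur g l (lowerCur g k v)) := by
  simp only [lowerCur_wedgeOp g hq, raiseCur_wedgeOp, map_add, map_smul, map_sub]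
  rw [sub_add_eq_add_sub m, smul_add, smul_add, smul_comm]
  module

end Current

/-! ### The energy grading. -/

section Energy

open Classical in
/-- The contribution of the site `x` to the energy of a Maya diagram relative to `sea c`. -/
noncomputable def energyTerm (c : ℤ) (A : Maya) (x : ℤ) : ℤ :=
  ((if x ∈ A.1 then 1 else 0) - (if x < c then 1 else 0)) * (2 * (x - c) + 1)

/-- The energy of a Maya diagram relative to `sea c`. -/
noncomputable def energy (c : ℤ) (A : Maya) : ℤ := ∑ᶠ x, energyTerm c A x

theorem energyTerm_support {c a b : ℤ} {A : Maya} (h : A.Within a b) :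
    Function.support (energyTerm c A) ⊆ (Finset.Ico (min a c) (max b c) : Finset ℤ) := by
  classical
  intro x hx
  rw [Function.mem_support, energyTerm] at hx
  rw [Finset.coe_Ico, Set.mem_Ico]
  by_contra hx'
  refine hx ?_
  by_cases h1 : x < min a c
  · rw [if_pos (h.1 x (lt_of_lt_of_le h1 (min_le_left _ _))),
      if_pos (lt_of_lt_of_le h1 (min_le_right _ _)), sub_self, zero_mul]
  · have h2 : max b c ≤ x := by
      by_contra h2
      exact hx' ⟨not_lt.mp h1, not_le.mp h2⟩
    rw [if_neg fun h3 => absurd (h.2 x h3) (not_lt.mpr ((le_max_left _ _).trans h2)),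
      if_neg (not_lt.mpr ((le_max_right _ _).trans h2)), sub_self, zero_mul]

theorem energyTerm_support_finite (c : ℤ) (A : Maya) :
    (Function.support (energyTerm c A)).Finite :=
  (Finset.finite_toSet _).subset (energyTerm_support A.within_lo_hi)

/-- Particles at x ≥ c and holes at x < c both count positively: the occupation difference and
2(x-c)+1 have the same sign. The odd number is never 0, so only the vacuum has energy 0. -/
theorem energyTerm_nonneg (c : ℤ) (A : Maya) (x : ℤ) : 0 ≤ energyTerm c A x := by
  rw [energyTerm]
  split_ifs <;> nlinarith

theorem energy_nonneg (c : ℤ) (A : Maya) : 0 ≤ energy c A :=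
  finsum_nonneg fun x => energyTerm_nonneg c A x

theorem eq_sea_of_energy_eq_zero {c : ℤ} {A : Maya} (h : energy c A = 0) : A = Maya.sea c := by
  classical
  refine Maya.ext' fun x => ?_
  rw [Maya.mem_sea]
  have hx : energyTerm c A x = 0 := by
    refine le_antisymm ?_ (energyTerm_nonneg c A x)
    rw [← h]
    exact single_le_finsum x (energyTerm_support_finite c A) fun y => energyTerm_nonneg c A y
  rw [energyTerm, mul_eq_zero] at hx
  rcases hx with hx | hx
  · split_ifs at hx <;> simp_all
  · omega

theorem energy_sea (c : ℤ) : energy c (Maya.sea c) = 0 := by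
  classical
  rw [energy, finsum_eq_zero_of_forall_eq_zero]
  intro x
  rw [energyTerm]
  simp [Maya.mem_sea]

theorem energy_move (c : ℤ) {A : Maya} {s t : ℤ} (hs : s ∈ A.1) (ht : t ∉ A.1) :
    energy c (A.move s t) = energy c A + 2 * (t - s) := by
  classical
  have hst : s ≠ t := fun h => ht (h ▸ hs)
  have h1 : ∀ x, energyTerm c (A.move s t) x = energyTerm c A x +
      ((if x = t then 2 * (t - c) + 1 else 0) + (if x = s then -(2 * (s - c) + 1) else 0)) := by
    intro x
    simp only [energyTerm, Maya.mem_move]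
    by_cases hxt : x = t
    · subst hxt
      simp only [true_or, if_true, if_neg ht, if_neg hst.symm]
      ring
    · by_cases hxs : x = s
      · subst hxs
        simp only [hxt, hs, ne_eq, not_true_eq_false, and_false, or_false, if_false, if_true]
        ring
      · simp [hxt, hxs]
  have f1 : (Function.support fun x : ℤ => if x = t then 2 * (t - c) + 1 else 0).Finite :=
    (Set.finite_singleton t).subset fun x hx => by
      by_contra h
      exact hx (if_neg h)
  have f2 : (Function.support fun x : ℤ => if x = s then -(2 * (s - c) + 1) else 0).Finite :=
    (Set.finite_singleton s).subset fun x hx => by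
      by_contra h
      exact hx (if_neg h)
  rw [energy, finsum_congr h1, finsum_add_distrib (energyTerm_support_finite c A)
    ((f1.union f2).subset (Function.support_add _ _)), finsum_add_distrib f1 f2,
    finsum_eq_single _ t (fun x hx => if_neg hx), finsum_eq_single _ s (fun x hx => if_neg hx),
    if_pos rfl, if_pos rfl, energy]
  ring

/-- The span of the Maya diagrams with a given energy. -/
def energySub (K : Type*) [Field K] (c E : ℤ) : Submodule K (Maya →₀ K) :=
  Finsupp.supported K K {A | energy c A = E}

variable {K : Type*} [Field K] {n : ℕ} {q : K}

theorem single_mem_energySub (c : ℤ) (A : Maya) (x : K) :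
    Finsupp.single A x ∈ energySub K c (energy c A) :=
  Finsupp.single_mem_supported K x rfl

theorem eq_zero_of_mem_energySub {c E : ℤ} (hE : E < 0) {v : Maya →₀ K}
    (hv : v ∈ energySub K c E) : v = 0 := by
  refine Finsupp.support_eq_empty.mp (Finset.eq_empty_of_forall_notMem fun A hA => ?_)
  have h : energy c A = E := (Finsupp.mem_supported K v).mp hv hA
  have := energy_nonneg c A
  omega

theorem eq_smul_of_mem_energySub {c : ℤ} {v : Maya →₀ K} (hv : v ∈ energySub K c 0) :
    v = v (Maya.sea c) • Finsupp.single (Maya.sea c) 1 := by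
  refine Finsupp.ext fun A => ?_
  rw [Finsupp.smul_apply, smul_eq_mul]
  by_cases hA : A = Maya.sea c
  · rw [hA, Finsupp.single_eq_same, mul_one]
  · rw [Finsupp.single_eq_of_ne hA, mul_zero]
    by_contra h
    exact hA (eq_sea_of_energy_eq_zero
      ((Finsupp.mem_supported K v).mp hv (Finsupp.mem_support_iff.mpr h)))

variable (g : Twist n q)

theorem lowerOp_energy {c E : ℤ} (e : ℤ) {v : Maya →₀ K} (hv : v ∈ energySub K c E) :
    lowerOp g e v ∈ energySub K c (E - 2 * n) :=
  moveOp_mem_supported hv fun A hA hs ht => by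
    rw [Set.mem_ofPred_eq] at hA ⊢
    rw [energy_move c hs ht, hA]; ring

theorem raiseOp_energy {c E : ℤ} (e : ℤ) {v : Maya →₀ K} (hv : v ∈ energySub K c E) :
    raiseOp g e v ∈ energySub K c (E + 2 * n) :=
  moveOp_mem_supported hv fun A hA hs ht => by
    rw [Set.mem_ofPred_eq] at hA ⊢
    rw [energy_move c hs ht, hA]; ring

theorem lowerSet_energy {c E : ℤ} (S : Finset ℤ) {v : Maya →₀ K} (hv : v ∈ energySub K c E) :
    lowerSet g S v ∈ energySub K c (E - 2 * n * S.card) := by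
  induction S using Finset.induction_on_max with
  | empty => simpa [lowerSet_empty] using hv
  | insert m S hm ih =>
    rw [lowerSet_insert g hm, Finset.card_insert_of_notMem fun h => (hm m h).false,
      Module.End.mul_apply]
    have := lowerOp_energy g m ih
    push_cast
    rwa [mul_add, mul_one, ← sub_sub]

theorem raiseSet_energy {c E : ℤ} (S : Finset ℤ) {v : Maya →₀ K} (hv : v ∈ energySub K c E) :
    raiseSet g S v ∈ energySub K c (E + 2 * n * S.card) := by
  induction S using Finset.induction_on_max generalizing E v with
  | empty => simpa [raiseSet_empty] using hv
  | insert m S hm ih =>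
    rw [raiseSet_insert g hm, Finset.card_insert_of_notMem fun h => (hm m h).false,
      Module.End.mul_apply]
    have := ih (raiseOp_energy g m hv)
    push_cast
    rwa [mul_add, mul_one, add_comm _ (2 * (n : ℤ)), ← add_assoc]

theorem lowerAll_energy {c E : ℤ} (r : ℕ) {v : Maya →₀ K} (hv : v ∈ energySub K c E) :
    lowerAll g r v ∈ energySub K c (E - 2 * n * r) :=
  map_mem_of_mem_supported hv fun A hA => by
    rw [Set.mem_ofPred_eq] at hA
    rw [lowerAll_apply g le_rfl r (single_mem_withinSub A.within_lo_hi 1), lowerElem,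
      LinearMap.sum_apply]
    refine Submodule.sum_mem _ fun S hS => ?_
    have := lowerSet_energy g S (single_mem_energySub c A (1 : K))
    rwa [hA, (Finset.mem_powersetCard.mp hS).2] at this

theorem raiseAll_energy {c E : ℤ} (r : ℕ) {v : Maya →₀ K} (hv : v ∈ energySub K c E) :
    raiseAll g r v ∈ energySub K c (E + 2 * n * r) :=
  map_mem_of_mem_supported hv fun A hA => by
    rw [Set.mem_ofPred_eq] at hA
    rw [raiseAll_apply g r le_rfl (single_mem_withinSub A.within_lo_hi 1), raiseElem,
      LinearMap.sum_apply]
    refine Submodule.sum_mem _ fun S hS => ?_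
    have := raiseSet_energy g S (single_mem_energySub c A (1 : K))
    rwa [hA, (Finset.mem_powersetCard.mp hS).2] at this

theorem lowerCur_energy {c E : ℤ} (k : ℕ) {v : Maya →₀ K} (hv : v ∈ energySub K c E) :
    lowerCur g k v ∈ energySub K c (E - 2 * n * (k + 1)) := by
  induction k using Nat.strong_induction_on with
  | _ k ih =>
    rw [lowerCur_apply]
    refine Submodule.sub_mem _ (Submodule.smul_mem _ _ (by
      simpa using lowerAll_energy g (k + 1) hv)) (Submodule.sum_mem _ fun i hi => ?_)
    rw [Finset.mem_range] at hi
    have h := lowerAll_energy g (k - i) (ih i hi)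
    rw [Nat.cast_sub hi.le] at h
    convert h using 2
    ring

theorem raiseCur_energy {c E : ℤ} (k : ℕ) {v : Maya →₀ K} (hv : v ∈ energySub K c E) :
    raiseCur g k v ∈ energySub K c (E + 2 * n * (k + 1)) := by
  induction k using Nat.strong_induction_on with
  | _ k ih =>
    rw [raiseCur_apply]
    refine Submodule.sub_mem _ (Submodule.smul_mem _ _ (by
      simpa using raiseAll_energy g (k + 1) hv)) (Submodule.sum_mem _ fun i hi => ?_)
    rw [Finset.mem_range] at hi
    have h := raiseAll_energy g (k - i) (ih i hi)
    rw [Nat.cast_sub hi.le] at h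
    convert h using 2
    ring

end Energy

/-! ### The Heisenberg relations up to central scalars. -/

section Heisenberg

variable {K : Type*} [Field K] {n : ℕ} {q : K} [NeZero n] (g : Twist n q)

/-- The commutator passes through every ψ_m, and applied to a vacuum it would have negative energy.
-/
theorem lowerCur_raiseCur_comm_of_lt (hq : q ≠ 0) {k l : ℕ} (h : l < k) (v : Maya →₀ K) :
    lowerCur g k (raiseCur g l v) = raiseCur g l (lowerCur g k v) := by
  have hn := NeZero.pos n
  refine comm_of_comm_wedgeOp g (fun m v => lowerCur_raiseCur_wedgeOp g hq k l m v)
    (fun c => ?_) v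
  rw [lowerCur_sea, map_zero]
  have hs := single_mem_energySub c (Maya.sea c) (1 : K)
  rw [energy_sea] at hs
  refine eq_zero_of_mem_energySub ?_ (lowerCur_energy g k (raiseCur_energy g l hs))
  have : (n : ℤ) * (l + 1) < n * (k + 1) := mul_lt_mul_of_pos_left (by omega) (by omega)
  linarith

/-- The energy argument fails if more is raised than lowered; this case is the transpose of the
other one for the dual twist. -/
theorem lowerCur_raiseCur_comm_of_ne (hq : q ≠ 0) {k l : ℕ} (h : k ≠ l) (v : Maya →₀ K) :
    lowerCur g k (raiseCur g l v) = raiseCur g l (lowerCur g k v) := by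
  rcases lt_or_gt_of_ne h with h | h
  · have h1 := (lowerCur_transpose g hq k).mul (raiseCur_transpose g hq l)
    have h2 := (raiseCur_transpose g hq l).mul (lowerCur_transpose g hq k)
    have h3 : lowerCur g.dual l * raiseCur g.dual k = raiseCur g.dual k * lowerCur g.dual l :=
      LinearMap.ext fun v => lowerCur_raiseCur_comm_of_lt g.dual hq h v
    rw [h3] at h1
    exact DFunLike.congr_fun (h1.symm.unique h2.symm) v
  · exact lowerCur_raiseCur_comm_of_lt g hq h v

theorem wedgeOp_sea (c : ℤ) : wedgeOp g c (Finsupp.single (Maya.sea c) 1) =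
    Finsupp.single (Maya.sea (c + 1)) 1 := by
  rw [wedgeOp_of_le g le_rfl (single_mem_withinSub (Maya.sea_within c) 1), addOp_single]
  congr 1
  refine Maya.ext' fun x => ?_
  rw [Maya.mem_add, Maya.mem_sea, Maya.mem_sea]
  omega

/-- The scalar by which the commutator of `lowerCur g k` and `raiseCur g k` acts. -/
noncomputable def curScalar (k : ℕ) : K :=
  lowerCur g k (raiseCur g k (Finsupp.single (Maya.sea 0) 1)) (Maya.sea 0)

/-- By energy the result is a multiple of the vacuum. Since ψ_c maps the vacuum at c to the one at c
+ 1 and commutes with the commutator, the multiple is the same for all c. -/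
theorem lowerCur_raiseCur_sea (hq : q ≠ 0) (k : ℕ) (c : ℤ) :
    lowerCur g k (raiseCur g k (Finsupp.single (Maya.sea c) 1)) =
      curScalar g k • Finsupp.single (Maya.sea c) 1 := by
  have h1 : ∀ c, lowerCur g k (raiseCur g k (Finsupp.single (Maya.sea c) 1)) =
      lowerCur g k (raiseCur g k (Finsupp.single (Maya.sea c) 1)) (Maya.sea c) •
        Finsupp.single (Maya.sea c) 1 := fun c => by
    have hs := single_mem_energySub c (Maya.sea c) (1 : K)
    rw [energy_sea] at hs
    have := lowerCur_energy g k (raiseCur_energy g k hs)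
    rw [add_sub_cancel_right] at this
    exact eq_smul_of_mem_energySub this
  have h2 : ∀ c, lowerCur g k (raiseCur g k (Finsupp.single (Maya.sea (c + 1)) 1))
      (Maya.sea (c + 1)) =
      lowerCur g k (raiseCur g k (Finsupp.single (Maya.sea c) 1)) (Maya.sea c) := fun c => by
    have := lowerCur_raiseCur_wedgeOp g hq k k c (Finsupp.single (Maya.sea c) 1)
    rw [wedgeOp_sea, lowerCur_sea, lowerCur_sea, map_zero, sub_zero, sub_zero, h1 c, map_smul,
      wedgeOp_sea] at this
    rw [this, Finsupp.smul_apply, Finsupp.single_eq_same, smul_eq_mul, mul_one, h1 c,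
      Finsupp.smul_apply, Finsupp.single_eq_same, smul_eq_mul, mul_one]
  rw [h1 c]
  congr 1
  induction c using Int.induction_on with
  | zero => rfl
  | succ i ih => rw [h2, ih]
  | pred i ih =>
    rw [← ih, ← h2]
    simp

theorem lowerCur_raiseCur_self (hq : q ≠ 0) (k : ℕ) (v : Maya →₀ K) :
    lowerCur g k (raiseCur g k v) = raiseCur g k (lowerCur g k v) + curScalar g k • v := by
  have : lowerCur g k * raiseCur g k - raiseCur g k * lowerCur g k - curScalar g k • 1 = 0 := by
    refine eq_zero_of_commute g (fun m v => ?_) fun c => ?_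
    · refine (congrArg (· - curScalar g k • wedgeOp g m v)
        (lowerCur_raiseCur_wedgeOp g hq k k m v)).trans ?_
      rw [← map_smul, ← map_sub]; rfl
    · have := lowerCur_raiseCur_sea g hq k c
      refine (congrArg₂ (fun x y => x - raiseCur g k y - _) this (lowerCur_sea g k c)).trans ?_
      rw [map_zero, sub_zero]
      exact sub_self _
  have h := DFunLike.congr_fun this v
  have h' : lowerCur g k (raiseCur g k v) - raiseCur g k (lowerCur g k v) -
    curScalar g k • v = 0 := h
  rw [← sub_eq_zero, ← h']
  abel

/-- Creation operators turn the commutator into a shift. -/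
theorem lowerCur_raiseAll [CharZero K] (hq : q ≠ 0) (k r : ℕ) (v : Maya →₀ K) :
    lowerCur g k (raiseAll g r v) = raiseAll g r (lowerCur g k v) +
      (if k < r then (curScalar g k / (k + 1)) • raiseAll g (r - (k + 1)) v else 0) := by
  induction r using Nat.strong_induction_on generalizing v with
  | _ r ih =>
  cases r with
  | zero => simp [raiseAll_zero]
  | succ r =>
  have hr : ((r : K) + 1) ≠ 0 := Nat.cast_add_one_ne_zero r
  have hk : ((k : K) + 1) ≠ 0 := Nat.cast_add_one_ne_zero k
  refine smul_right_injective _ hr ?_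
  simp only
  rw [← map_smul, ← raiseCur_sum, map_sum, smul_add, ← raiseCur_sum]
  -- After expanding (r+1) F_{r+1} by Newton's identity, the lowering operator passes F_{r-i} by
  -- induction and the power sum by the Heisenberg relation; each part leaves a multiple of F_{r-k}.
  have hterm : ∀ i ∈ Finset.range (r + 1), lowerCur g k (raiseAll g (r - i) (raiseCur g i v)) =
      raiseAll g (r - i) (raiseCur g i (lowerCur g k v)) +
      ((if i = k then curScalar g k • raiseAll g (r - k) v else 0) +
      (if k < r - i then (curScalar g k / (k + 1)) •
        raiseAll g (r - (k + 1) - i) (raiseCur g i v) else 0)) := by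
    intro i hi
    rw [ih (r - i) (by omega), show r - i - (k + 1) = r - (k + 1) - i by omega]
    rcases eq_or_ne i k with rfl | hik
    · rw [lowerCur_raiseCur_self g hq, map_add, map_smul, if_pos rfl, add_assoc]
    · rw [lowerCur_raiseCur_comm_of_ne g hq hik.symm, if_neg hik, zero_add]
  rw [Finset.sum_congr rfl hterm, Finset.sum_add_distrib, Finset.sum_add_distrib,
    Finset.sum_ite_eq']
  congr 1
  by_cases hkr : k < r + 1
  · rw [if_pos (Finset.mem_range.mpr hkr), if_pos hkr, ← Finset.sum_filter]
    have hf : (Finset.range (r + 1)).filter (fun i => k < r - i) = Finset.range (r - k) := by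
      ext i; simp only [Finset.mem_filter, Finset.mem_range]; omega
    rw [hf, ← Finset.smul_sum, show r + 1 - (k + 1) = r - k by omega]
    rcases Nat.eq_zero_or_pos (r - k) with h0 | h0
    · have : r = k := by omega
      subst this
      rw [h0, Finset.sum_range_zero, smul_zero, add_zero, smul_smul, mul_div_cancel₀ _ hr]
    · have h2 : r - (k + 1) + 1 = r - k := by omega
      have := raiseCur_sum g (r - (k + 1)) v
      rw [h2] at this
      rw [this, smul_smul, smul_smul, ← add_smul]
      congr 1
      have h3 : ((r - (k + 1) : ℕ) : K) = r - (k + 1) := by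
        rw [Nat.cast_sub (by omega)]; push_cast; ring
      rw [h3]
      field_simp
      ring
  · rw [if_neg (by rwa [Finset.mem_range]), if_neg hkr, zero_add, smul_zero]
    refine Finset.sum_eq_zero fun i _ => if_neg (by omega)

end Heisenberg

/-! ### Logarithmic derivatives of products of geometric series. -/

section LogDerivative

open PowerSeries

variable {R : Type*} [CommRing R]

/-- `L` is the logarithmic derivative of `F`. -/
def IsLogDeriv (F L : PowerSeries R) : Prop := d⁄dX R F = F * L

theorem isLogDeriv_one : IsLogDeriv (1 : PowerSeries R) 0 := by
  rw [IsLogDeriv, mul_zero, derivative_one]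

theorem IsLogDeriv.mul {F G L M : PowerSeries R} (hF : IsLogDeriv F L) (hG : IsLogDeriv G M) :
    IsLogDeriv (F * G) (L + M) := by
  rw [IsLogDeriv] at *
  rw [Derivation.leibniz, hF, hG, smul_eq_mul, smul_eq_mul]
  ring

theorem IsLogDeriv.prod {ι : Type*} (s : Finset ι) {F L : ι → PowerSeries R}
    (h : ∀ i ∈ s, IsLogDeriv (F i) (L i)) : IsLogDeriv (∏ i ∈ s, F i) (∑ i ∈ s, L i) := by
  classical
  induction s using Finset.induction_on with
  | empty => simpa using isLogDeriv_one
  | insert i s hi ih =>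
    rw [Finset.prod_insert hi, Finset.sum_insert hi]
    exact (h i (Finset.mem_insert_self _ _)).mul (ih fun j hj => h j (Finset.mem_insert_of_mem hj))

theorem IsLogDeriv.coeff_succ {F L : PowerSeries R} (h : IsLogDeriv F L) (r : ℕ) :
    ((r : R) + 1) * coeff (r + 1) F =
      ∑ i ∈ Finset.range (r + 1), coeff i L * coeff (r - i) F := by
  have := congrArg (coeff r) h
  rw [PowerSeries.coeff_derivative, coeff_mul, Finset.Nat.sum_antidiagonal_eq_sum_range_succ_mk]
    at this
  rw [mul_comm, this, ← Finset.sum_range_reflect]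
  refine Finset.sum_congr rfl fun i hi => ?_
  rw [Finset.mem_range] at hi
  rw [mul_comm, show r + 1 - 1 - i = r - i by omega, show r - (r - i) = i by omega]

/-- The geometric series `1 / (1 - a X)`. -/
def geomSeries (a : R) : PowerSeries R := PowerSeries.mk fun k => a ^ k

theorem geomSeries_eq (a : R) : geomSeries a = 1 + C a * X * geomSeries a := by
  ext k
  rw [map_add, mul_assoc, coeff_C_mul, coeff_one]
  cases k with
  | zero => simp [geomSeries]
  | succ k => simp [geomSeries, coeff_succ_X_mul, pow_succ']

theorem geomSeries_mul (a : R) : geomSeries a * (1 - C a * X) = 1 := by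
  have := geomSeries_eq a
  linear_combination this

theorem isLogDeriv_geomSeries (a : R) : IsLogDeriv (geomSeries a) (C a * geomSeries a) := by
  rw [IsLogDeriv]
  ext k
  rw [PowerSeries.coeff_derivative, mul_left_comm, coeff_C_mul, coeff_mul,
    Finset.Nat.sum_antidiagonal_eq_sum_range_succ_mk]
  simp only [geomSeries, coeff_mk]
  rw [Finset.sum_congr rfl fun i hi => by
    rw [← pow_add, show i + (k - i) = k by rw [Finset.mem_range] at hi; omega]]
  rw [Finset.sum_const, Finset.card_range, nsmul_eq_mul]
  push_cast
  ring

theorem isLogDeriv_one_sub (a : R) : IsLogDeriv (1 - C a * X) (-(C a * geomSeries a)) := by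
  have h := geomSeries_mul a
  have h1 : d⁄dX R (1 - C a * X : PowerSeries R) = -C a := by
    rw [map_sub, derivative_one, Derivation.leibniz]; simp
  rw [IsLogDeriv, h1]
  linear_combination C a * h

end LogDerivative

/-! ### The central scalars, from cores with separated runners. -/

section Core

variable {K : Type*} [Field K] {n : ℕ} {q : K}

theorem dot_eq_zero {P Q : Set Maya} (h : ∀ A ∈ P, A ∉ Q) {v w : Maya →₀ K}
    (hv : v ∈ Finsupp.supported K K P) (hw : w ∈ Finsupp.supported K K Q) : dot v w = 0 := by
  refine eq_zero_of_mem_supported (f := dot.flip w) hv fun A hA => ?_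
  rw [LinearMap.flip_apply, dot_single_left, one_mul]
  by_contra hne
  exact h A hA ((Finsupp.mem_supported K w).mp hw (Finsupp.mem_support_iff.mpr hne))

variable (g : Twist n q)

theorem raiseElem_mem_supported {W : Finset ℤ} {m : ℤ} (hW : ∀ s ∈ W, s < m) (p : Prop) (r : ℕ)
    {v : Maya →₀ K} (hv : v ∈ Finsupp.supported K K {A | m ∈ A.1 ↔ p}) :
    raiseElem g W r v ∈ Finsupp.supported K K {A | m ∈ A.1 ↔ p} := by
  have key : ∀ (S : Finset ℤ) (v : Maya →₀ K), S ⊆ W →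
      v ∈ Finsupp.supported K K {A | m ∈ A.1 ↔ p} →
      raiseSet g S v ∈ Finsupp.supported K K {A | m ∈ A.1 ↔ p} := by
    intro S
    induction S using Finset.induction_on_max with
    | empty => intro v _ hv; simpa [raiseSet_empty] using hv
    | insert k S hk ih =>
      intro v hS hv
      rw [raiseSet_insert g hk, Module.End.mul_apply]
      have hkm := hW k (hS (Finset.mem_insert_self _ _))
      refine ih _ (fun s hs => hS (Finset.mem_insert_of_mem hs))
        (moveOp_mem_supported hv fun A hA _ _ => ?_)
      rw [Set.mem_ofPred_eq] at hA ⊢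
      rw [Maya.mem_move, ← hA]
      constructor
      · rintro (h | h)
        · omega
        · exact h.1
      · exact fun h => Or.inr ⟨h, by omega⟩
  rw [raiseElem, LinearMap.sum_apply]
  exact Submodule.sum_mem _ fun S hS => key S v (Finset.mem_powersetCard.mp hS).1 hv

/-- The diagonal matrix element of the product of a raising operator and its adjoint, restricted to
the sites in a window. -/
noncomputable def raiseNorm (W : Finset ℤ) (r : ℕ) (A : Maya) : K :=
  dot (raiseElem g W r (Finsupp.single A 1)) (raiseElem g.dual W r (Finsupp.single A 1))

theorem raiseNorm_zero (W : Finset ℤ) (A : Maya) : raiseNorm g W 0 A = 1 := by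
  rw [raiseNorm, raiseElem_zero, raiseElem_zero, Module.End.one_apply, dot_single_left,
    Finsupp.single_eq_same, one_mul]

theorem raiseNorm_empty (r : ℕ) (A : Maya) : raiseNorm g ∅ (r + 1) A = 0 := by
  rw [raiseNorm, raiseElem, Finset.powersetCard_eq_empty.mpr (by simp), Finset.sum_empty,
    LinearMap.zero_apply, map_zero, LinearMap.zero_apply]

theorem raiseNorm_insert_of_not {W : Finset ℤ} {m : ℤ} (hW : ∀ s ∈ W, s < m) (r : ℕ) {A : Maya}
    (hA : ¬(m - n ∈ A.1 ∧ m ∉ A.1)) : raiseNorm g (insert m W) r A = raiseNorm g W r A := by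
  cases r with
  | zero => rw [raiseNorm_zero, raiseNorm_zero]
  | succ r =>
    rw [raiseNorm, raiseElem_insert g hW, raiseElem_insert g.dual hW, LinearMap.add_apply,
      LinearMap.add_apply, Module.End.mul_apply, Module.End.mul_apply, raiseOp, raiseOp,
      moveOp_single_of_not hA, moveOp_single_of_not hA, map_zero, map_zero, add_zero, add_zero,
      raiseNorm]

-- In an ordered product the highest site m is raised first or never. The occupation of m tells the
-- two cases apart, so they are orthogonal; the weights of g and of its dual multiply to a power of
-- v. Hence the matrix element depends on v alone.
open Classical in
theorem raiseNorm_insert {W : Finset ℤ} {m : ℤ} (hW : ∀ s ∈ W, s < m) (r : ℕ) {A : Maya}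
    (h1 : m - n ∈ A.1) (h2 : m ∉ A.1) :
    raiseNorm g (insert m W) (r + 1) A = raiseNorm g W (r + 1) A +
      (q ^ 2) ^ ((Finset.Ioo (m - n) m).filter (· ∈ A.1)).card *
        raiseNorm g W r (A.move (m - n) m) := by
  have hs : Finsupp.single A (1 : K) ∈ Finsupp.supported K K {A : Maya | m ∈ A.1 ↔ False} :=
    single_mem_supported (by simpa using h2) 1
  have ht : Finsupp.single (A.move (m - n) m) (1 : K) ∈
      Finsupp.supported K K {A : Maya | m ∈ A.1 ↔ True} :=
    single_mem_supported (by simp [Maya.mem_move]) 1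
  have hd : ∀ A ∈ {A : Maya | m ∈ A.1 ↔ False}, A ∉ {A : Maya | m ∈ A.1 ↔ True} := by
    intro A hA hA'
    rw [Set.mem_ofPred_eq] at hA hA'
    exact hA.mp (hA'.mpr trivial)
  have e1 : ∀ g : Twist n q, raiseOp g m (Finsupp.single A 1) =
      passWeight (fun b => g.g ((b - m : ℤ) : ZMod n)) (Finset.Ioo (m - n) m) A •
        Finsupp.single (A.move (m - n) m) 1 := fun g => by
    rw [raiseOp, moveOp_single_of h1 h2, single_eq_smul]
  have z1 := dot_eq_zero hd (raiseElem_mem_supported g hW _ (r + 1) hs)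
    (raiseElem_mem_supported g.dual hW _ r ht)
  have z2 := dot_eq_zero hd (raiseElem_mem_supported g.dual hW _ (r + 1) hs)
    (raiseElem_mem_supported g hW _ r ht)
  rw [dot_comm] at z2
  have hw : passWeight (fun b => g.dual.g ((b - m : ℤ) : ZMod n)) (Finset.Ioo (m - n) m) A =
      passWeight (fun b => g.g ((m - b : ℤ) : ZMod n)) (Finset.Ioo (m - n) m) A := by
    refine congrArg (fun h => passWeight h _ A) (funext fun b => ?_)
    show g.g (-((b - m : ℤ) : ZMod n)) = _
    rw [← Int.cast_neg, neg_sub]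
  rw [raiseNorm, raiseElem_insert g hW, raiseElem_insert g.dual hW, LinearMap.add_apply,
    LinearMap.add_apply, Module.End.mul_apply, Module.End.mul_apply, e1, e1, map_smul, map_smul,
    map_add, map_add, LinearMap.add_apply, LinearMap.add_apply, map_smul, map_smul, map_smul,
    LinearMap.smul_apply, LinearMap.smul_apply, z1, z2, smul_zero, smul_zero, add_zero, zero_add,
    ← passWeight_mul_swap g m A, smul_smul, smul_eq_mul, hw, raiseNorm, raiseNorm]

/-- Sites to which no particle can be raised contribute nothing and can be dropped from the top of
the window. -/
theorem raiseNorm_scan {lo m₁ m₂ : ℤ} (h1 : lo ≤ m₁) (h2 : m₁ ≤ m₂) {A : Maya}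
    (hA : ∀ x, m₁ ≤ x → x < m₂ → ¬(x - n ∈ A.1 ∧ x ∉ A.1)) (r : ℕ) :
    raiseNorm g (Finset.Ico lo m₂) r A = raiseNorm g (Finset.Ico lo m₁) r A := by
  obtain ⟨k, rfl⟩ : ∃ k : ℕ, m₂ = m₁ + k := ⟨(m₂ - m₁).toNat, by omega⟩
  clear h2
  induction k with
  | zero => simp
  | succ k ih =>
    rw [← ih fun x hx hx' => hA x hx (by push_cast; omega)]
    have : Finset.Ico lo (m₁ + (k + 1 : ℕ)) = insert (m₁ + k : ℤ) (Finset.Ico lo (m₁ + k)) := by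
      ext x; simp only [Finset.mem_Ico, Finset.mem_insert]; push_cast; omega
    rw [this, raiseNorm_insert_of_not g (fun s hs => (Finset.mem_Ico.mp hs).2) r
      (hA _ (by omega) (by push_cast; omega))]

variable [NeZero n]

open Classical in
/-- Diagonal matrix elements for a diagram whose runners end at well separated levels. -/
theorem raiseNorm_separated {M : ℤ} {lo : ℤ} (hlo : ∀ s : ℤ, 0 ≤ s → s ≤ n → lo ≤ s - n * (s * M))
    (d : ℕ) : ∀ (r j : ℕ) (t : ℕ) (l : ℤ) (A : Maya), t + d + 1 = n → r ≤ j → (j : ℤ) + 1 ≤ M →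
      (∀ s l' : ℤ, 0 ≤ s → s ≤ t → s + n * l' < t + n * l → s + n * l' ∈ A.1) →
      (∀ s l' : ℤ, t < s → s < n → s + n * l' < t + n * l → (s + n * l' ∈ A.1 ↔ l' < -(s * M))) →
      (t + n * l ∉ A.1) → -((t + 1) * M) + j + 1 ≤ l →
      raiseNorm g (Finset.Ico lo (t + n * l + 1)) r A =
        PowerSeries.coeff r (∏ s ∈ Finset.Ico t n, geomSeries ((q ^ 2) ^ s)) := by
  have hn := NeZero.pos n
  -- The window is scanned downwards. The site e, at level l of runner t, is the next one that can
  -- be filled; runners up to t are full below e, and later runners still have their original ends.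
  -- The number j bounds the raises to come on runner t, whose level stays more than j above the end
  -- of runner t + 1. The outer induction is on the runners left, the inner one on the raises left.
  induction d using Nat.strong_induction_on with
  | _ d ihd =>
  intro r
  induction r with
  | zero =>
    intro j t l A _ _ _ _ _ _ _
    rw [raiseNorm_zero, PowerSeries.coeff_zero_eq_constantCoeff, map_prod,
      Finset.prod_eq_one fun s _ => ?_]
    rw [← PowerSeries.coeff_zero_eq_constantCoeff]
    simp [geomSeries]
  | succ r ihr =>
    intro j t l A htd hrj hjM h1 h2 h3 h4
    set e : ℤ := t + n * l with he
    have hn1 : (1 : ℤ) ≤ n := by omega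
    have hM : (1 : ℤ) ≤ M := by omega
    have hnl : (n : ℤ) * (-((t + 1) * M) + j + 1) ≤ n * l :=
      mul_le_mul_of_nonneg_left h4 (by omega)
    have hnj : (1 : ℤ) ≤ n * j := by
      have : (1 : ℤ) * 1 ≤ n * j := mul_le_mul hn1 (by omega) (by omega) (by omega)
      omega
    have hdiv : ∀ x : ℤ, ∃ s l' : ℤ, 0 ≤ s ∧ s < n ∧ x = s + n * l' := fun x =>
      ⟨x % n, x / n, Int.emod_nonneg _ (by omega), Int.emod_lt_of_pos _ (by omega),
        (Int.emod_add_mul_ediv x n).symm⟩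
    -- the sites where a particle can be raised
    have hadd : ∀ x, x < e → x - n ∈ A.1 → x ∉ A.1 →
        ∃ s : ℤ, t < s ∧ s < n ∧ x = s - n * (s * M) := by
      intro x hx hxn hxA
      obtain ⟨s, l', hs0, hsn, rfl⟩ := hdiv x
      by_cases hst : s ≤ t
      · exact absurd (h1 s l' hs0 hst hx) hxA
      · rw [not_le] at hst
        have e1 : s + n * l' - n = s + n * (l' - 1) := by ring
        rw [e1, h2 s (l' - 1) hst hsn (by rw [← e1]; omega)] at hxn
        rw [h2 s l' hst hsn hx] at hxA
        have : l' = -(s * M) := by omega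
        exact ⟨s, hst, hsn, by rw [this]; ring⟩
    -- The ends of the later runners lie at or below that of runner t + 1, since M ≥ 1.
    have hsep : ∀ s : ℤ, t < s → s - n * (s * M) ≤ t + 1 - n * ((t + 1) * M) := by
      intro s hs
      have : 0 ≤ (s - (t + 1)) * (n * M - 1) := mul_nonneg (by omega) (by
        have : (1 : ℤ) * 1 ≤ n * M := mul_le_mul hn1 hM (by omega) (by omega)
        omega)
      linarith
    have hen : e - n + 1 ≥ t + 1 - n * ((t + 1) * M) + n * j := by rw [he]; linarith
    have hem : e - n ∈ A.1 := by
      have e1 : e - n = t + n * (l - 1) := by rw [he]; ring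
      rw [e1]
      exact h1 t (l - 1) (by omega) le_rfl (by rw [← e1]; omega)
    have hloe : lo ≤ e - n + 1 := by
      have := hlo (t + 1) (by omega) (by omega)
      linarith
    have hI : Finset.Ico lo (e + 1) = insert e (Finset.Ico lo e) := by
      ext x; simp only [Finset.mem_Ico, Finset.mem_insert]; omega
    rw [hI, raiseNorm_insert g (fun s hs => (Finset.mem_Ico.mp hs).2) r hem h3]
    -- Between e - n and e exactly the runners 0, …, t-1 hold a particle: they are full below e, and
    -- separation makes the later runners empty at this level.
    have hcard : ((Finset.Ioo (e - n) e).filter (· ∈ A.1)).card = t := by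
      have : (Finset.Ioo (e - n) e).filter (· ∈ A.1) = Finset.Ico (e - t) e := by
        ext x
        rw [Finset.mem_filter, Finset.mem_Ioo, Finset.mem_Ico]
        constructor
        · rintro ⟨⟨hx1, hx2⟩, hxA⟩
          refine ⟨?_, hx2⟩
          by_contra hx3
          obtain ⟨s, hs⟩ : ∃ s : ℤ, x = s + n * (l - 1) := ⟨x - n * (l - 1), by ring⟩
          have hnl1 : (n : ℤ) * (l - 1) = n * l - n := by ring
          rw [hs, h2 s (l - 1) (by omega) (by omega) (by omega)] at hxA
          have : (t + 1) * M ≤ s * M := mul_le_mul_of_nonneg_right (by omega) (by omega)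
          omega
        · rintro ⟨hx1, hx2⟩
          obtain ⟨s, hs⟩ : ∃ s : ℤ, x = s + n * l := ⟨x - n * l, by ring⟩
          refine ⟨by omega, ?_⟩
          rw [hs]
          exact h1 s l (by omega) (by omega) (by omega)
      rw [this, Int.card_Ico]
      omega
    -- The generating function H_t = ∏_{s ≥ t} 1/(1 - v^s X) satisfies H_t = H_{t+1} + v^t X H_t,
    -- the same recursion as the matrix elements.
    have hprod : (∏ s ∈ Finset.Ico t n, geomSeries ((q ^ 2) ^ s) : PowerSeries K) =
        ∏ s ∈ Finset.Ico (t + 1) n, geomSeries ((q ^ 2) ^ s) +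
          PowerSeries.C ((q ^ 2) ^ t) * (PowerSeries.X *
            ∏ s ∈ Finset.Ico t n, geomSeries ((q ^ 2) ^ s)) := by
      rw [Finset.prod_eq_prod_Ico_succ_bot (by omega)]
      conv_lhs => rw [geomSeries_eq]
      ring
    rw [hcard, hprod, map_add, PowerSeries.coeff_C_mul, PowerSeries.coeff_succ_X_mul]
    congr 1
    -- The particle at e - n stays. Then nothing else on runner t can move, and the scan goes on at
    -- the end of runner t + 1; there j may start afresh because that runner has M levels to spare.
    · cases d with
      | zero =>
        rw [raiseNorm_scan g le_rfl (by omega), Finset.Ico_self, raiseNorm_empty,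
          Finset.Ico_eq_empty (by omega), Finset.prod_empty, PowerSeries.coeff_one,
          if_neg (Nat.succ_ne_zero r)]
        rintro x hx1 hx2 ⟨hx3, hx4⟩
        obtain ⟨s, hs1, hs2, -⟩ := hadd x hx2 hx3 hx4
        omega
      | succ d =>
        have hlo' := hlo (t + 1) (by omega) (by omega)
        rw [raiseNorm_scan g (m₁ := t + 1 - n * ((t + 1) * M) + 1) (by omega) (by linarith)]
        · have := ihd d (by omega) (r + 1) j (t + 1) (-((t + 1) * M)) A (by omega) hrj hjM
          push_cast at this
          rw [show (t : ℤ) + 1 - n * ((t + 1) * M) + 1 =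
            t + 1 + n * -((t + 1) * M) + 1 by ring]
          have hfe : (t : ℤ) + 1 + n * -((t + 1) * M) < e := by
            have : (1 : ℤ) * (j + 1) ≤ n * (j + 1) := mul_le_mul_of_nonneg_right hn1 (by omega)
            linarith
          refine this (fun s l' hs0 hst hx => ?_) (fun s l' hs hsn hx =>
            h2 s l' (by omega) hsn (hx.trans hfe)) ?_ ?_
          · rcases (by omega : s ≤ t ∨ s = t + 1) with hs | hs
            · exact h1 s l' hs0 hs (hx.trans hfe)
            · subst hs
              rw [h2 _ l' (by omega) (by omega) (hx.trans hfe)]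
              exact lt_of_mul_lt_mul_left (a := (n : ℤ)) (by linarith) (by omega)
          · rw [h2 _ _ (by omega) (by omega) hfe]
            exact lt_irrefl _
          · have : ((t : ℤ) + 1 + 1) * M = (t + 1) * M + M := by ring
            omega
        · rintro x hx1 hx2 ⟨hx3, hx4⟩
          obtain ⟨s, hs1, hs2, rfl⟩ := hadd x hx2 hx3 hx4
          have := hsep s hs1
          omega
    -- The particle is raised with weight v^t. Now e - n is empty, and the particle below it on the
    -- same runner may follow, one level lower and with j reduced by one.
    · congr 1
      rw [raiseNorm_scan g (m₁ := e - n + 1) hloe (by omega)]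
      · have e1 : e - n = t + n * (l - 1) := by rw [he]; ring
        rw [e1]
        refine ihr (j - 1) t (l - 1) _ htd (by omega) (by omega) (fun s l' hs0 hst hx => ?_)
          (fun s l' hs hsn hx => ?_) ?_ (by omega)
        · rw [Maya.mem_move, ← e1]
          rw [← e1] at hx
          exact Or.inr ⟨h1 s l' hs0 hst (by omega), by omega⟩
        · rw [Maya.mem_move, ← h2 s l' hs hsn (by omega)]
          constructor
          · rintro (h | h)
            · omega
            · exact h.1
          · exact fun h => Or.inr ⟨h, by omega⟩
        · rw [Maya.mem_move, ← e1]
          rintro (h | h)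
          · omega
          · exact h.2 rfl
      · rintro x hx1 hx2 ⟨hx3, hx4⟩
        rw [Maya.mem_move] at hx3 hx4
        obtain ⟨s, hs1, hs2, rfl⟩ := hadd x hx2 (by
          rcases hx3 with h | h
          · omega
          · exact h.1) (fun h => hx4 (Or.inr ⟨h, by omega⟩))
        have := hsep s hs1
        omega

/-- The Maya diagram with separated runners: the runner `s` is filled below the level `-s M`. -/
def separatedCore (n : ℕ) [NeZero n] (M : ℕ) : Maya :=
  ⟨{x | x / n < -(x % n * M)}, by
    have hn := NeZero.pos n
    constructor
    · refine ⟨-(n * M) * n, fun x hx => ?_⟩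
      rw [Set.mem_ofPred_eq]
      have h1 : x / n < -(n * M) := Int.ediv_lt_of_lt_mul (by omega) hx
      have h2 : x % n * M ≤ n * M :=
        mul_le_mul_of_nonneg_right (Int.emod_lt_of_pos x (by omega)).le (by omega)
      omega
    · refine ⟨0, fun x hx => ?_⟩
      rw [Set.mem_ofPred_eq] at hx
      rw [Set.mem_Iio]
      by_contra h
      have h1 : 0 ≤ x / n := Int.ediv_nonneg (by omega) (by omega)
      have h2 : 0 ≤ x % n * M := mul_nonneg (Int.emod_nonneg x (by omega)) (by omega)
      omega⟩

theorem mem_separatedCore {M : ℕ} {s l : ℤ} (h0 : 0 ≤ s) (h1 : s < n) :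
    s + n * l ∈ (separatedCore n M).1 ↔ l < -(s * M) := by
  have hn := NeZero.pos n
  show (s + n * l) / n < -((s + n * l) % n * M) ↔ _
  rw [Int.add_mul_ediv_left _ _ (by omega), Int.add_mul_emod_self_left, Int.emod_eq_of_lt h0 h1,
    Int.ediv_eq_zero_of_lt h0 h1, zero_add]

theorem sub_mem_separatedCore {M : ℕ} {x : ℤ} (h : x ∈ (separatedCore n M).1) :
    x - n ∈ (separatedCore n M).1 := by
  have hn := NeZero.pos n
  have e1 : x = x % n + n * (x / n) := (Int.emod_add_mul_ediv x n).symm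
  have e2 : x - n = x % n + n * (x / n - 1) := by rw [mul_sub, mul_one]; omega
  have h0 := Int.emod_nonneg x (b := n) (by omega)
  have h1 := Int.emod_lt_of_pos x (b := n) (by omega)
  rw [e1, mem_separatedCore h0 h1] at h
  rw [e2, mem_separatedCore h0 h1]
  omega

/-- The diagram is an n-core: below every particle of a runner the runner is full, so no particle
can drop by n. -/
theorem lowerAll_separatedCore (M r : ℕ) :
    lowerAll g (r + 1) (Finsupp.single (separatedCore n M) 1) = 0 := by
  have key : ∀ S : Finset ℤ, S.Nonempty →
      lowerSet g S (Finsupp.single (separatedCore n M) 1) = 0 := by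
    intro S
    induction S using Finset.induction_on_max with
    | empty => rintro ⟨x, hx⟩; simp at hx
    | insert m S hm ih =>
      intro _
      rw [lowerSet_insert g hm, Module.End.mul_apply]
      rcases S.eq_empty_or_nonempty with rfl | hS
      · rw [lowerSet_empty, Module.End.one_apply, lowerOp,
          moveOp_single_of_not fun h => h.2 (sub_mem_separatedCore h.1)]
      · rw [ih hS, map_zero]
  rw [lowerAll_apply g le_rfl (r + 1) (single_mem_withinSub (Maya.within_lo_hi _) 1), lowerElem,
    LinearMap.sum_apply]
  refine Finset.sum_eq_zero fun S hS => key S (Finset.card_pos.mp ?_)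
  rw [(Finset.mem_powersetCard.mp hS).2]
  omega

theorem raiseAll_separatedCore {M r : ℕ} (h : r + 1 ≤ M) :
    lowerAll g r (raiseAll g r (Finsupp.single (separatedCore n M) 1)) (separatedCore n M) =
      PowerSeries.coeff r (∏ s ∈ Finset.range n, geomSeries ((q ^ 2) ^ s)) := by
  have hn := NeZero.pos n
  have hn1 : (1 : ℤ) ≤ n := by omega
  set A := separatedCore n M with hA
  have hw := single_mem_withinSub (K := K) A.within_lo_hi 1
  set lo := min (A.lo - r * n) (-(n * (n * M)))
  set hi := max (A.hi + n) 1
  have hlo1 : lo ≤ -(n * (n * M)) := min_le_right _ _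
  have hnM : (0 : ℤ) ≤ n * (n * M) := by positivity
  have h1 := lowerAll_transpose g r (raiseAll g r (Finsupp.single A 1)) (Finsupp.single A 1)
  rw [dot_single_right, one_mul, raiseAll_apply_Ico g r (lo := lo) (hi := hi) (min_le_left _ _)
    (le_max_left _ _) hw, raiseAll_apply_Ico g.dual r (lo := lo) (hi := hi) (min_le_left _ _)
    (le_max_left _ _) hw] at h1
  rw [raiseAll_apply_Ico g r (lo := lo) (hi := hi) (min_le_left _ _) (le_max_left _ _) hw, h1]
  -- Particles can be raised only to the ends s - n s M of the runners, which are at most 0, so the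
  -- scan starts at e = 0 on runner 0.
  refine (raiseNorm_scan g (lo := lo) (m₁ := 1) (m₂ := hi) (by omega) (le_max_right _ _)
    (fun x hx _ => ?_) r).trans ?_
  · rintro ⟨hx1, hx2⟩
    have e1 : x = x % n + n * (x / n) := (Int.emod_add_mul_ediv x n).symm
    have e2 : x - n = x % n + n * (x / n - 1) := by rw [mul_sub, mul_one]; omega
    have h0 := Int.emod_nonneg x (b := n) (by omega)
    have h1 := Int.emod_lt_of_pos x (b := n) (by omega)
    rw [e1, mem_separatedCore h0 h1] at hx2
    rw [e2, mem_separatedCore h0 h1] at hx1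
    have e3 : x / n = -(x % n * M) := by omega
    have h2 : (x % n) * 1 ≤ x % n * (n * M) := mul_le_mul_of_nonneg_left (by
      have : (1 : ℤ) * 1 ≤ n * M := mul_le_mul hn1 (by omega) (by omega) (by omega)
      omega) h0
    rw [e3] at e1
    have e4 : (n : ℤ) * -(x % n * M) = -(x % n * (n * M)) := by ring
    omega
  · have := raiseNorm_separated g (M := M) (lo := lo) (fun s hs0 hsn => by
      have : (n : ℤ) * (s * M) ≤ n * (n * M) :=
        mul_le_mul_of_nonneg_left (mul_le_mul_of_nonneg_right hsn (by omega)) (by omega)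
      omega) (n - 1) r r 0 0 A (by omega) le_rfl (by omega) (fun s l' hs0 hst hx => ?_)
      (fun s l' hs hsn _ => mem_separatedCore (by push_cast at hs; omega) hsn) ?_ (by push_cast; omega)
    · rw [show ((0 : ℕ) : ℤ) + n * 0 + 1 = 1 by simp] at this
      rw [Finset.range_eq_Ico]
      exact this
    · obtain rfl : s = 0 := by push_cast at hst; omega
      refine (mem_separatedCore le_rfl (by omega)).mpr ?_
      simp only [Nat.cast_zero, zero_add, mul_zero] at hx
      rw [zero_mul, neg_zero]
      exact neg_of_mul_neg_right hx (by omega)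
    · have := mem_separatedCore (n := n) (M := M) (s := 0) (l := 0) le_rfl (by omega)
      push_cast
      rw [this]
      simp

/-- On a core, Newton's identity for the E's applied after F_{k+1} gives (k+1) h_{k+1} = ∑
(c_i/(i+1)) h_{k-i}, where c_i is the central scalar, because the power sums kill the core. The
logarithmic derivative of ∏ 1/(1 - v^s X) gives the same recursion with power sums of 1, v, …,
v^{n-1}, and comparing the two determines c_k. -/
theorem curScalar_eq [CharZero K] (hq : q ≠ 0) (k : ℕ) :
    curScalar g k = (k + 1) * ∑ t ∈ Finset.range n, ((q ^ 2) ^ t) ^ (k + 1) := by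
  induction k using Nat.strong_induction_on with
  | _ k ih =>
  have hk : ((k : K) + 1) ≠ 0 := Nat.cast_add_one_ne_zero k
  set F : PowerSeries K := ∏ s ∈ Finset.range n, geomSeries ((q ^ 2) ^ s) with hF
  -- Separation k + 2 is what matrix elements up to h_{k+1} require.
  set A := separatedCore n (k + 2)
  have ha : ∀ j, j ≤ k + 1 →
      lowerAll g j (raiseAll g j (Finsupp.single A 1)) A = PowerSeries.coeff j F :=
    fun j hj => raiseAll_separatedCore g (by omega)
  have hlog : IsLogDeriv F (∑ s ∈ Finset.range n,
      PowerSeries.C ((q ^ 2) ^ s) * geomSeries ((q ^ 2) ^ s)) :=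
    IsLogDeriv.prod _ fun s _ => isLogDeriv_geomSeries _
  have hL : ∀ i, PowerSeries.coeff i (∑ s ∈ Finset.range n,
      PowerSeries.C ((q ^ 2) ^ s) * geomSeries ((q ^ 2) ^ s)) =
      ∑ t ∈ Finset.range n, ((q ^ 2) ^ t) ^ (i + 1) := fun i => by
    rw [map_sum]
    refine Finset.sum_congr rfl fun t _ => ?_
    rw [PowerSeries.coeff_C_mul, geomSeries, PowerSeries.coeff_mk]
    exact (pow_succ' _ i).symm
  have h1 := hlog.coeff_succ k
  have h2 := DFunLike.congr_fun (lowerCur_sum g k (raiseAll g (k + 1) (Finsupp.single A 1))) A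
  rw [Finsupp.smul_apply, ha _ le_rfl, smul_eq_mul, h1, Finsupp.finsetSum_apply] at h2
  have hterm : ∀ i ∈ Finset.range (k + 1),
      lowerAll g (k - i) (lowerCur g i (raiseAll g (k + 1) (Finsupp.single A 1))) A =
        curScalar g i / (i + 1) * PowerSeries.coeff (k - i) F := by
    intro i hi
    rw [Finset.mem_range] at hi
    rw [lowerCur_raiseAll g hq, lowerCur_eq_zero g (fun r => lowerAll_separatedCore g _ r),
      map_zero, zero_add, if_pos hi, map_smul, Finsupp.smul_apply, smul_eq_mul,
      show k + 1 - (i + 1) = k - i by omega, ha _ (by omega)]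
  rw [Finset.sum_congr rfl hterm, Finset.sum_range_succ, Finset.sum_range_succ _ k] at h2
  rw [Finset.sum_congr rfl fun i hi => by
    rw [ih i (Finset.mem_range.mp hi), mul_div_cancel_left₀ _ (Nat.cast_add_one_ne_zero (R := K) i),
      ← hL i]] at h2
  have h3 := add_left_cancel h2
  have hF0 : PowerSeries.coeff 0 F = 1 := by
    rw [← ha 0 (by omega), lowerAll_zero, raiseAll_zero]
    simp
  rw [Nat.sub_self, hF0, mul_one, mul_one, hL, div_eq_iff hk] at h3
  rw [h3, mul_comm]

end Core

/-! ### Index sequences: prefixes, tails and vacua. -/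

section Sequences

namespace SemiInf

theorem ext' {m m' : SemiInf} (h : ∀ i, m.1 i = m'.1 i) : m = m' := Subtype.ext (funext h)

/-- Put an entry in front of a sequence. -/
def cons (x : ℤ) (m : SemiInf) : SemiInf :=
  ⟨fun i => Nat.casesOn i x m.1, by
    obtain ⟨c, hc⟩ := m.2
    refine ⟨c + 1, ?_⟩
    rw [Filter.eventually_atTop] at hc ⊢
    obtain ⟨N, hN⟩ := hc
    refine ⟨N + 1, fun i hi => ?_⟩
    obtain ⟨j, rfl⟩ : ∃ j, i = j + 1 := ⟨i - 1, by omega⟩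
    show m.1 j = _
    rw [hN j (by omega)]
    push_cast
    ring⟩

theorem cons_zero (x : ℤ) (m : SemiInf) : (cons x m).1 0 = x := rfl

theorem cons_succ (x : ℤ) (m : SemiInf) (i : ℕ) : (cons x m).1 (i + 1) = m.1 i := rfl

/-- Put a list of entries in front of a sequence. -/
def prepend (L : List ℤ) (m : SemiInf) : SemiInf := L.foldr cons m

theorem prepend_append (L L' : List ℤ) (m : SemiInf) :
    prepend (L ++ L') m = prepend L (prepend L' m) := List.foldr_append

theorem set_cons_zero (x a : ℤ) (m : SemiInf) : (cons x m).set 0 a = cons a m :=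
  ext' fun i => by
    cases i with
    | zero => simp [set, cons_zero]
    | succ i => simp [set, cons_succ]

theorem set_cons_succ (x a : ℤ) (m : SemiInf) (i : ℕ) :
    (cons x m).set (i + 1) a = cons x (m.set i a) :=
  ext' fun j => by
    cases j with
    | zero => exact Function.update_of_ne (Nat.succ_ne_zero i).symm a (cons x m).1
    | succ j =>
      rw [cons_succ]
      simp only [set, Function.update_apply, add_left_inj]
      rfl

theorem set_prepend (P : List ℤ) (m : SemiInf) (i : ℕ) (a : ℤ) :
    (prepend P m).set (P.length + i) a = prepend P (m.set i a) := by
  induction P with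
  | nil => simp [prepend]
  | cons x P ih =>
    show (cons x (prepend P m)).set (P.length + 1 + i) a = cons x (prepend P (m.set i a))
    rw [show P.length + 1 + i = P.length + i + 1 by ring, set_cons_succ, ih]

theorem prepend_apply (P : List ℤ) (m : SemiInf) (i : ℕ) :
    (prepend P m).1 (P.length + i) = m.1 i := by
  induction P with
  | nil => simp [prepend]
  | cons x P ih =>
    show (cons x (prepend P m)).1 (P.length + 1 + i) = _
    rw [show P.length + 1 + i = P.length + i + 1 by ring, cons_succ, ih]

/-- Remove the first entries of a sequence. -/
def drop (m : SemiInf) (r : ℕ) : SemiInf :=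
  ⟨fun i => m.1 (r + i), by
    obtain ⟨c, hc⟩ := m.2
    refine ⟨c - r, ?_⟩
    rw [Filter.eventually_atTop] at hc ⊢
    obtain ⟨N, hN⟩ := hc
    refine ⟨N, fun i hi => (hN (r + i) (by omega)).trans ?_⟩
    push_cast
    ring⟩

/-- The first entries of a sequence. -/
def take (m : SemiInf) (r : ℕ) : List ℤ := (List.range r).map m.1

theorem length_take (m : SemiInf) (r : ℕ) : (m.take r).length = r := by simp [take]

theorem cons_drop_one (m : SemiInf) : cons (m.1 0) (m.drop 1) = m :=
  ext' fun i => by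
    cases i with
    | zero => rfl
    | succ i => rw [cons_succ, drop]; simp only [add_comm]

theorem take_succ (m : SemiInf) (r : ℕ) : m.take (r + 1) = m.1 0 :: (m.drop 1).take r := by
  simp only [take, List.range_succ_eq_map, List.map_cons, List.map_map, drop]
  congr 1
  refine List.map_congr_left fun i _ => ?_
  simp [add_comm]

theorem drop_drop (m : SemiInf) (r s : ℕ) : (m.drop r).drop s = m.drop (r + s) :=
  ext' fun i => by simp only [drop, add_assoc]

theorem prepend_take (m : SemiInf) (r : ℕ) : prepend (m.take r) (m.drop r) = m := by
  induction r generalizing m with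
  | zero => exact ext' fun i => congrArg m.1 (zero_add i)
  | succ r ih =>
    rw [take_succ, add_comm, ← drop_drop]
    show cons (m.1 0) (prepend _ _) = m
    rw [ih, cons_drop_one]

/-- The sequence `c - 1, c - 2, …` of the vacuum. -/
def vac (c : ℤ) : SemiInf := ⟨fun i => c - 1 - i, c - 1, Filter.Eventually.of_forall fun _ => rfl⟩

theorem drop_vac (c : ℤ) (r : ℕ) : (vac c).drop r = vac (c - r) :=
  ext' fun i => by simp only [drop, vac]; push_cast; ring

theorem exists_drop_eq_vac (m : SemiInf) : ∃ (N : ℕ) (c : ℤ), ∀ r, N ≤ r →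
    m.drop r = vac (c - r) ∧ ∀ x ∈ m.take r, c - r ≤ x := by
  obtain ⟨c, hc⟩ := m.2
  obtain ⟨N, hN⟩ := Filter.eventually_atTop.mp hc
  obtain ⟨B, hB⟩ := ((List.range N).map m.1).toFinset.bddBelow
  -- Beyond the start N of the regular tail, the cut waits until the vacuum below it has dropped
  -- under the lower bound B of the irregular entries.
  refine ⟨N + (c - B + 1).toNat, c + 1, fun r hr => ⟨ext' fun i => ?_, fun x hx => ?_⟩⟩
  · simp only [drop, vac]
    rw [hN (r + i) (by omega)]
    push_cast
    ring
  · obtain ⟨i, hi, rfl⟩ := List.mem_map.mp hx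
    rw [List.mem_range] at hi
    by_cases hiN : i < N
    · have : B ≤ m.1 i := hB (by
        rw [Finset.mem_coe, List.mem_toFinset, List.mem_map]
        exact ⟨i, List.mem_range.mpr hiN, rfl⟩)
      omega
    · rw [hN i (by omega)]
      omega

theorem strictAnti_cons {x : ℤ} {m : SemiInf} (h : StrictAnti m.1) (hx : m.1 0 < x) :
    StrictAnti (cons x m).1 := by
  refine strictAnti_nat_of_succ_lt fun i => ?_
  cases i with
  | zero => exact hx
  | succ i => exact h (Nat.lt_succ_self i)

theorem strictAnti_vac (c : ℤ) : StrictAnti (vac c).1 :=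
  strictAnti_nat_of_succ_lt fun i => by simp only [vac]; push_cast; omega

theorem strictAnti_prepend {L : List ℤ} (hL : L.Pairwise (· > ·)) {c : ℤ} (hc : ∀ x ∈ L, c ≤ x) :
    StrictAnti (prepend L (vac c)).1 := by
  induction L with
  | nil => exact strictAnti_vac c
  | cons x L ih =>
    rw [List.pairwise_cons] at hL
    refine strictAnti_cons (ih hL.2 fun y hy => hc y (List.mem_cons_of_mem _ hy)) ?_
    cases L with
    | nil =>
      have := hc x List.mem_cons_self
      show c - 1 - (0 : ℕ) < x
      push_cast
      omega
    | cons y L => exact hL.1 y List.mem_cons_self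

theorem pairwise_take {m : SemiInf} (h : StrictAnti m.1) (r : ℕ) :
    (m.take r).Pairwise (· > ·) := by
  rw [take, List.pairwise_map]
  exact List.pairwise_lt_range.imp fun hij => h hij

end SemiInf

end Sequences

/-! ### Termination of straightening. -/

section Straighten

variable {K : Type*} [Field K] {n : ℕ} {q : K} (g : Twist n q)

theorem orderPair_support {l m : ℤ} (hlm : l < m) {p : ℤ × ℤ}
    (hp : p ∈ (orderPair g l m).support) : p.1 + p.2 = l + m ∧ p.2 < p.1 ∧ l ≤ p.2 := by
  have hmod := Int.emod_nonneg (m - l) (b := n)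
  have key : orderPair g l m ∈
      Finsupp.supported K K {p : ℤ × ℤ | p.1 + p.2 = l + m ∧ p.2 < p.1 ∧ l ≤ p.2} := by
    rw [orderPair]
    split_ifs with h
    · refine Submodule.neg_mem _ (Finsupp.single_mem_supported K _ ?_)
      exact ⟨by ring, hlm, le_rfl⟩
    · refine Submodule.add_mem _ (Finsupp.single_mem_supported K _ ⟨by ring, hlm, le_rfl⟩)
        (Submodule.smul_mem _ _ (Submodule.sum_mem _ fun t _ => Submodule.smul_mem _ _
          (Submodule.add_mem _ ?_ ?_)))
      · split_ifs with h1
        · refine Finsupp.single_mem_supported K _ ⟨by ring, h1, ?_⟩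
          have h2 : (0 : ℤ) ≤ t * n := by positivity
          have h3 : 0 ≤ (m - l) % n := by
            rcases Nat.eq_zero_or_pos n with h0 | h0
            · subst h0; simp; omega
            · exact hmod (by omega)
          show l ≤ l + t * n + (m - l) % n
          omega
        · exact Submodule.zero_mem _
      · split_ifs with h1
        · refine Finsupp.single_mem_supported K _ ⟨by ring, h1, ?_⟩
          have h2 : (0 : ℤ) ≤ (t + 1) * n := by positivity
          show l ≤ l + (t + 1) * n
          omega
        · exact Submodule.zero_mem _
  exact (Finsupp.mem_supported K _).mp key hp

variable {V : Type*} [AddCommGroup V] [Module K V]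

/-- A family indexed by lists that satisfies the normal ordering relations. -/
def IsStraightening (f : List ℤ → V) : Prop :=
  ∀ (P : List ℤ) (l m : ℤ) (Q : List ℤ), l ≤ m → f (P ++ l :: m :: Q) =
    Finsupp.linearCombination K (fun p : ℤ × ℤ => f (P ++ p.1 :: p.2 :: Q)) (orderPair g l m)

/-- The measure that decreases under straightening. -/
def disorder (lo : ℤ) : List ℤ → ℤ
  | [] => 0
  | _ :: L => disorder lo L + (L.map (· - lo)).sum

theorem disorder_nonneg {lo : ℤ} {L : List ℤ} (h : ∀ x ∈ L, lo ≤ x) : 0 ≤ disorder lo L := by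
  induction L with
  | nil => exact le_rfl
  | cons x L ih =>
    have h' : ∀ y ∈ L, lo ≤ y := fun y hy => h y (List.mem_cons_of_mem _ hy)
    refine add_nonneg (ih h') (List.sum_nonneg fun y hy => ?_)
    obtain ⟨z, hz, rfl⟩ := List.mem_map.mp hy
    have := h' z hz
    omega

/-- The measure weights each entry by its position; straightening keeps the sum of a pair and
decreases its second entry. -/
theorem disorder_lt (lo : ℤ) (P Q : List ℤ) {l m a b : ℤ} (h : a + b = l + m) (hb : b < m) :
    disorder lo (P ++ a :: b :: Q) < disorder lo (P ++ l :: m :: Q) := by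
  induction P with
  | nil => simp only [List.nil_append, disorder, List.map_cons, List.sum_cons]; omega
  | cons x P ih =>
    simp only [List.cons_append, disorder, List.map_append, List.map_cons, List.sum_append,
      List.sum_cons]
    omega

theorem exists_descent_of_not_pairwise {L : List ℤ} (h : ¬L.Pairwise (· > ·)) :
    ∃ P l m Q, l ≤ m ∧ L = P ++ l :: m :: Q := by
  induction L with
  | nil => exact absurd List.Pairwise.nil h
  | cons x L ih =>
    by_cases hL : L.Pairwise (· > ·)
    · cases L with
      | nil => exact absurd (List.pairwise_singleton _ _) h
      | cons y L =>
        refine ⟨[], x, y, L, ?_, rfl⟩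
        by_contra hxy
        rw [not_le] at hxy
        refine h (List.pairwise_cons.mpr ⟨fun z hz => ?_, hL⟩)
        rcases List.mem_cons.mp hz with rfl | hz
        · exact hxy
        · exact lt_trans ((List.pairwise_cons.mp hL).1 z hz) hxy
    · obtain ⟨P, l, m, Q, hlm, rfl⟩ := ih hL
      exact ⟨x :: P, l, m, Q, hlm, rfl⟩

/-- Straightening a descent never leaves the interval [lo, hi] and lowers the measure, which is
nonnegative there. A repeated adjacent entry gives f = -f, hence 0. -/
theorem IsStraightening.mem_span [CharZero K] {f : List ℤ → V} (hf : IsStraightening g f)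
    {lo hi : ℤ} {L : List ℤ} (hL : ∀ x ∈ L, lo ≤ x ∧ x ≤ hi) :
    f L ∈ Submodule.span K {w | ∃ L' : List ℤ, L'.Pairwise (· > ·) ∧ L'.length = L.length ∧
      (∀ x ∈ L', lo ≤ x ∧ x ≤ hi) ∧ w = f L'} := by
  have key : ∀ (d : ℕ) (L : List ℤ), disorder lo L ≤ d → (∀ x ∈ L, lo ≤ x ∧ x ≤ hi) →
      f L ∈ Submodule.span K {w | ∃ L' : List ℤ, L'.Pairwise (· > ·) ∧ L'.length = L.length ∧
        (∀ x ∈ L', lo ≤ x ∧ x ≤ hi) ∧ w = f L'} := by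
    intro d
    induction d using Nat.strong_induction_on with
    | _ d ih =>
    intro L hd hL
    by_cases hs : L.Pairwise (· > ·)
    · exact Submodule.subset_span ⟨L, hs, rfl, hL, rfl⟩
    obtain ⟨P, l, m, Q, hlm, rfl⟩ := exists_descent_of_not_pairwise hs
    rcases hlm.eq_or_lt with rfl | hlm'
    · have := hf P l l Q le_rfl
      rw [orderPair, if_pos (by simp), map_neg, Finsupp.linearCombination_single, one_smul,
        eq_neg_iff_add_eq_zero, ← two_smul K, smul_eq_zero] at this
      rw [this.resolve_left two_ne_zero]
      exact Submodule.zero_mem _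
    · rw [hf P l m Q hlm, Finsupp.linearCombination_apply, Finsupp.sum]
      refine Submodule.sum_mem _ fun p hp => Submodule.smul_mem _ _ ?_
      obtain ⟨h1, h2, h3⟩ := orderPair_support g hlm' hp
      have hm := hL m (by simp)
      have hl := hL l (by simp)
      have hp' : ∀ x ∈ P ++ p.1 :: p.2 :: Q, lo ≤ x ∧ x ≤ hi := by
        intro x hx
        simp only [List.mem_append, List.mem_cons] at hx
        rcases hx with hx | rfl | rfl | hx
        · exact hL x (by simp [hx])
        · omega
        · omega
        · exact hL x (by simp [hx])
      have hlt := disorder_lt lo P Q h1 (show p.2 < m by omega)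
      have h0 := disorder_nonneg (lo := lo) fun x hx => (hp' x hx).1
      have := ih (disorder lo (P ++ p.1 :: p.2 :: Q)).toNat (by omega) _ (by omega) hp'
      simpa using this
  exact key (disorder lo L).toNat L (by omega) hL

/-- Pigeonhole: no strictly decreasing list of this length fits into the interval. -/
theorem IsStraightening.eq_zero [CharZero K] {f : List ℤ → V} (hf : IsStraightening g f)
    {lo hi : ℤ} {L : List ℤ} (hL : ∀ x ∈ L, lo ≤ x ∧ x ≤ hi) (hlen : hi - lo + 1 < L.length)
    (hle : lo ≤ hi + 1) : f L = 0 := by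
  have := hf.mem_span g hL
  refine (Submodule.span_eq_bot.mpr ?_).le this
  rintro w ⟨L', hs, hlen', hL', -⟩
  exfalso
  have h1 : L'.toFinset ⊆ Finset.Icc lo hi := fun x hx =>
    Finset.mem_Icc.mpr (hL' x (List.mem_toFinset.mp hx))
  have h2 := Finset.card_le_card h1
  rw [List.toFinset_card_of_nodup (hs.imp fun h => ne_of_gt h), Int.card_Icc, hlen'] at h2
  omega

end Straighten

/-! ### Normally ordered wedges span Fock space. -/

section Fock

open SemiInf

variable {K : Type*} [Field K] {n : ℕ} {q : K} (g : Twist n q)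

theorem wedge_straightening (s : SemiInf) (P₀ : List ℤ) :
    IsStraightening g fun L => wedge g (prepend (P₀ ++ L) s) := by
  intro P l m Q hlm
  set w := prepend (P₀ ++ (P ++ l :: m :: Q)) s with hw
  have e : ∀ a b, prepend (P₀ ++ (P ++ a :: b :: Q)) s =
      prepend (P₀ ++ P) (cons a (cons b (prepend Q s))) := fun a b => by
    rw [← List.append_assoc, prepend_append]; rfl
  have e0 : w.1 (P₀ ++ P).length = l := by
    rw [hw, e]
    exact prepend_apply (P₀ ++ P) _ 0
  have e1 : w.1 ((P₀ ++ P).length + 1) = m := by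
    rw [hw, e]
    exact prepend_apply (P₀ ++ P) _ 1
  have hrel : Finsupp.single w 1 -
      (orderPair g (w.1 (P₀ ++ P).length) (w.1 ((P₀ ++ P).length + 1))).mapDomain
        (fun p => (w.set (P₀ ++ P).length p.1).set ((P₀ ++ P).length + 1) p.2) ∈ relations g :=
    Submodule.subset_span ⟨w, (P₀ ++ P).length, by rw [e0, e1]; exact hlm, rfl⟩
  rw [e0, e1] at hrel
  have hset : ∀ p : ℤ × ℤ, (w.set (P₀ ++ P).length p.1).set ((P₀ ++ P).length + 1) p.2 =
      prepend (P₀ ++ (P ++ p.1 :: p.2 :: Q)) s := fun p => by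
    rw [hw, e, e]
    have := set_prepend (P₀ ++ P) (cons l (cons m (prepend Q s))) 0 p.1
    rw [add_zero] at this
    rw [this, set_cons_zero, set_prepend, set_cons_succ, set_cons_zero]
  simp only [hset] at hrel
  have := (Submodule.Quotient.mk_eq_zero _).mpr hrel
  rw [← Submodule.mkQ_apply, map_sub, sub_eq_zero] at this
  refine this.trans ?_
  rw [Finsupp.linearCombination_apply, Finsupp.mapDomain, Finsupp.sum, map_sum, Finsupp.sum]
  refine Finset.sum_congr rfl fun p _ => ?_
  refine Eq.trans ?_ (map_smul (relations g).mkQ _ _)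
  rw [Finsupp.smul_single, smul_eq_mul, mul_one]

theorem wedge_eq_zero_of_window [CharZero K] {m : SemiInf} {p len : ℕ} {lo hi : ℤ}
    (h : ∀ j, j < len → lo ≤ m.1 (p + j) ∧ m.1 (p + j) ≤ hi) (hlen : hi - lo + 1 < len)
    (hle : lo ≤ hi + 1) : wedge g m = 0 := by
  have e : m = prepend (m.take p ++ (m.drop p).take len) (m.drop (p + len)) := by
    rw [prepend_append, ← drop_drop, prepend_take, prepend_take]
  rw [e]
  refine (wedge_straightening g (m.drop (p + len)) (m.take p)).eq_zero g (lo := lo) (hi := hi)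
    (fun x hx => ?_) (by rwa [length_take]) hle
  obtain ⟨j, hj, rfl⟩ := List.mem_map.mp hx
  exact h j (List.mem_range.mp hj)

theorem wedge_mem_span [CharZero K] (m : SemiInf) :
    wedge g m ∈ LinearMap.range
      (Finsupp.linearCombination K fun m : NormOrd => wedge g m.1) := by
  rw [Finsupp.range_linearCombination]
  obtain ⟨N, c, h⟩ := m.exists_drop_eq_vac
  obtain ⟨h1, h2⟩ := h N le_rfl
  obtain ⟨hi, hhi⟩ := (m.take N).toFinset.exists_le
  have := (wedge_straightening g (m.drop N) []).mem_span g (lo := c - N) (hi := hi)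
    (L := m.take N) fun x hx => ⟨h2 x hx, hhi x (List.mem_toFinset.mpr hx)⟩
  simp only [List.nil_append, prepend_take] at this
  refine Submodule.span_mono ?_ this
  rintro w ⟨L', hs, -, hL', rfl⟩
  refine ⟨⟨prepend L' (m.drop N), ?_⟩, rfl⟩
  rw [h1]
  exact strictAnti_prepend hs fun x hx => (hL' x hx).1

theorem linearCombination_wedge_surjective [CharZero K] :
    Function.Surjective (Finsupp.linearCombination K fun m : NormOrd => wedge g m.1) := by
  rw [← LinearMap.range_eq_top, eq_top_iff]
  rintro x -
  obtain ⟨v, rfl⟩ := (relations g).mkQ_surjective x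
  induction v using Finsupp.induction_linear with
  | zero => rw [map_zero]; exact Submodule.zero_mem _
  | add v w hv hw => rw [map_add]; exact Submodule.add_mem _ hv hw
  | single m a =>
    rw [← mul_one a, ← smul_eq_mul, ← Finsupp.smul_single, map_smul]
    exact Submodule.smul_mem _ _ (wedge_mem_span g m)

end Fock

/-! ### The map from Fock space to the span of Maya diagrams. -/

section FockMap

open SemiInf

variable {K : Type*} [Field K] {n : ℕ} {q : K} (g : Twist n q)

/-- The product of the operators `wedgeOp` along a list. -/
noncomputable def wedgeList (L : List ℤ) : Module.End K (Maya →₀ K) := (L.map (wedgeOp g)).prod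

theorem wedgeList_cons (x : ℤ) (L : List ℤ) (v : Maya →₀ K) :
    wedgeList g (x :: L) v = wedgeOp g x (wedgeList g L v) := by
  rw [wedgeList, List.map_cons, List.prod_cons]; rfl

theorem wedgeList_nil (v : Maya →₀ K) : wedgeList g [] v = v := rfl

theorem wedgeList_append (L L' : List ℤ) (v : Maya →₀ K) :
    wedgeList g (L ++ L') v = wedgeList g L (wedgeList g L' v) := by
  rw [wedgeList, List.map_append, List.prod_append]; rfl

/-- The vector of a semi-infinite wedge in the space of Maya diagrams. -/
noncomputable def mayaVec (m : SemiInf) : Maya →₀ K :=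
  wedgeList g (m.take m.exists_drop_eq_vac.choose) (Finsupp.single
    (Maya.sea (m.exists_drop_eq_vac.choose_spec.choose - m.exists_drop_eq_vac.choose)) 1)

theorem _root_.LLT.SemiInf.vac_injective {c c' : ℤ} (h : vac c = vac c') : c = c' := by
  have : (vac c).1 0 = (vac c').1 0 := by rw [h]
  simp only [vac] at this
  omega

variable [NeZero n]

/-- A later cut changes nothing, since ψ_c turns the vacuum at c into the vacuum at c + 1. So
`mayaVec` does not depend on the chosen cut. -/
theorem wedgeList_take_add {m : SemiInf} {r : ℕ} {c : ℤ} (h : m.drop r = vac c) (d : ℕ) :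
    wedgeList g (m.take (r + d)) (Finsupp.single (Maya.sea (c - d)) 1) =
      wedgeList g (m.take r) (Finsupp.single (Maya.sea c) 1) := by
  induction d with
  | zero => simp
  | succ d ih =>
    rw [← ih, ← add_assoc, take, List.range_succ, List.map_append, wedgeList_append,
      List.map_singleton, wedgeList_cons, wedgeList_nil]
    have hm : m.1 (r + d) = c - (d + 1 : ℕ) := by
      have : (m.drop r).1 d = (vac c).1 d := by rw [h]
      simp only [drop, vac] at this
      rw [this]
      push_cast
      ring
    rw [hm, wedgeOp_sea, take]
    congr 3
    push_cast
    ring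

theorem mayaVec_eq {m : SemiInf} {r : ℕ} {c : ℤ} (h : m.drop r = vac c) :
    mayaVec g m = wedgeList g (m.take r) (Finsupp.single (Maya.sea c) 1) := by
  have key : ∀ {r r' : ℕ} {c c' : ℤ}, m.drop r = vac c → m.drop r' = vac c' → r ≤ r' →
      wedgeList g (m.take r') (Finsupp.single (Maya.sea c') 1) =
        wedgeList g (m.take r) (Finsupp.single (Maya.sea c) 1) := by
    intro r r' c c' h h' hr
    obtain ⟨d, rfl⟩ := Nat.exists_eq_add_of_le hr
    rw [← drop_drop, h, drop_vac] at h'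
    rw [← vac_injective h', wedgeList_take_add g h]
  set N := m.exists_drop_eq_vac.choose
  have h' := (m.exists_drop_eq_vac.choose_spec.choose_spec N le_rfl).1
  rw [mayaVec]
  rcases le_total r N with hr | hr
  · exact key h h' hr
  · exact (key h' h hr).symm

theorem mayaVec_vac (c : ℤ) : mayaVec g (vac c) = Finsupp.single (Maya.sea c) 1 := by
  rw [mayaVec_eq g (r := 0) (c := c) (by rw [drop_vac]; simp)]
  rfl

theorem mayaVec_cons (x : ℤ) (m : SemiInf) :
    mayaVec g (SemiInf.cons x m) = wedgeOp g x (mayaVec g m) := by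
  obtain ⟨N, c, h⟩ := m.exists_drop_eq_vac
  have h1 := (h N le_rfl).1
  have e : (SemiInf.cons x m).drop 1 = m := ext' fun i => by
    simp only [drop, add_comm 1 i, cons_succ]
  have h2 : (SemiInf.cons x m).drop (1 + N) = vac (c - N) := by rw [← drop_drop, e, h1]
  rw [mayaVec_eq g h1, mayaVec_eq g h2, add_comm, take_succ, wedgeList_cons, e]
  rfl

theorem mayaVec_prepend (L : List ℤ) (m : SemiInf) :
    mayaVec g (prepend L m) = wedgeList g L (mayaVec g m) := by
  induction L with
  | nil => rfl
  | cons x L ih =>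
    rw [wedgeList_cons, ← ih]
    exact mayaVec_cons g x _

variable [CharZero K]

/-- The entries before the adjacent pair act as a linear operator and the tail is a vector, so only
`wedgeOp_orderPair` for the pair itself is needed. -/
theorem mayaVec_relation (hq : q ≠ 0) : relations g ≤
    LinearMap.ker (Finsupp.linearCombination K (mayaVec g)) := by
  refine Submodule.span_le.mpr ?_
  rintro _ ⟨m, i, hi, rfl⟩
  have e : m = prepend (m.take i) (SemiInf.cons (m.1 i) (SemiInf.cons (m.1 (i + 1))
      (m.drop (i + 2)))) := by
    conv_lhs => rw [← prepend_take m i, ← cons_drop_one (m.drop i), drop_drop,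
      ← cons_drop_one (m.drop (i + 1)), drop_drop]
    rfl
  have hset : ∀ p : ℤ × ℤ, (m.set i p.1).set (i + 1) p.2 = prepend (m.take i)
      (SemiInf.cons p.1 (SemiInf.cons p.2 (m.drop (i + 2)))) := fun p => by
    set a := m.1 i
    set b := m.1 (i + 1)
    set P := m.take i with hP
    set s := m.drop (i + 2)
    have hl : P.length = i := length_take m i
    rw [e, ← hl]
    have := set_prepend P (SemiInf.cons a (SemiInf.cons b s)) 0 p.1
    rw [add_zero] at this
    rw [this, set_cons_zero, set_prepend, set_cons_succ, set_cons_zero]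
  simp only [hset]
  rw [SetLike.mem_coe, LinearMap.mem_ker, map_sub, sub_eq_zero, Finsupp.linearCombination_single,
    one_smul, Finsupp.linearCombination_mapDomain]
  conv_lhs => rw [e]
  rw [mayaVec_prepend, mayaVec_cons, mayaVec_cons, wedgeOp_orderPair g hq hi,
    Finsupp.linearCombination_apply, Finsupp.linearCombination_apply, Finsupp.sum, Finsupp.sum,
    map_sum]
  refine Finset.sum_congr rfl fun p _ => ?_
  rw [map_smul, Function.comp_apply, mayaVec_prepend, mayaVec_cons, mayaVec_cons]

/-- The map from Fock space to the space of Maya diagrams. -/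
noncomputable def fockMap (hq : q ≠ 0) : Fock g →ₗ[K] (Maya →₀ K) :=
  (relations g).liftQ (Finsupp.linearCombination K (mayaVec g)) (mayaVec_relation g hq)

theorem fockMap_wedge (hq : q ≠ 0) (m : SemiInf) : fockMap g hq (wedge g m) = mayaVec g m := by
  rw [fockMap, wedge, Submodule.mkQ_apply, Submodule.liftQ_apply,
    Finsupp.linearCombination_single, one_smul]

end FockMap

/-! ### Normally ordered wedges form a basis. -/

section Basis

open SemiInf

/-- The Maya diagram of a normally ordered wedge. -/
def NormOrd.maya (m : NormOrd) : Maya :=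
  ⟨Set.range m.1.1, by
    constructor
    · obtain ⟨N, c, h⟩ := m.1.exists_drop_eq_vac
      refine ⟨c - N, fun x hx => ⟨N + (c - N - 1 - x).toNat, ?_⟩⟩
      have h1 : (m.1.drop N).1 (c - N - 1 - x).toNat = (vac (c - N)).1 (c - N - 1 - x).toNat := by
        rw [(h N le_rfl).1]
      rw [Set.mem_Iio] at hx
      refine Eq.trans h1 ?_
      simp only [vac]
      omega
    · refine ⟨m.1.1 0 + 1, ?_⟩
      rintro _ ⟨i, rfl⟩
      have := m.2.antitone (Nat.zero_le i)
      rw [Set.mem_Iio]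
      omega⟩

theorem NormOrd.mem_maya {m : NormOrd} {x : ℤ} : x ∈ m.maya.1 ↔ ∃ i, m.1.1 i = x := Iff.rfl

theorem NormOrd.maya_injective : Function.Injective NormOrd.maya := by
  intro m m' h
  have h1 : Set.range (fun i => OrderDual.toDual (m.1.1 i)) =
    Set.range (fun i => OrderDual.toDual (m'.1.1 i)) := congrArg Subtype.val h
  have hm : ∀ m : NormOrd, StrictMono fun i => OrderDual.toDual (m.1.1 i) :=
    fun m i j hij => m.2 hij
  have h2 := (StrictMono.range_inj (hm m) (hm m')).mp h1
  exact Subtype.ext (Subtype.ext h2)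

theorem NormOrd.maya_surjective : Function.Surjective NormOrd.maya := by
  intro A
  induction A using Maya.induction_top with
  | h0 c =>
    refine ⟨⟨vac c, strictAnti_vac c⟩, Maya.ext' fun x => ?_⟩
    rw [Maya.mem_sea]
    show (∃ i, (vac c).1 i = x) ↔ x < c
    constructor
    · rintro ⟨i, rfl⟩
      simp only [vac]
      omega
    · intro hx
      refine ⟨(c - 1 - x).toNat, ?_⟩
      simp only [vac]
      omega
  | h1 A m hA ih =>
    obtain ⟨w, rfl⟩ := ih
    refine ⟨⟨SemiInf.cons m w.1, strictAnti_cons w.2 (hA _ ⟨0, rfl⟩)⟩, Maya.ext' fun x => ?_⟩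
    rw [Maya.mem_add]
    show (∃ i, (SemiInf.cons m w.1).1 i = x) ↔ x = m ∨ ∃ i, w.1.1 i = x
    constructor
    · rintro ⟨i, rfl⟩
      cases i with
      | zero => exact Or.inl rfl
      | succ i => exact Or.inr ⟨i, rfl⟩
    · rintro (rfl | ⟨i, rfl⟩)
      · exact ⟨0, rfl⟩
      · exact ⟨i + 1, rfl⟩

variable {K : Type*} [Field K] {n : ℕ} {q : K} [NeZero n] (g : Twist n q)

theorem wedgeList_pairwise {c : ℤ} {L : List ℤ} (hL : L.Pairwise (· > ·)) (hc : ∀ x ∈ L, c ≤ x) :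
    ∃ A : Maya, wedgeList g L (Finsupp.single (Maya.sea c) 1) = Finsupp.single A 1 ∧
      ∀ x, x ∈ A.1 ↔ x ∈ L ∨ x < c := by
  induction L with
  | nil => exact ⟨Maya.sea c, rfl, fun x => by simp [Maya.mem_sea]⟩
  | cons y L ih =>
    rw [List.pairwise_cons] at hL
    obtain ⟨A, h1, h2⟩ := ih hL.2 fun x hx => hc x (List.mem_cons_of_mem _ hx)
    have hy := hc y List.mem_cons_self
    have hw : A.Within A.lo y := ⟨A.within_lo_hi.1, fun x hx => by
      rcases (h2 x).mp hx with h | h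
      · exact hL.1 x h
      · omega⟩
    refine ⟨A.add y, ?_, fun x => ?_⟩
    · rw [wedgeList_cons, h1, wedgeOp_of_le g le_rfl (single_mem_withinSub hw 1), addOp_single]
    · rw [Maya.mem_add, h2, List.mem_cons, or_assoc]

theorem mayaVec_normOrd (m : NormOrd) : mayaVec g m.1 = Finsupp.single m.maya 1 := by
  obtain ⟨N, c, h⟩ := m.1.exists_drop_eq_vac
  obtain ⟨h1, h2⟩ := h N le_rfl
  obtain ⟨A, h3, h4⟩ := wedgeList_pairwise g (pairwise_take m.2 N) h2
  rw [mayaVec_eq g h1, h3]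
  congr 1
  refine Maya.ext' fun x => ?_
  rw [h4, NormOrd.mem_maya, take, List.mem_map]
  have hd : ∀ i, m.1.1 (N + i) = c - N - 1 - i := fun i => by
    have : (m.1.drop N).1 i = (vac (c - N)).1 i := by rw [h1]
    exact this
  constructor
  · rintro (⟨i, -, rfl⟩ | hx)
    · exact ⟨i, rfl⟩
    · refine ⟨N + (c - N - 1 - x).toNat, ?_⟩
      rw [hd]
      omega
  · rintro ⟨i, rfl⟩
    by_cases hi : i < N
    · exact Or.inl ⟨i, List.mem_range.mpr hi, rfl⟩
    · obtain ⟨j, rfl⟩ := Nat.exists_eq_add_of_le (not_lt.mp hi)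
      rw [hd]
      exact Or.inr (by omega)

variable [CharZero K]

theorem fockMap_linearCombination (hq : q ≠ 0) (w : NormOrd →₀ K) :
    fockMap g hq (Finsupp.linearCombination K (fun m : NormOrd => wedge g m.1) w) =
      w.mapDomain NormOrd.maya := by
  rw [Finsupp.linearCombination_apply, Finsupp.sum, map_sum, Finsupp.mapDomain, Finsupp.sum]
  refine Finset.sum_congr rfl fun m _ => ?_
  rw [map_smul, fockMap_wedge, mayaVec_normOrd, Finsupp.smul_single, smul_eq_mul, mul_one]

/-- Distinct normally ordered wedges have distinct Maya diagrams as images, and diagrams are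
independent by construction. -/
theorem linearCombination_wedge_injective (hq : q ≠ 0) :
    Function.Injective (Finsupp.linearCombination K fun m : NormOrd => wedge g m.1) := by
  intro w w' h
  have := congrArg (fockMap g hq) h
  rw [fockMap_linearCombination, fockMap_linearCombination] at this
  exact Finsupp.mapDomain_injective NormOrd.maya_injective this

/-- Since the combinations of normally ordered wedges are in bijection with Fock space, the
`Function.invFun` in `coords` is a true inverse. -/
theorem mapDomain_coords (hq : q ≠ 0) (x : Fock g) :
    (coords g x).mapDomain NormOrd.maya = fockMap g hq x := by
  obtain ⟨w, rfl⟩ := linearCombination_wedge_surjective g x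
  rw [fockMap_linearCombination, coords,
    Function.leftInverse_invFun (linearCombination_wedge_injective g hq)]

end Basis

/-! ### The current operators in the model. -/

section CurrentOperators

open SemiInf

variable {K : Type*} [Field K] {n : ℕ} {q : K} [NeZero n] (g : Twist n q)

/-- The operator `J_{k + 1}` on the space of Maya diagrams. -/
noncomputable def annihOp (k : ℕ) : Module.End K (Maya →₀ K) := (-1 : K) ^ k • lowerCur g k

/-- The operator `J_{-(k + 1)}` on the space of Maya diagrams. -/
noncomputable def creatOp (k : ℕ) : Module.End K (Maya →₀ K) := (-1 : K) ^ k • raiseCur g k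

theorem annihOp_wedgeOp (hq : q ≠ 0) (k : ℕ) (m : ℤ) (v : Maya →₀ K) :
    annihOp g k (wedgeOp g m v) =
      wedgeOp g m (annihOp g k v) + wedgeOp g (m - (k + 1) * n) v := by
  rw [annihOp, LinearMap.smul_apply, lowerCur_wedgeOp g hq, smul_add, smul_smul, ← mul_pow,
    neg_one_mul, neg_neg, one_pow, one_smul, LinearMap.smul_apply, map_smul]

/-- Leibniz rule: as a derivation the operator lowers one entry of the prefix at a time, or acts on
the tail. -/
theorem annihOp_prepend (hq : q ≠ 0) (k : ℕ) (L : List ℤ) (s : SemiInf) :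
    annihOp g k (mayaVec g (prepend L s)) = wedgeList g L (annihOp g k (mayaVec g s)) +
      ∑ i ∈ Finset.range L.length,
        mayaVec g ((prepend L s).set i ((prepend L s).1 i - (k + 1) * n)) := by
  induction L with
  | nil => simp [prepend, wedgeList_nil]
  | cons x L ih =>
    show annihOp g k (mayaVec g (SemiInf.cons x (prepend L s))) = _ + ∑ i ∈ _,
      mayaVec g ((SemiInf.cons x (prepend L s)).set i
        ((SemiInf.cons x (prepend L s)).1 i - (k + 1) * n))
    rw [mayaVec_cons, annihOp_wedgeOp g hq, ih, List.length_cons, Finset.sum_range_succ',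
      wedgeList_cons, map_add, map_sum, add_assoc]
    congr 2
    · refine Finset.sum_congr rfl fun i _ => ?_
      rw [cons_succ, set_cons_succ, mayaVec_cons]
    · rw [cons_zero, set_cons_zero, mayaVec_cons]

omit [NeZero n] in
theorem annihOp_sea (k : ℕ) (c : ℤ) : annihOp g k (Finsupp.single (Maya.sea c) 1) = 0 := by
  rw [annihOp, LinearMap.smul_apply, lowerCur_sea, smul_zero]

variable [CharZero K]

/-- In the vacuum tail, the lowered entry and the (k+1) n entries after it all lie in an interval of
(k+1) n integers, so straightening gives 0. -/
theorem wedge_set_eq_zero {m : SemiInf} {r i : ℕ} {c : ℤ} (h : m.drop r = vac c) (hi : r ≤ i)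
    (k : ℕ) : wedge g (m.set i (m.1 i - (k + 1) * n)) = 0 := by
  have hn := NeZero.pos n
  have hk : (1 : ℤ) ≤ (k + 1) * n := by
    have : 0 < (k + 1) * n := by positivity
    exact_mod_cast this
  have hd : ∀ j, r ≤ j → m.1 j = c - 1 - (j - r) := fun j hj => by
    obtain ⟨d, rfl⟩ := Nat.exists_eq_add_of_le hj
    have : (m.drop r).1 d = (vac c).1 d := by rw [h]
    refine Eq.trans this ?_
    simp only [vac]
    push_cast
    ring
  refine wedge_eq_zero_of_window g (p := i) (len := (k + 1) * n + 1) (lo := m.1 i - (k + 1) * n)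
    (hi := m.1 i - 1) (fun j hj => ?_) (by push_cast; omega) (by omega)
  rcases Nat.eq_zero_or_pos j with rfl | hj0
  · have : (m.set i (m.1 i - (k + 1) * n)).1 (i + 0) = m.1 i - (k + 1) * n :=
      Function.update_self _ _ _
    rw [this]
    omega
  · have : (m.set i (m.1 i - (k + 1) * n)).1 (i + j) = m.1 (i + j) :=
      Function.update_of_ne (by omega) _ _
    rw [this]
    have e1 := hd (i + j) (by omega)
    have e2 := hd i hi
    have hj' : (j : ℤ) < (k + 1) * n + 1 := by exact_mod_cast hj
    push_cast at e1
    omega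

/-- The sum over all positions reduces to the irregular prefix, where it agrees with the Leibniz
rule because the operator kills the vacuum. -/
theorem fockMap_currentWedge (hq : q ≠ 0) (k : ℕ) (m : NormOrd) :
    fockMap g hq (currentWedge g (k + 1) m) = annihOp g k (Finsupp.single m.maya 1) := by
  obtain ⟨N, c, h⟩ := m.1.exists_drop_eq_vac
  obtain ⟨h1, -⟩ := h N le_rfl
  rw [currentWedge, finsum_eq_sum_of_support_subset (s := Finset.range N)]
  · rw [map_sum, ← mayaVec_normOrd g]
    have := annihOp_prepend g hq k (m.1.take N) (m.1.drop N)
    rw [prepend_take, h1, mayaVec_vac, annihOp_sea, map_zero, zero_add, length_take] at this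
    rw [this]
    exact Finset.sum_congr rfl fun i _ => fockMap_wedge g hq _
  · intro i hi
    rw [Finset.coe_range, Set.mem_Iio]
    by_contra hiN
    exact hi (wedge_set_eq_zero g h1 (not_lt.mp hiN) k)

/-- Extension of scalars of an operator. -/
noncomputable def extendScalars {ι : Type*} (R : Type*) [CommRing R] [Algebra K R]
    (P : Module.End K (ι →₀ K)) : Module.End R (ι →₀ R) :=
  Finsupp.linearCombination R fun A =>
    (P (Finsupp.single A 1)).mapRange (algebraMap K R) (map_zero _)

theorem mapDomain_current {R : Type*} [CommRing R] [Algebra K R] (hq : q ≠ 0) (k : ℕ)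
    (v : NormOrd →₀ R) :
    (current R g (k + 1) v).mapDomain NormOrd.maya =
      extendScalars R (annihOp g k) (v.mapDomain NormOrd.maya) := by
  induction v using Finsupp.induction_linear with
  | zero => simp
  | add v w hv hw => rw [map_add, Finsupp.mapDomain_add, hv, hw, Finsupp.mapDomain_add, map_add]
  | single m a =>
    rw [current, extendScalars, Finsupp.mapDomain_single, Finsupp.linearCombination_single,
      Finsupp.linearCombination_single, Finsupp.mapDomain_smul, ← fockMap_currentWedge g hq,
      ← mapDomain_coords g hq]
    congr 1
    exact Finsupp.mapDomain_mapRange _ _ _ _ (map_add _)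

end CurrentOperators

/-! ### The Euler operator on power series. -/

section Euler

open PowerSeries

variable {B : Type*} [Ring B]

/-- The Euler operator `t d/dt`. -/
noncomputable def euler (f : PowerSeries B) : PowerSeries B := PowerSeries.mk fun d => d • coeff d f

theorem coeff_euler (f : PowerSeries B) (d : ℕ) : coeff d (euler f) = d • coeff d f :=
  coeff_mk _ _

theorem euler_mul (f h : PowerSeries B) : euler (f * h) = euler f * h + f * euler h := by
  ext d
  rw [coeff_euler, map_add, coeff_mul, coeff_mul, coeff_mul, ← Finset.sum_add_distrib,
    Finset.smul_sum]
  refine Finset.sum_congr rfl fun p hp => ?_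
  rw [coeff_euler, coeff_euler, ← Finset.HasAntidiagonal.mem_antidiagonal.mp hp, add_smul, smul_mul_assoc,
    mul_smul_comm]

theorem euler_C (b : B) : euler (C b) = 0 := by
  ext d
  rw [coeff_euler, coeff_C]
  rcases eq_or_ne d 0 with rfl | h <;> simp [*]

theorem euler_X_pow (k : ℕ) : euler (X ^ k : PowerSeries B) = k • X ^ k := by
  ext d
  rw [coeff_euler, map_nsmul, coeff_X_pow]
  split_ifs with h <;> simp [h]

variable (K : Type*) [Field K] [CharZero K] [Module K B]

include K in
/-- Uniqueness for the equation `t F' = c F + r`. -/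
theorem eq_of_euler_eq {c r F H : PowerSeries B} (hc : coeff 0 c = 0)
    (hF : euler F = c * F + r) (hH : euler H = c * H + r) (h0 : coeff 0 F = coeff 0 H) : F = H := by
  ext d
  induction d using Nat.strong_induction_on with
  | _ d ih =>
    rcases Nat.eq_zero_or_pos d with rfl | hd
    · exact h0
    have h1 := congrArg (coeff d) hF
    have h2 := congrArg (coeff d) hH
    rw [coeff_euler, map_add, coeff_mul] at h1 h2
    have h3 : d • coeff d F = d • coeff d H := by
      rw [h1, h2]
      congr 1
      refine Finset.sum_congr rfl fun p hp => ?_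
      have hp' := Finset.HasAntidiagonal.mem_antidiagonal.mp hp
      rcases Nat.eq_zero_or_pos p.1 with h | h
      · rw [h, hc, zero_mul, zero_mul]
      · rw [ih p.2 (by omega)]
    rw [← Nat.cast_smul_eq_nsmul K, ← Nat.cast_smul_eq_nsmul K] at h3
    exact smul_right_injective B (Nat.cast_ne_zero.mpr hd.ne') h3

end Euler

/-! ### Exchanging exponentials of annihilation and creation operators. -/

section Exchange

open PowerSeries

/-- The series `∑ c_i t ^ (i + 1)`. -/
noncomputable def shiftSeries {B : Type*} [Ring B] (c : ℕ → B) : PowerSeries B :=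
  X * PowerSeries.mk c

theorem coeff_zero_shiftSeries {B : Type*} [Ring B] (c : ℕ → B) : coeff 0 (shiftSeries c) = 0 := by
  rw [shiftSeries, coeff_zero_X_mul]

theorem coeff_succ_shiftSeries {B : Type*} [Ring B] (c : ℕ → B) (i : ℕ) :
    coeff (i + 1) (shiftSeries c) = c i := by
  rw [shiftSeries, coeff_succ_X_mul, coeff_mk]

theorem euler_mk_eq {B : Type*} [Ring B] {c F : ℕ → B}
    (h : ∀ d, (d + 1) • F (d + 1) = ∑ i ∈ Finset.range (d + 1), c i * F (d - i)) :
    euler (PowerSeries.mk F) = shiftSeries c * PowerSeries.mk F := by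
  ext d
  rw [coeff_euler, coeff_mk, shiftSeries, mul_assoc]
  cases d with
  | zero => rw [zero_smul, coeff_zero_X_mul]
  | succ d =>
    rw [h, coeff_succ_X_mul, coeff_mul, Finset.Nat.sum_antidiagonal_eq_sum_range_succ_mk]
    simp only [coeff_mk]

theorem commute_of_coeff {B : Type*} [Ring B] {W : PowerSeries B}
    (h : ∀ d b, Commute (coeff d W) b) (F : PowerSeries B) : Commute W F := by
  ext d
  rw [coeff_mul, coeff_mul, ← Finset.Nat.sum_antidiagonal_swap]
  exact Finset.sum_congr rfl fun p _ => (h _ _).eq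

variable (K : Type*) {R A : Type*} [Field K] [CharZero K] [CommRing R] [Ring A] [Module K A]
  [Algebra R A] {J C' P M : ℕ → A} {α β ζ Z ω : ℕ → R}

include K in
/-- Moving an annihilation operator past an exponential of creation operators. -/
theorem annihilate_exp (hM0 : M 0 = 1)
    (hM : ∀ e, (e + 1) • M (e + 1) = ∑ i ∈ Finset.range (e + 1), (β i • C' i) * M (e - i))
    (hJC : ∀ i k, J i * C' k = C' k * J i + if i = k then ((i + 1 : ℕ) * Z i : R) • (1 : A) else 0)
    (i : ℕ) : C (J i) * PowerSeries.mk M =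
      PowerSeries.mk M * C (J i) + (Z i * β i) • (X ^ (i + 1) * PowerSeries.mk M) := by
  have hME := euler_mk_eq hM
  set c := shiftSeries fun i => β i • C' i
  set m := PowerSeries.mk M
  have hc : C (J i) * c = c * C (J i) + ((i + 1 : ℕ) * (Z i * β i)) • X ^ (i + 1) := by
    ext d
    rw [coeff_C_mul, map_add, coeff_mul_C, coeff_smul, coeff_X_pow]
    cases d with
    | zero => rw [coeff_zero_shiftSeries]; simp
    | succ d =>
      rw [coeff_succ_shiftSeries, mul_smul_comm, hJC, smul_add, smul_mul_assoc]
      by_cases h : i = d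
      · subst h
        rw [if_pos rfl, if_pos rfl, smul_smul]
        congr 2
        ring
      · rw [if_neg h, if_neg (by omega), smul_zero, smul_zero]
  -- Both sides solve t F' = c F + r with the same inhomogeneous term, the commutator of J_i with
  -- the exponent's derivative, and have the same constant term.
  refine eq_of_euler_eq K (c := c) (r := ((i + 1 : ℕ) * (Z i * β i)) • (X ^ (i + 1) * m))
    (coeff_zero_shiftSeries _) ?_ ?_ ?_
  · rw [euler_mul, euler_C, zero_mul, zero_add, hME, ← mul_assoc, hc, add_mul, mul_assoc,
      smul_mul_assoc]
  · have hs : ∀ (a : R) (f : PowerSeries A), euler (a • f) = a • euler f := fun a f => by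
      ext d
      rw [coeff_euler, coeff_smul, coeff_smul, coeff_euler, smul_comm]
    have ha : ∀ f h : PowerSeries A, euler (f + h) = euler f + euler h := fun f h => by
      ext d
      rw [coeff_euler, map_add, map_add, coeff_euler, coeff_euler, smul_add]
    rw [ha, hs, euler_mul, euler_mul, euler_C, mul_zero, add_zero, hME, euler_X_pow, mul_add,
      ← mul_assoc (X ^ (i + 1)), ((commute_X_pow c (i + 1)).eq).symm, smul_add, mul_assoc, mul_assoc,
      mul_smul_comm, smul_mul_assoc, ← Nat.cast_smul_eq_nsmul R, smul_smul,
      mul_comm (Z i * β i)]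
    abel
  · rw [coeff_C_mul, map_add, coeff_mul_C, coeff_smul, pow_succ', mul_assoc, coeff_zero_X_mul,
      smul_zero, add_zero, coeff_mk, hM0, mul_one, one_mul]

include K in
/-- The exchange relation between exponentials of annihilation and creation operators. -/
theorem exp_exchange (hP0 : P 0 = 1) (hM0 : M 0 = 1)
    (hP : ∀ d, (d + 1) • P (d + 1) = ∑ i ∈ Finset.range (d + 1), (α i • J i) * P (d - i))
    (hM : ∀ e, (e + 1) • M (e + 1) = ∑ i ∈ Finset.range (e + 1), (β i • C' i) * M (e - i))
    (hJC : ∀ i k, J i * C' k = C' k * J i + if i = k then ((i + 1 : ℕ) * Z i : R) • (1 : A) else 0)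
    (hω0 : ω 0 = 1)
    (hω : ∀ m, (m + 1 : ℕ) * ω (m + 1) = ∑ i ∈ Finset.range (m + 1), (α i * (Z i * β i)) * ω (m - i))
    (d e : ℕ) : P d * M e =
      ∑ j ∈ Finset.range (min d e + 1), ω j • (M (e - j) * P (d - j)) := by
  have hann := annihilate_exp K hM0 hM hJC
  -- The outer variable records the degree of P, the inner one the degree of M; `W` carries the
  -- scalars ω_j at equal degrees and is central.
  set m : PowerSeries A := PowerSeries.mk M with hm
  set p : PowerSeries (PowerSeries A) := PowerSeries.mk fun d => C (P d) with hp
  set W : PowerSeries (PowerSeries A) := PowerSeries.mk fun j => ω j • X ^ j with hW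
  set jj : PowerSeries (PowerSeries A) := shiftSeries fun i => α i • C (J i) with hjj
  set w : PowerSeries (PowerSeries A) := shiftSeries fun i => (α i * (Z i * β i)) • X ^ (i + 1)
    with hw
  have hpE : euler p = jj * p := euler_mk_eq fun d => by
    have := congrArg (C (R := A)) (hP d)
    rw [map_nsmul, map_sum] at this
    rw [this]
    refine Finset.sum_congr rfl fun i _ => ?_
    rw [map_mul]
    congr 1
    ext k
    rw [coeff_smul, coeff_C, coeff_C]
    split_ifs <;> simp
  have hWE : euler W = w * W := euler_mk_eq fun k => by
    rw [← Nat.cast_smul_eq_nsmul R, smul_smul, hω, Finset.sum_smul]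
    refine Finset.sum_congr rfl fun i hi => ?_
    rw [Finset.mem_range] at hi
    rw [smul_mul_smul_comm, ← pow_add, show i + 1 + (k - i) = k + 1 by omega]
  have hWc : ∀ F, Commute W F := commute_of_coeff fun k b => by
    rw [hW, coeff_mk]
    exact (commute_X_pow b k).symm.smul_left _
  have hjm : jj * C m = C m * (jj + w) := by
    ext1 k
    rw [coeff_mul_C, coeff_C_mul, map_add]
    cases k with
    | zero => rw [coeff_zero_shiftSeries, coeff_zero_shiftSeries, zero_mul, add_zero, mul_zero]
    | succ k =>
      rw [coeff_succ_shiftSeries, coeff_succ_shiftSeries, smul_mul_assoc, hann, mul_add, smul_add,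
        mul_smul_comm, mul_smul_comm, smul_smul, (commute_X_pow m (k + 1)).eq]
  have hcomm : jj * W = W * jj := (hWc jj).eq.symm
  -- Again both sides solve the same Euler equation: moving `jj` past `C m` creates the term `w`,
  -- which is the logarithmic derivative of `W`.
  have key : p * C m = C m * (W * p) := by
    refine eq_of_euler_eq K (c := jj) (r := 0) (coeff_zero_shiftSeries _) ?_ ?_ ?_
    · rw [euler_mul, euler_C, mul_zero, add_zero, hpE, mul_assoc, add_zero]
    · rw [euler_mul, euler_C, zero_mul, zero_add, euler_mul, hpE, hWE, add_zero, ← mul_assoc jj,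
        hjm, mul_assoc, mul_assoc (C m), add_mul, ← mul_assoc jj, hcomm]
      simp only [mul_assoc, add_comm]
    · rw [coeff_mul_C, coeff_C_mul, coeff_mul, Finset.Nat.antidiagonal_zero, Finset.sum_singleton,
        coeff_mk, coeff_mk, hP0, hω0, pow_zero, one_smul, map_one, one_mul, mul_one]
      simp
  have h1 := congrArg (fun F => coeff e (coeff d F)) key
  simp only [coeff_mul_C, coeff_C_mul] at h1
  rw [hp, coeff_mk, coeff_C_mul, hm, coeff_mk] at h1
  rw [h1, coeff_mul (n := d), Finset.Nat.sum_antidiagonal_eq_sum_range_succ_mk, Finset.mul_sum,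
    map_sum]
  have hterm : ∀ j, coeff e (PowerSeries.mk M * (coeff j W * coeff (d - j)
      (PowerSeries.mk fun d => C (P d)))) =
      if j ≤ e then ω j • (M (e - j) * P (d - j)) else 0 := fun j => by
    rw [hW, coeff_mk, coeff_mk, smul_mul_assoc, mul_smul_comm, coeff_smul, ← mul_assoc,
      coeff_mul_C, coeff_mul_X_pow']
    split_ifs
    · rw [coeff_mk]
    · rw [zero_mul, smul_zero]
  rw [Finset.sum_congr rfl fun j _ => hterm j, ← Finset.sum_filter]
  congr 1
  ext j
  rw [Finset.mem_filter, Finset.mem_range, Finset.mem_range]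
  omega

end Exchange

/-! ### Coefficients of exponentials in a noncommutative algebra. -/

section ExpCoeff

open PowerSeries

variable (K : Type*) {A : Type*} [Field K] [CharZero K] [Ring A] [Algebra K A]

/-- The coefficients of the exponential of a power series. -/
noncomputable def expCoeff (h : PowerSeries A) (d : ℕ) : A :=
  ∑ j ∈ Finset.range (d + 1), ((j.factorial : K)⁻¹) • coeff d (h ^ j)

variable {h : PowerSeries A}

omit K in
theorem coeff_pow_eq_zero {A : Type*} [Ring A] {h : PowerSeries A} (h0 : coeff 0 h = 0) {d j : ℕ}
    (hdj : d < j) : coeff d (h ^ j) = 0 := by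
  induction j generalizing d with
  | zero => omega
  | succ j ih =>
    rw [pow_succ', coeff_mul]
    refine Finset.sum_eq_zero fun p hp => ?_
    have := Finset.HasAntidiagonal.mem_antidiagonal.mp hp
    rcases Nat.eq_zero_or_pos p.1 with h1 | h1
    · rw [h1, h0, zero_mul]
    · rw [ih (by omega), mul_zero]

omit [CharZero K] in
theorem expCoeff_eq (h0 : coeff 0 h = 0) {d N : ℕ} (hd : d ≤ N) :
    expCoeff K h d = ∑ j ∈ Finset.range (N + 1), ((j.factorial : K)⁻¹) • coeff d (h ^ j) := by
  refine Finset.sum_subset (Finset.range_subset_range.mpr (by omega)) fun j _ hj => ?_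
  rw [Finset.mem_range] at hj
  rw [coeff_pow_eq_zero h0 (by omega), smul_zero]

omit K in
theorem euler_pow {A : Type*} [Ring A] {h : PowerSeries A} (hc : Commute h (euler h)) (j : ℕ) :
    euler (h ^ (j + 1)) = (j + 1) • (euler h * h ^ j) := by
  induction j with
  | zero => simp
  | succ j ih =>
    rw [pow_succ', euler_mul, ih, mul_smul_comm, ← mul_assoc, hc.eq, mul_assoc, ← pow_succ',
      succ_nsmul (euler h * h ^ (j + 1)) (j + 1), add_comm]

omit [CharZero K] in
theorem expCoeff_zero : expCoeff K h 0 = 1 := by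
  rw [expCoeff, Finset.sum_range_one]
  simp

/-- This is t (exp h)' = t h' exp h read off coefficientwise; commuting c_i make h commute with its
derivative. -/
theorem expCoeff_succ (c : ℕ → A) (hc : ∀ i k, Commute (c i) (c k)) (d : ℕ) :
    (d + 1) • expCoeff K (shiftSeries c) (d + 1) =
      ∑ i ∈ Finset.range (d + 1), ((i + 1) • c i) * expCoeff K (shiftSeries c) (d - i) := by
  set h := shiftSeries c with hh
  have h0 : coeff 0 h = 0 := coeff_zero_shiftSeries c
  have hcc : ∀ i k, Commute (coeff i h) (coeff k h) := by
    intro i k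
    cases i with
    | zero => rw [h0]; exact Commute.zero_left _
    | succ i =>
      cases k with
      | zero => rw [h0]; exact Commute.zero_right _
      | succ k => rw [hh, coeff_succ_shiftSeries, coeff_succ_shiftSeries]; exact hc i k
  have hcomm : Commute h (euler h) := by
    ext d
    rw [coeff_mul, coeff_mul, ← Finset.Nat.sum_antidiagonal_swap]
    refine Finset.sum_congr rfl fun p _ => ?_
    rw [coeff_euler, coeff_euler]
    exact ((hcc _ _).smul_right _).eq
  have hpow : ∀ j, (d + 1) • coeff (d + 1) (h ^ (j + 1)) =
      (j + 1) • ∑ i ∈ Finset.range (d + 1), ((i + 1) • c i) * coeff (d - i) (h ^ j) := by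
    intro j
    have h1 := congrArg (coeff (d + 1)) (euler_pow hcomm j)
    rw [coeff_euler, map_nsmul, coeff_mul, Finset.Nat.sum_antidiagonal_eq_sum_range_succ_mk,
      Finset.sum_range_succ', coeff_euler, zero_smul, zero_mul, add_zero] at h1
    rw [h1]
    congr 1
    refine Finset.sum_congr rfl fun i _ => ?_
    rw [coeff_euler, hh, coeff_succ_shiftSeries, Nat.succ_sub_succ]
  rw [expCoeff, Finset.sum_range_succ', pow_zero, coeff_one, if_neg (Nat.succ_ne_zero d), smul_zero,
    add_zero, Finset.smul_sum]
  have hterm : ∀ j ∈ Finset.range (d + 1),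
      (d + 1) • (((j + 1).factorial : K)⁻¹ • coeff (d + 1) (h ^ (j + 1))) =
      ∑ i ∈ Finset.range (d + 1), ((i + 1) • c i) * ((j.factorial : K)⁻¹ • coeff (d - i) (h ^ j)) := by
    intro j _
    have hj : ((j : K) + 1) ≠ 0 := Nat.cast_add_one_ne_zero j
    rw [smul_comm, hpow, ← Nat.cast_smul_eq_nsmul K (j + 1), smul_smul, Nat.factorial_succ,
      Finset.smul_sum]
    refine Finset.sum_congr rfl fun i _ => ?_
    rw [mul_smul_comm]
    congr 1
    push_cast
    rw [mul_inv, mul_comm, ← mul_assoc, mul_inv_cancel₀ hj, one_mul]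
  rw [Finset.sum_congr rfl hterm, Finset.sum_comm]
  refine Finset.sum_congr rfl fun i _ => ?_
  rw [← Finset.mul_sum, ← expCoeff_eq K h0 (Nat.sub_le d i)]

end ExpCoeff

/-! ### Extension of scalars for operators. -/

section ExtendScalars

variable {K : Type*} [Field K] {ι : Type*} {R : Type*} [CommRing R] [Algebra K R]

theorem extendScalars_single (P : Module.End K (ι →₀ K)) (A : ι) (a : R) :
    extendScalars R P (Finsupp.single A a) =
      a • (P (Finsupp.single A 1)).mapRange (algebraMap K R) (map_zero _) := by
  rw [extendScalars, Finsupp.linearCombination_single]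

theorem extendScalars_mapRange (P : Module.End K (ι →₀ K)) (v : ι →₀ K) :
    extendScalars R P (v.mapRange (algebraMap K R) (map_zero _)) =
      (P v).mapRange (algebraMap K R) (map_zero _) := by
  induction v using Finsupp.induction_linear with
  | zero => simp
  | add v w hv hw =>
    rw [Finsupp.mapRange_add (map_add _), map_add, hv, hw, map_add,
      Finsupp.mapRange_add (map_add _)]
  | single A a =>
    rw [Finsupp.mapRange_single, extendScalars_single]
    have : Finsupp.single A a = a • Finsupp.single A (1 : K) := by simp
    rw [this, map_smul]
    ext B
    simp [Algebra.smul_def]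

theorem end_ext {P Q : Module.End R (ι →₀ R)}
    (h : ∀ A, P (Finsupp.single A 1) = Q (Finsupp.single A 1)) : P = Q := by
  refine Finsupp.lhom_ext fun A a => ?_
  have : Finsupp.single A a = a • Finsupp.single A (1 : R) := by simp
  rw [this, map_smul, map_smul, h]

variable (R) in
/-- Extension of scalars as a homomorphism of algebras. -/
noncomputable def extendHom : Module.End K (ι →₀ K) →ₐ[K] Module.End R (ι →₀ R) where
  toFun := extendScalars R
  map_one' := end_ext fun A => by simp [extendScalars_single]
  map_mul' P Q := end_ext fun A => by
    rw [Module.End.mul_apply, extendScalars_single, extendScalars_single, one_smul, one_smul,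
      Module.End.mul_apply, extendScalars_mapRange]
  map_zero' := end_ext fun A => by simp [extendScalars_single]
  map_add' P Q := end_ext fun A => by
    rw [LinearMap.add_apply, extendScalars_single, extendScalars_single, extendScalars_single,
      LinearMap.add_apply, Finsupp.mapRange_add (map_add _), smul_add]
  commutes' a := end_ext fun A => by
    rw [extendScalars_single, one_smul]
    ext B
    simp [Algebra.algebraMap_eq_smul_one]

theorem extendHom_single_apply (P : Module.End K (ι →₀ K)) (A B : ι) (a : R) :
    extendHom R P (Finsupp.single A a) B = a * algebraMap K R (P (Finsupp.single A 1) B) := by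
  show extendScalars R P (Finsupp.single A a) B = _
  rw [extendScalars_single]
  rfl

theorem extendHom_transpose {P Q : Module.End K (ι →₀ K)} (h : IsTranspose P Q) :
    IsTranspose (extendHom R P) (extendHom R Q) :=
  IsTranspose.of_single fun A B => by
    rw [extendHom_single_apply, extendHom_single_apply, h.apply_single]

theorem extendHom_mem_supported {P : Module.End K (ι →₀ K)} {S S' : Set ι}
    (h : ∀ A ∈ S, P (Finsupp.single A 1) ∈ Finsupp.supported K K S') {v : ι →₀ R}
    (hv : v ∈ Finsupp.supported R R S) : extendHom R P v ∈ Finsupp.supported R R S' := by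
  rw [Finsupp.supported_eq_span_single] at hv
  refine Submodule.span_le (p := (Finsupp.supported R R S').comap (extendHom R P)).mpr ?_ hv
  rintro _ ⟨A, hA, rfl⟩
  rw [SetLike.mem_coe, Submodule.mem_comap, Finsupp.mem_supported]
  intro B hB
  refine (Finsupp.mem_supported K _).mp (h A hA) (Finsupp.mem_support_iff.mpr fun h0 => ?_)
  rw [Finset.mem_coe, Finsupp.mem_support_iff, extendHom_single_apply, h0, map_zero, mul_zero] at hB
  exact hB rfl

end ExtendScalars

/-! ### Multiplicative filtrations and exponentials. -/

section ExpOperators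

open PowerSeries

variable {K : Type*} [Field K] {A : Type*} [Ring A] [Algebra K A]

/-- One induction serves several filtrations F: energy, degree in the variables, preservation of
charge, and commutation with a given element. -/
theorem coeff_shiftSeries_pow_mem {F : ℕ → Submodule K A} (h1 : 1 ∈ F 0)
    (hmul : ∀ i j a b, a ∈ F i → b ∈ F j → a * b ∈ F (i + j)) {c : ℕ → A}
    (hc : ∀ i, c i ∈ F (i + 1)) (j d : ℕ) : coeff d (shiftSeries c ^ j) ∈ F d := by
  induction j generalizing d with
  | zero =>
    rw [pow_zero, coeff_one]
    split_ifs with h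
    · rw [h]; exact h1
    · exact Submodule.zero_mem _
  | succ j ih =>
    rw [pow_succ', coeff_mul]
    refine Submodule.sum_mem _ fun p hp => ?_
    rw [← Finset.HasAntidiagonal.mem_antidiagonal.mp hp]
    refine hmul _ _ _ _ ?_ (ih _)
    rcases p.1 with _ | i
    · rw [coeff_zero_shiftSeries]; exact Submodule.zero_mem _
    · rw [coeff_succ_shiftSeries]; exact hc i

theorem expCoeff_mem {F : ℕ → Submodule K A} (h1 : 1 ∈ F 0)
    (hmul : ∀ i j a b, a ∈ F i → b ∈ F j → a * b ∈ F (i + j)) {c : ℕ → A}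
    (hc : ∀ i, c i ∈ F (i + 1)) (d : ℕ) : expCoeff K (shiftSeries c) d ∈ F d :=
  Submodule.sum_mem _ fun j _ =>
    Submodule.smul_mem _ _ (coeff_shiftSeries_pow_mem h1 hmul hc j d)

theorem commute_expCoeff {a : A} {c : ℕ → A} (hc : ∀ i, Commute a (c i)) (d : ℕ) :
    Commute a (expCoeff K (shiftSeries c) d) := by
  have := expCoeff_mem (K := K) (c := c)
    (F := fun _ => Subalgebra.toSubmodule (Subalgebra.centralizer K {a})) (Subalgebra.one_mem _)
    (fun _ _ _ _ hx hy => Subalgebra.mul_mem _ hx hy)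
    (fun i => (Subalgebra.mem_centralizer_iff K).mpr fun _ h => by
      rw [Set.mem_singleton_iff.mp h]; exact (hc i).eq) d
  exact (Subalgebra.mem_centralizer_iff K).mp this a rfl

end ExpOperators

/-! ### Charge, and partitions as the diagrams of a given charge. -/

section Charge

open SemiInf

/-- The Maya diagrams which arise from `sea c` by moving particles. -/
def chargeSet (c : ℤ) : Set Maya :=
  {A | ∃ (a : ℤ) (S : Finset ℤ), (∀ x ∈ S, a ≤ x) ∧ (∀ x, x ∈ A.1 ↔ x < a ∨ x ∈ S) ∧
    a + S.card = c}

/-- The reference level of the description may be lowered at will, so two descriptions can be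
compared at a common level. -/
theorem exists_chargeSet_below {c : ℤ} {A : Maya} (hA : A ∈ chargeSet c) (b : ℤ) :
    ∃ a ≤ b, ∀ a' ≤ a, ∃ S : Finset ℤ, (∀ x ∈ S, a' ≤ x) ∧ (∀ x, x ∈ A.1 ↔ x < a' ∨ x ∈ S) ∧
      a' + S.card = c := by
  obtain ⟨a, S, h1, h2, h3⟩ := hA
  refine ⟨min a b, min_le_right _ _, fun a' ha' => ⟨S ∪ Finset.Ico a' a, fun x hx => ?_,
    fun x => ?_, ?_⟩⟩
  · rw [Finset.mem_union, Finset.mem_Ico] at hx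
    rcases hx with hx | hx
    · have := h1 x hx; omega
    · exact hx.1
  · rw [h2, Finset.mem_union, Finset.mem_Ico]
    have : x < a ↔ x < a' ∨ (a' ≤ x ∧ x < a) := by omega
    rw [this]
    tauto
  · rw [Finset.card_union_of_disjoint, Int.card_Ico]
    · push_cast
      rw [Int.toNat_of_nonneg (by omega)]
      omega
    · refine Finset.disjoint_left.mpr fun x hx hx' => ?_
      have := h1 x hx
      rw [Finset.mem_Ico] at hx'
      omega

theorem eq_of_mem_chargeSet {c c' : ℤ} {A : Maya} (h : A ∈ chargeSet c) (h' : A ∈ chargeSet c') :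
    c = c' := by
  obtain ⟨a, -, h1⟩ := exists_chargeSet_below h 0
  obtain ⟨b, hb, h2⟩ := exists_chargeSet_below h' a
  obtain ⟨S, hS, hS', rfl⟩ := h1 b hb
  obtain ⟨T, hT, hT', rfl⟩ := h2 b le_rfl
  have : S = T := by
    ext x
    constructor
    · intro hx
      have := hS x hx
      rcases (hT' x).mp ((hS' x).mpr (Or.inr hx)) with h | h
      · omega
      · exact h
    · intro hx
      have := hT x hx
      rcases (hS' x).mp ((hT' x).mpr (Or.inr hx)) with h | h
      · omega
      · exact h
  rw [this]

theorem move_mem_chargeSet {c : ℤ} {A : Maya} {s t : ℤ} (hA : A ∈ chargeSet c) (hs : s ∈ A.1)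
    (ht : t ∉ A.1) : A.move s t ∈ chargeSet c := by
  obtain ⟨a, ha, h⟩ := exists_chargeSet_below hA (min s t)
  obtain ⟨S, h1, h2, h3⟩ := h a le_rfl
  have hsS : s ∈ S := by
    rcases (h2 s).mp hs with h | h
    · omega
    · exact h
  have htS : t ∉ S := fun h => ht ((h2 t).mpr (Or.inr h))
  refine ⟨a, insert t (S.erase s), fun x hx => ?_, fun x => ?_, ?_⟩
  · rw [Finset.mem_insert, Finset.mem_erase] at hx
    rcases hx with rfl | hx
    · omega
    · exact h1 x hx.2
  · rw [Maya.mem_move, h2, Finset.mem_insert, Finset.mem_erase]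
    have : x < a → x ≠ s := by omega
    tauto
  · rw [Finset.card_insert_of_notMem fun h => htS (Finset.mem_of_mem_erase h),
      Finset.card_erase_add_one hsS, h3]

theorem mem_chargeSet_of_drop {m : NormOrd} {r : ℕ} {c : ℤ} (h : m.1.drop r = vac c) :
    m.maya ∈ chargeSet (c + r) := by
  have hd : ∀ i, m.1.1 (r + i) = c - 1 - i := fun i => by
    have : (m.1.drop r).1 i = (vac c).1 i := by rw [h]
    exact this
  refine ⟨c, (Finset.range r).image m.1.1, fun x hx => ?_, fun x => ?_, ?_⟩
  · obtain ⟨i, hi, rfl⟩ := Finset.mem_image.mp hx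
    have h1 := m.2 (Finset.mem_range.mp hi)
    have h2 := hd 0
    rw [add_zero] at h2
    omega
  · rw [NormOrd.mem_maya, Finset.mem_image]
    constructor
    · rintro ⟨i, rfl⟩
      by_cases hi : i < r
      · exact Or.inr ⟨i, Finset.mem_range.mpr hi, rfl⟩
      · obtain ⟨j, rfl⟩ := Nat.exists_eq_add_of_le (not_lt.mp hi)
        rw [hd]
        exact Or.inl (by omega)
    · rintro (hx | ⟨i, -, hi⟩)
      · refine ⟨r + (c - 1 - x).toNat, ?_⟩
        rw [hd]
        omega
      · exact ⟨i, hi⟩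
  · rw [Finset.card_image_of_injective _ m.2.injective, Finset.card_range]

theorem maya_mem_chargeSet {m : NormOrd} {c : ℤ} :
    m.maya ∈ chargeSet c ↔ ∀ᶠ i : ℕ in Filter.atTop, m.1.1 i = c - (i + 1) := by
  obtain ⟨N, c', h⟩ := m.1.exists_drop_eq_vac
  have h1 := (h N le_rfl).1
  have h2 := mem_chargeSet_of_drop h1
  have hd : ∀ i, m.1.1 (N + i) = c' - N - 1 - i := fun i => by
    have : (m.1.drop N).1 i = (vac (c' - N)).1 i := by rw [h1]
    exact this
  constructor
  · intro hc
    have := eq_of_mem_chargeSet h2 hc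
    filter_upwards [Filter.eventually_ge_atTop N] with i hi
    obtain ⟨j, rfl⟩ := Nat.exists_eq_add_of_le hi
    rw [hd]
    push_cast
    omega
  · intro hc
    obtain ⟨i, hi, hi'⟩ := (hc.and (Filter.eventually_ge_atTop N)).exists
    obtain ⟨j, rfl⟩ := Nat.exists_eq_add_of_le hi'
    rw [hd] at hi
    push_cast at hi
    have : c' - N + N = c := by omega
    rwa [this] at h2

theorem ket_mem_chargeSet (c : ℤ) (ν : YoungDiagram) : (ket c ν).maya ∈ chargeSet c := by
  rw [maya_mem_chargeSet]
  filter_upwards [Filter.eventually_ge_atTop (ν.colLen 0)] with i hi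
  have h : ν.rowLen i = 0 := by
    by_contra h0
    have h1 : (i, 0) ∈ ν := YoungDiagram.mem_iff_lt_rowLen.mpr (Nat.pos_of_ne_zero h0)
    have h2 := YoungDiagram.mem_iff_lt_colLen.mp h1
    omega
  show (ν.rowLen i : ℤ) + c - (i + 1) = c - (i + 1)
  rw [h]
  push_cast
  ring

theorem _root_.YoungDiagram.exists_rowLen_eq {f : ℕ → ℕ} (hf : Antitone f) {N : ℕ}
    (hN : ∀ i, N ≤ i → f i = 0) : ∃ ν : YoungDiagram, ∀ i, ν.rowLen i = f i := by
  let ν : YoungDiagram :=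
    ⟨(Finset.range N ×ˢ Finset.range (f 0)).filter fun p => p.2 < f p.1, fun p p' h hp => by
      simp only [Finset.coe_filter, Set.mem_ofPred_eq, Finset.mem_product, Finset.mem_range] at hp ⊢
      have h1 := h.1
      have h2 := h.2
      have h3 := hf h1
      have h4 := hf (Nat.zero_le p'.1)
      omega⟩
  have hν : ∀ i j, (i, j) ∈ ν ↔ j < f i := fun i j => by
    show (i, j) ∈ (Finset.range N ×ˢ Finset.range (f 0)).filter (fun p => p.2 < f p.1) ↔ _
    simp only [Finset.mem_filter, Finset.mem_product, Finset.mem_range]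
    refine ⟨fun h => h.2, fun h => ⟨⟨?_, ?_⟩, h⟩⟩
    · by_contra h'
      have := hN i (not_lt.mp h')
      omega
    · have := hf (Nat.zero_le i)
      omega
  refine ⟨ν, fun i => ?_⟩
  have h1 := fun j => (hν i j).symm.trans YoungDiagram.mem_iff_lt_rowLen
  have h2 := h1 (ν.rowLen i)
  have h3 := h1 (f i)
  omega

/-- The row lengths are m_i + i - c in the convention i = 1, 2, …: weakly decreasing as the m_i
strictly decrease, and eventually 0 by the charge. So a sum over partitions is a sum over all
diagrams of charge c. -/
theorem exists_ket_eq {c : ℤ} {A : Maya} (hA : A ∈ chargeSet c) :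
    ∃ ν : YoungDiagram, (ket c ν).maya = A := by
  obtain ⟨m, rfl⟩ := NormOrd.maya_surjective A
  obtain ⟨N, hN⟩ := Filter.eventually_atTop.mp (maya_mem_chargeSet.mp hA)
  have hanti : Antitone fun i : ℕ => m.1.1 i + i := antitone_nat_of_succ_le fun i => by
    have := m.2 (Nat.lt_succ_self i)
    simp only [Nat.succ_eq_add_one] at this
    push_cast
    omega
  have hpos : ∀ i : ℕ, 0 ≤ m.1.1 i + (i + 1) - c := fun i => by
    have h1 : m.1.1 (max i N) + (max i N : ℕ) ≤ m.1.1 i + i := hanti (le_max_left i N)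
    have h2 := hN (max i N) (le_max_right i N)
    omega
  obtain ⟨ν, hν⟩ := YoungDiagram.exists_rowLen_eq (f := fun i => (m.1.1 i + (i + 1) - c).toNat)
    (N := N) (fun i j hij => by
      have h1 : m.1.1 j + j ≤ m.1.1 i + i := hanti hij
      show (m.1.1 j + (j + 1) - c).toNat ≤ (m.1.1 i + (i + 1) - c).toNat
      omega) (fun i hi => by have := hN i hi; omega)
  refine ⟨ν, congrArg NormOrd.maya (Subtype.ext (Subtype.ext (funext fun i => ?_)))⟩
  show (ν.rowLen i : ℤ) + c - (i + 1) = m.1.1 i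
  have := hpos i
  rw [hν]
  omega

theorem ket_injective (c : ℤ) : Function.Injective (ket c) := fun ν ν' h => by
  have hr : ∀ i, ν.rowLen i = ν'.rowLen i := fun i => by
    have : (ν.rowLen i : ℤ) + c - (i + 1) = ν'.rowLen i + c - (i + 1) :=
      congrArg (fun m : NormOrd => m.1.1 i) h
    omega
  refine YoungDiagram.ext (Finset.ext fun ⟨i, j⟩ => ?_)
  rw [YoungDiagram.mem_cells, YoungDiagram.mem_cells, YoungDiagram.mem_iff_lt_rowLen,
    YoungDiagram.mem_iff_lt_rowLen, hr]

variable {K : Type*} [Field K] {n : ℕ} {q : K} (g : Twist n q)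

theorem lowerSet_charge {c : ℤ} (S : Finset ℤ) {v : Maya →₀ K}
    (hv : v ∈ Finsupp.supported K K (chargeSet c)) :
    lowerSet g S v ∈ Finsupp.supported K K (chargeSet c) := by
  induction S using Finset.induction_on_max with
  | empty => simpa [lowerSet_empty] using hv
  | insert m S hm ih =>
    rw [lowerSet_insert g hm, Module.End.mul_apply]
    exact moveOp_mem_supported ih fun A hA hs ht => move_mem_chargeSet hA hs ht

theorem lowerAll_charge {c : ℤ} (r : ℕ) {v : Maya →₀ K}
    (hv : v ∈ Finsupp.supported K K (chargeSet c)) :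
    lowerAll g r v ∈ Finsupp.supported K K (chargeSet c) :=
  map_mem_of_mem_supported hv fun A hA => by
    rw [lowerAll_apply g le_rfl r (single_mem_withinSub A.within_lo_hi 1), lowerElem,
      LinearMap.sum_apply]
    exact Submodule.sum_mem _ fun S _ => lowerSet_charge g S (Finsupp.single_mem_supported K 1 hA)

theorem lowerCur_charge {c : ℤ} (k : ℕ) {v : Maya →₀ K}
    (hv : v ∈ Finsupp.supported K K (chargeSet c)) :
    lowerCur g k v ∈ Finsupp.supported K K (chargeSet c) := by
  induction k using Nat.strong_induction_on with
  | _ k ih =>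
    rw [lowerCur_apply]
    exact Submodule.sub_mem _ (Submodule.smul_mem _ _ (lowerAll_charge g (k + 1) hv))
      (Submodule.sum_mem _ fun i hi => lowerAll_charge g (k - i) (ih i (Finset.mem_range.mp hi)))

end Charge

/-! ### The operators J_k and their exponentials over a K-algebra. -/

section Operators

variable {K : Type*} [Field K] {n : ℕ} {q : K} [NeZero n] (g : Twist n q)

theorem neg_one_pow_smul_smul {V : Type*} [AddCommGroup V] [Module K V] (k : ℕ) (v : V) :
    (-1 : K) ^ k • (-1 : K) ^ k • v = v := by
  rw [smul_smul, ← mul_pow, neg_one_mul, neg_neg, one_pow, one_smul]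

omit [NeZero n] in
theorem annihOp_apply (k : ℕ) (v : Maya →₀ K) : annihOp g k v = (-1 : K) ^ k • lowerCur g k v := rfl

omit [NeZero n] in
theorem creatOp_apply (k : ℕ) (v : Maya →₀ K) : creatOp g k v = (-1 : K) ^ k • raiseCur g k v := rfl

variable (R : Type*) [CommRing R] [Algebra K R]

/-- The operator `J_{k + 1}` over a `K`-algebra. -/
noncomputable def annih (k : ℕ) : Module.End R (Maya →₀ R) := extendHom R (annihOp g k)

/-- The operator `J_{-(k + 1)}` over a `K`-algebra. -/
noncomputable def creat (k : ℕ) : Module.End R (Maya →₀ R) := extendHom R (creatOp g k)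

variable (K) in
/-- The scalar `[J_k, J_{-k}] / k`, for the index `k + 1`. -/
def levelScalar (n : ℕ) (q : K) (k : ℕ) : R :=
  algebraMap K R (∑ t ∈ Finset.range n, ((q ^ 2) ^ t) ^ (k + 1))

variable {R}

theorem commute_annih (hq : q ≠ 0) (k l : ℕ) : Commute (annih g R k) (annih g R l) := by
  have : annihOp g k * annihOp g l = annihOp g l * annihOp g k := LinearMap.ext fun v => by
    simp only [Module.End.mul_apply, annihOp_apply, map_smul]
    rw [lowerCur_comm g hq, smul_comm]
  rw [annih, annih, Commute, SemiconjBy, ← map_mul, this, map_mul]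

theorem commute_creat (hq : q ≠ 0) (k l : ℕ) : Commute (creat g R k) (creat g R l) := by
  have : creatOp g k * creatOp g l = creatOp g l * creatOp g k := LinearMap.ext fun v => by
    simp only [Module.End.mul_apply, creatOp_apply, map_smul]
    rw [raiseCur_comm g hq, smul_comm]
  rw [creat, creat, Commute, SemiconjBy, ← map_mul, this, map_mul]

theorem annih_transpose (hq : q ≠ 0) (k : ℕ) : IsTranspose (annih g.dual R k) (creat g R k) := by
  have h := (lowerCur_transpose g.dual hq k).smul ((-1 : K) ^ k)
  rw [Twist.dual_dual] at h
  exact extendHom_transpose h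

/-- The graded pieces of `exp (∑ s_k J_{k + 1})`. -/
noncomputable def expAnnih (s : ℕ → R) (d : ℕ) : Module.End R (Maya →₀ R) :=
  expCoeff K (shiftSeries fun k => s k • annih g R k) d

/-- The graded pieces of `exp (∑ s_k J_{-(k + 1)})`. -/
noncomputable def expCreat (s : ℕ → R) (d : ℕ) : Module.End R (Maya →₀ R) :=
  expCoeff K (shiftSeries fun k => s k • creat g R k) d

variable [CharZero K]

theorem annih_mul_creat (hq : q ≠ 0) (k l : ℕ) : annih g R k * creat g R l =
    creat g R l * annih g R k +
      if k = l then ((k + 1 : ℕ) * levelScalar K R n q k : R) • 1 else 0 := by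
  have : annihOp g k * creatOp g l = creatOp g l * annihOp g k +
      if k = l then curScalar g k • 1 else 0 := LinearMap.ext fun v => by
    rw [LinearMap.add_apply]
    simp only [Module.End.mul_apply, annihOp_apply, creatOp_apply, map_smul]
    by_cases h : k = l
    · subst h
      rw [if_pos rfl, neg_one_pow_smul_smul, neg_one_pow_smul_smul, lowerCur_raiseCur_self g hq]
      rfl
    · rw [if_neg h, lowerCur_raiseCur_comm_of_ne g hq h, smul_comm, LinearMap.zero_apply, add_zero]
  rw [annih, creat, ← map_mul, this, map_add, map_mul]
  congr 1
  split_ifs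
  · rw [map_smul, map_one, curScalar_eq g hq, levelScalar, ← algebraMap_smul R]
    congr 1
    rw [map_mul]
    push_cast
    simp
  · rw [map_zero]

theorem expAnnih_succ (hq : q ≠ 0) (s : ℕ → R) (d : ℕ) :
    (d + 1) • expAnnih g s (d + 1) =
      ∑ i ∈ Finset.range (d + 1), (((i + 1 : ℕ) * s i) • annih g R i) * expAnnih g s (d - i) := by
  rw [expAnnih, expCoeff_succ K _ fun i k =>
    ((commute_annih g hq i k).smul_left _).smul_right _]
  refine Finset.sum_congr rfl fun i _ => ?_
  rw [← Nat.cast_smul_eq_nsmul R, smul_smul]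
  rfl

theorem expCreat_succ (hq : q ≠ 0) (s : ℕ → R) (d : ℕ) :
    (d + 1) • expCreat g s (d + 1) =
      ∑ i ∈ Finset.range (d + 1), (((i + 1 : ℕ) * s i) • creat g R i) * expCreat g s (d - i) := by
  rw [expCreat, expCoeff_succ K _ fun i k =>
    ((commute_creat g hq i k).smul_left _).smul_right _]
  refine Finset.sum_congr rfl fun i _ => ?_
  rw [← Nat.cast_smul_eq_nsmul R, smul_smul]
  rfl

/-- Induction along the Newton-type recursion of the graded pieces; reversing each product is
harmless because creation operators commute with one another. -/
theorem expAnnih_transpose (hq : q ≠ 0) (s : ℕ → R) (d : ℕ) :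
    IsTranspose (expAnnih g.dual s d) (expCreat g s d) := by
  induction d using Nat.strong_induction_on with
  | _ d ih =>
    rcases d with _ | d
    · rw [expAnnih, expCreat, expCoeff_zero, expCoeff_zero]
      exact isTranspose_one
    · have h : IsTranspose ((d + 1) • expAnnih g.dual s (d + 1)) ((d + 1) • expCreat g s (d + 1)) := by
        rw [expAnnih_succ g.dual hq, expCreat_succ g hq]
        refine isTranspose_sum _ fun i _ => ?_
        have hc : Commute (((i + 1 : ℕ) * s i) • creat g R i) (expCreat g s (d - i)) :=
          commute_expCoeff (K := K) (c := fun k => s k • creat g R k)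
            (fun k => ((commute_creat g hq i k).smul_left _).smul_right _) _
        rw [hc.eq]
        exact ((annih_transpose g hq i).smul _).mul (ih (d - i) (by omega))
      have h2 := h.smul (algebraMap K R ((d + 1 : ℕ) : K)⁻¹)
      have hd : ((d + 1 : ℕ) : K) ≠ 0 := Nat.cast_ne_zero.mpr (Nat.succ_ne_zero d)
      have h3 : ∀ P : Module.End R (Maya →₀ R),
          algebraMap K R ((d + 1 : ℕ) : K)⁻¹ • (d + 1) • P = P := fun P => by
        rw [algebraMap_smul, ← Nat.cast_smul_eq_nsmul K, smul_smul, inv_mul_cancel₀ hd, one_smul]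
      rwa [h3, h3] at h2

theorem expAnnih_mul_expCreat (hq : q ≠ 0) {a b ω : ℕ → R} (hω0 : ω 0 = 1)
    (hω : ∀ m, (m + 1 : ℕ) * ω (m + 1) = ∑ i ∈ Finset.range (m + 1),
      ((i + 1 : ℕ) * a i * (levelScalar K R n q i * ((i + 1 : ℕ) * b i))) * ω (m - i)) (d e : ℕ) :
    expAnnih g a d * expCreat g b e = ∑ j ∈ Finset.range (min d e + 1),
      ω j • (expCreat g b (e - j) * expAnnih g a (d - j)) :=
  exp_exchange K (expCoeff_zero K) (expCoeff_zero K) (expAnnih_succ g hq a) (expCreat_succ g hq b)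
    (annih_mul_creat g hq) hω0 hω d e

end Operators

/-! ### Energy filtration: local finiteness of the exponentials. -/

section Filtration

open PowerSeries

variable {K : Type*} [Field K] {n : ℕ} {q : K} (g : Twist n q) {R : Type*} [CommRing R]
  [Algebra K R]

variable (R) in
/-- The vectors of energy less than `2 n D`. -/
def lowEnergy (n : ℕ) (D : ℤ) : Submodule R (Maya →₀ R) :=
  Finsupp.supported R R {A | energy 0 A < 2 * n * D}

theorem eq_zero_of_mem_lowEnergy {D : ℤ} (hD : D ≤ 0) {v : Maya →₀ R}
    (hv : v ∈ lowEnergy R n D) : v = 0 := by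
  refine Finsupp.support_eq_empty.mp (Finset.eq_empty_of_forall_notMem fun A hA => ?_)
  have h : energy 0 A < 2 * n * D := (Finsupp.mem_supported R v).mp hv hA
  have h1 := energy_nonneg 0 A
  have h2 : 2 * (n : ℤ) * D ≤ 0 := mul_nonpos_of_nonneg_of_nonpos (by positivity) hD
  omega

theorem lowEnergy_mono {D D' : ℤ} (h : D ≤ D') : lowEnergy R n D ≤ lowEnergy R n D' :=
  Finsupp.supported_mono fun A hA => by
    rw [Set.mem_ofPred_eq] at hA ⊢
    have : 2 * (n : ℤ) * D ≤ 2 * n * D' := mul_le_mul_of_nonneg_left h (by positivity)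
    omega

theorem exists_mem_lowEnergy [NeZero n] (v : Maya →₀ R) : ∃ D : ℕ, v ∈ lowEnergy R n D := by
  have hn := NeZero.pos n
  obtain ⟨b, hb⟩ := (v.support.image (energy 0)).exists_le
  refine ⟨b.toNat + 1, (Finsupp.mem_supported R v).mpr fun A hA => ?_⟩
  have h := hb _ (Finset.mem_image_of_mem _ hA)
  rw [Set.mem_ofPred_eq]
  push_cast
  have h1 := Int.self_le_toNat b
  nlinarith

variable (K) in
/-- The operators which lower the energy filtration by `d` steps. -/
def lowering (n : ℕ) (d : ℕ) : Submodule K (Module.End R (Maya →₀ R)) where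
  carrier := {P | ∀ D, ∀ v ∈ lowEnergy R n D, P v ∈ lowEnergy R n (D - d)}
  zero_mem' _ _ _ := Submodule.zero_mem _
  add_mem' hP hQ D v hv := Submodule.add_mem _ (hP D v hv) (hQ D v hv)
  smul_mem' a P hP D v hv := by
    rw [← algebraMap_smul R a]
    exact Submodule.smul_mem _ _ (hP D v hv)

theorem one_mem_lowering : (1 : Module.End R (Maya →₀ R)) ∈ lowering K n 0 := fun D v hv => by
  simpa using hv

theorem mul_mem_lowering (i j : ℕ) (P Q : Module.End R (Maya →₀ R)) (hP : P ∈ lowering K n i)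
    (hQ : Q ∈ lowering K n j) : P * Q ∈ lowering K n (i + j) := fun D v hv => by
  have := hP _ _ (hQ D v hv)
  rw [sub_sub] at this
  push_cast
  rwa [_root_.add_comm (i : ℤ)]

variable (s : ℕ → R)

theorem smul_annih_mem_lowering (k : ℕ) : s k • annih g R k ∈ lowering K n (k + 1) :=
  fun D v hv => by
    rw [LinearMap.smul_apply]
    refine Submodule.smul_mem _ _ (extendHom_mem_supported (fun A hA => ?_) hv)
    rw [annihOp_apply]
    refine Submodule.smul_mem _ _ (Finsupp.supported_mono (fun B hB => ?_)
      (lowerCur_energy g k (single_mem_energySub 0 A 1)))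
    rw [Set.mem_ofPred_eq] at hA hB ⊢
    rw [hB]
    push_cast
    linarith

theorem coeff_pow_mem_lowering (j d : ℕ) :
    coeff d (shiftSeries (fun k => s k • annih g R k) ^ j) ∈ lowering K n d :=
  coeff_shiftSeries_pow_mem (F := lowering (R := R) K n) (c := fun k => s k • annih g R k)
    one_mem_lowering mul_mem_lowering (smul_annih_mem_lowering g s) j d

theorem expAnnih_mem_lowering (d : ℕ) : expAnnih g s d ∈ lowering K n d :=
  expCoeff_mem (F := lowering (R := R) K n) (c := fun k => s k • annih g R k)
    one_mem_lowering mul_mem_lowering (smul_annih_mem_lowering g s) d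

/-- On vectors of bounded energy, products of total index at least D vanish, so truncating each
factor separately gives the truncated product. -/
theorem sum_range_coeff_mul {D : ℕ} {f h : PowerSeries (Module.End R (Maya →₀ R))}
    (hf : ∀ i, coeff i f ∈ lowering K n i) (hh : ∀ i, coeff i h ∈ lowering K n i) {v : Maya →₀ R}
    (hv : v ∈ lowEnergy R n D) :
    ∑ d ∈ Finset.range D, coeff d (f * h) v =
      ∑ i ∈ Finset.range D, coeff i f (∑ j ∈ Finset.range D, coeff j h v) := by
  have h0 : ∀ i j, D ≤ i + j → coeff i f (coeff j h v) = 0 := fun i j hij =>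
    eq_zero_of_mem_lowEnergy (n := n) (D := D - (i + j : ℕ)) (by omega)
      (mul_mem_lowering i j _ _ (hf i) (hh j) D v hv)
  have h1 : ∀ d ∈ Finset.range D, coeff d (f * h) v = ∑ i ∈ Finset.range D, ∑ j ∈ Finset.range D,
      if i + j = d then coeff i f (coeff j h v) else 0 := fun d hd => by
    rw [Finset.mem_range] at hd
    rw [coeff_mul, LinearMap.sum_apply, ← Finset.sum_product', ← Finset.sum_filter]
    refine Finset.sum_congr (Finset.ext fun p => ?_) fun _ _ => rfl
    rw [Finset.HasAntidiagonal.mem_antidiagonal, Finset.mem_filter, Finset.mem_product,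
      Finset.mem_range, Finset.mem_range]
    omega
  rw [Finset.sum_congr rfl h1, Finset.sum_comm]
  refine Finset.sum_congr rfl fun i _ => ?_
  rw [Finset.sum_comm, map_sum]
  refine Finset.sum_congr rfl fun j _ => ?_
  rw [Finset.sum_ite_eq]
  split_ifs with h
  · rfl
  · rw [h0 i j (not_lt.mp fun h' => h (Finset.mem_range.mpr h'))]

end Filtration

/-! ### The exponentials in the definition of `superLLT` as finite sums of graded pieces. -/

section ExpHamiltonian

open PowerSeries

variable {K : Type*} [Field K] [CharZero K] {n : ℕ} {q : K} [NeZero n] (g : Twist n q)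
  {R : Type*} [CommRing R] [Algebra K R]

theorem mapDomain_hamiltonian (hq : q ≠ 0) (s : ℕ+ → R) {D : ℕ} {v : NormOrd →₀ R}
    (hv : v.mapDomain NormOrd.maya ∈ lowEnergy R n D) :
    (hamiltonian g s v).mapDomain NormOrd.maya =
      ∑ k ∈ Finset.range D, (s k.succPNat • annih g R k) (v.mapDomain NormOrd.maya) := by
  have hterm : ∀ k : ℕ, (s k.succPNat • current R g (k.succPNat : ℤ) v).mapDomain NormOrd.maya =
      (s k.succPNat • annih g R k) (v.mapDomain NormOrd.maya) := fun k => by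
    rw [Finsupp.mapDomain_smul, LinearMap.smul_apply]
    congr 1
    have h := mapDomain_current g hq k v
    have e : (k.succPNat : ℤ) = k + 1 := by simp
    rw [e]
    exact h
  rw [hamiltonian, ← finsum_comp_equiv Equiv.pnatEquivNat.symm,
    finsum_eq_sum_of_support_subset (s := Finset.range D), Finsupp.mapDomain_finsetSum]
  · exact Finset.sum_congr rfl fun k _ => hterm k
  · intro k hk
    rw [Finset.coe_range, Set.mem_Iio]
    by_contra hkD
    refine hk (Finsupp.mapDomain_injective NormOrd.maya_injective ?_)
    rw [Finsupp.mapDomain_zero]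
    refine (hterm k).trans ?_
    exact eq_zero_of_mem_lowEnergy (n := n) (D := D - (k + 1 : ℕ)) (by omega)
      (smul_annih_mem_lowering g (fun k => s k.succPNat) k D _ hv)

theorem mapDomain_hamiltonian_iterate (hq : q ≠ 0) (s : ℕ+ → R) {D : ℕ} {v : NormOrd →₀ R}
    (hv : v.mapDomain NormOrd.maya ∈ lowEnergy R n (D + 1 : ℕ)) (j : ℕ) :
    ((hamiltonian g s)^[j] v).mapDomain NormOrd.maya = ∑ d ∈ Finset.range (D + 1),
      coeff d (shiftSeries (fun k => s k.succPNat • annih g R k) ^ j)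
        (v.mapDomain NormOrd.maya) := by
  set h := shiftSeries fun k => s k.succPNat • annih g R k with hh
  have hmem := coeff_pow_mem_lowering (K := K) g fun k => s k.succPNat
  induction j with
  | zero =>
    rw [Finset.sum_eq_single 0]
    · simp
    · intro d _ hd
      rw [pow_zero, coeff_one, if_neg hd, LinearMap.zero_apply]
    · simp
  | succ j ih =>
    have hlow : ((hamiltonian g s)^[j] v).mapDomain NormOrd.maya ∈ lowEnergy R n (D + 1 : ℕ) := by
      rw [ih]
      refine Submodule.sum_mem _ fun d _ => lowEnergy_mono ?_ (hmem j d _ _ hv)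
      omega
    have h1 : ∀ i, coeff i h ∈ lowering K n i := fun i => by
      have := hmem 1 i
      rwa [pow_one] at this
    rw [Function.iterate_succ_apply', mapDomain_hamiltonian g hq s hlow, pow_succ',
      sum_range_coeff_mul h1 (hmem j) hv, ih, Finset.sum_range_succ _ D,
      Finset.sum_range_succ' (fun i => coeff i h _) D]
    have e : (s D.succPNat • annih g R D) (∑ d ∈ Finset.range (D + 1),
        coeff d (h ^ j) (v.mapDomain NormOrd.maya)) = 0 := by
      rw [← ih]
      exact eq_zero_of_mem_lowEnergy (n := n) (D := (D + 1 : ℕ) - (D + 1 : ℕ)) (by omega)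
        (smul_annih_mem_lowering g (fun k => s k.succPNat) D _ _ hlow)
    have e0 : ∀ w, coeff 0 h w = 0 := fun w => DFunLike.congr_fun (coeff_zero_shiftSeries _) w
    have e1 : ∀ i w, coeff (i + 1) h w = (s i.succPNat • annih g R i) w := fun i w =>
      DFunLike.congr_fun (coeff_succ_shiftSeries _ i) w
    rw [e, e0]
    congr 1
    exact Finset.sum_congr rfl fun i _ => (e1 i _).symm

theorem mapDomain_expHamiltonian (hq : q ≠ 0) (s : ℕ+ → R) {D : ℕ} {v : NormOrd →₀ R}
    (hv : v.mapDomain NormOrd.maya ∈ lowEnergy R n (D + 1 : ℕ)) :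
    (expHamiltonian g s v).mapDomain NormOrd.maya = ∑ d ∈ Finset.range (D + 1),
      expAnnih g (fun k => s k.succPNat) d (v.mapDomain NormOrd.maya) := by
  have hit := mapDomain_hamiltonian_iterate g hq s hv
  rw [expHamiltonian, finsum_eq_sum_of_support_subset (s := Finset.range (D + 1)),
    Finsupp.mapDomain_finsetSum]
  · have hd : ∀ d ∈ Finset.range (D + 1), expAnnih g (fun k => s k.succPNat) d
        (v.mapDomain NormOrd.maya) = ∑ j ∈ Finset.range (D + 1), algebraMap K R (j.factorial : K)⁻¹ •
          coeff d (shiftSeries (fun k => s k.succPNat • annih g R k) ^ j)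
            (v.mapDomain NormOrd.maya) := fun d hd => by
      rw [Finset.mem_range] at hd
      rw [expAnnih, expCoeff_eq K (coeff_zero_shiftSeries _) (Nat.le_of_lt_succ hd),
        LinearMap.sum_apply]
      exact Finset.sum_congr rfl fun j _ => by rw [LinearMap.smul_apply, algebraMap_smul]
    rw [Finset.sum_congr rfl hd, Finset.sum_comm]
    refine Finset.sum_congr rfl fun j _ => ?_
    rw [Finsupp.mapDomain_smul, hit, Finset.smul_sum]
  · intro j hj
    rw [Finset.coe_range, Set.mem_Iio]
    by_contra hjD
    refine hj ?_
    have : (hamiltonian g s)^[j] v = 0 := by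
      refine Finsupp.mapDomain_injective NormOrd.maya_injective ?_
      rw [hit, Finsupp.mapDomain_zero]
      refine Finset.sum_eq_zero fun d hd => ?_
      rw [Finset.mem_range] at hd
      exact DFunLike.congr_fun (coeff_pow_eq_zero (coeff_zero_shiftSeries _) (by omega)) _
    show algebraMap K R (j.factorial : K)⁻¹ • (hamiltonian g s)^[j] v = 0
    rw [this, smul_zero]

/-- The coefficients of the power sums `∑ x_j ^ n - ∑ y_j ^ n` in `L₊(xⁿ) - L₊(yⁿ)`. -/
noncomputable def powerSumCoeff (K : Type*) [Field K] {R : Type*} [CommRing R] [Algebra K R] (n : ℕ)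
    {N : ℕ} (x y : Fin N → R) (k : ℕ) : R :=
  algebraMap K R ((k + 1 : ℕ) : K)⁻¹ *
    (∑ j, (x j ^ n) ^ (k + 1) - ∑ j, (y j ^ n) ^ (k + 1))

/-- The graded pieces of `superLLT`. -/
noncomputable def superLLTPart (g : Twist n q) (c : ℤ) (lam mu : YoungDiagram) {N : ℕ}
    (x y : Fin N → R) (d : ℕ) : R :=
  expAnnih g (powerSumCoeff K n x y) d (Finsupp.single (ket c lam).maya 1) (ket c mu).maya

/-- The number of pieces needed depends on the energy of λ only, not on μ. -/
theorem superLLT_eq_sum (hq : q ≠ 0) (c : ℤ) (lam : YoungDiagram) {N : ℕ} (x y : Fin N → R) :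
    ∃ D, (∀ d, D ≤ d → expAnnih g (powerSumCoeff K n x y) d
      (Finsupp.single (ket c lam).maya 1) = 0) ∧ ∀ mu, superLLT g c lam mu x y =
        ∑ d ∈ Finset.range D, superLLTPart g c lam mu x y d := by
  obtain ⟨D, hD⟩ := exists_mem_lowEnergy (n := n) (Finsupp.single (ket c lam).maya (1 : R))
  refine ⟨D + 1, fun d hd => eq_zero_of_mem_lowEnergy (n := n) (D := D - d) (by omega)
    (expAnnih_mem_lowering g _ d _ _ hD), fun mu => ?_⟩
  have h := mapDomain_expHamiltonian g hq (R := R) (fun k : ℕ+ => algebraMap K R ((k : K)⁻¹) *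
    (∑ j, (x j ^ n) ^ (k : ℕ) - ∑ j, (y j ^ n) ^ (k : ℕ))) (D := D)
    (v := Finsupp.single (ket c lam) 1) (by
      rw [Finsupp.mapDomain_single]
      exact lowEnergy_mono (by omega) hD)
  rw [superLLT, ← Finsupp.mapDomain_apply NormOrd.maya_injective, h, Finsupp.finsetSum_apply,
    Finsupp.mapDomain_single]
  rfl

end ExpHamiltonian

/-! ### Homogeneous power series and operators. -/

section Homogeneous

variable {σ Γ K : Type*} [AddCommMonoid Γ] [Field K] (w : σ → Γ)

/-- The power series all of whose monomials have degree `γ`, where the variable `i` has degree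
`w i`. -/
def homSub (K : Type*) [Field K] (γ : Γ) : Submodule K (MvPowerSeries σ K) where
  carrier := {f | ∀ m, MvPowerSeries.coeff m f ≠ 0 → Finsupp.linearCombination ℕ w m = γ}
  zero_mem' m hm := by simp at hm
  add_mem' {f g} hf hg m hm := by
    by_cases h : MvPowerSeries.coeff m f = 0
    · refine hg m fun h' => hm ?_
      rw [map_add, h, h', add_zero]
    · exact hf m h
  smul_mem' c f hf m hm := hf m fun h => hm (by rw [map_smul, h, smul_zero])

variable {w}

theorem one_mem_homSub : (1 : MvPowerSeries σ K) ∈ homSub w K 0 := fun m hm => by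
  classical
  rw [MvPowerSeries.coeff_one] at hm
  rw [(ite_ne_right_iff.mp hm).1, map_zero]

theorem mul_mem_homSub {γ δ : Γ} {f g : MvPowerSeries σ K} (hf : f ∈ homSub w K γ)
    (hg : g ∈ homSub w K δ) : f * g ∈ homSub w K (γ + δ) := fun m hm => by
  classical
  rw [MvPowerSeries.coeff_mul] at hm
  obtain ⟨p, hp, h⟩ := Finset.exists_ne_zero_of_sum_ne_zero hm
  rw [← Finset.HasAntidiagonal.mem_antidiagonal.mp hp, map_add, hf _ (left_ne_zero_of_mul h),
    hg _ (right_ne_zero_of_mul h)]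

theorem pow_mem_homSub {γ : Γ} {f : MvPowerSeries σ K} (hf : f ∈ homSub w K γ) (k : ℕ) :
    f ^ k ∈ homSub w K (k • γ) := by
  induction k with
  | zero => rw [pow_zero, zero_smul]; exact one_mem_homSub
  | succ k ih => rw [pow_succ, succ_nsmul]; exact mul_mem_homSub ih hf

theorem X_mem_homSub (i : σ) : (MvPowerSeries.X i : MvPowerSeries σ K) ∈ homSub w K (w i) :=
  fun m hm => by
    classical
    rw [MvPowerSeries.coeff_X] at hm
    rw [(ite_ne_right_iff.mp hm).1, Finsupp.linearCombination_single, one_smul]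

theorem algebraMap_mem_homSub (a : K) : algebraMap K (MvPowerSeries σ K) a ∈ homSub w K 0 := by
  rw [Algebra.algebraMap_eq_smul_one]
  exact Submodule.smul_mem _ _ one_mem_homSub

/-- The operators which raise the degrees of all coefficients by `δ`. -/
def homOp {ι : Type*} (w : σ → Γ) (K : Type*) [Field K] (δ : Γ) :
    Submodule K (Module.End (MvPowerSeries σ K) (ι →₀ MvPowerSeries σ K)) where
  carrier := {P | ∀ γ v, (∀ A, v A ∈ homSub w K γ) → ∀ A, P v A ∈ homSub w K (δ + γ)}
  zero_mem' _ _ _ _ := Submodule.zero_mem _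
  add_mem' hP hQ γ v hv A := Submodule.add_mem _ (hP γ v hv A) (hQ γ v hv A)
  smul_mem' a _ hP γ v hv A := Submodule.smul_mem _ a (hP γ v hv A)

theorem extendHom_mem_homOp {ι : Type*} (P : Module.End K (ι →₀ K)) :
    extendHom (MvPowerSeries σ K) P ∈ homOp w K 0 := fun γ v hv A => by
  rw [zero_add, ← Finsupp.sum_single v, Finsupp.sum, map_sum, Finsupp.finsetSum_apply]
  refine Submodule.sum_mem _ fun B _ => ?_
  rw [extendHom_single_apply]
  have := mul_mem_homSub (hv B) (algebraMap_mem_homSub (w := w) (P (Finsupp.single B 1) A))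
  rwa [add_zero] at this

theorem smul_mem_homOp {ι : Type*} {γ δ : Γ} {f : MvPowerSeries σ K} (hf : f ∈ homSub w K γ)
    {P : Module.End (MvPowerSeries σ K) (ι →₀ MvPowerSeries σ K)} (hP : P ∈ homOp w K δ) :
    f • P ∈ homOp w K (γ + δ) := fun ε v hv A => by
  rw [add_assoc]
  exact mul_mem_homSub hf (hP ε v hv A)

theorem one_mem_homOp {ι : Type*} :
    (1 : Module.End (MvPowerSeries σ K) (ι →₀ MvPowerSeries σ K)) ∈ homOp w K 0 :=
  fun γ v hv A => by rw [zero_add]; exact hv A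

theorem mul_mem_homOp {ι : Type*} {γ δ : Γ}
    {P Q : Module.End (MvPowerSeries σ K) (ι →₀ MvPowerSeries σ K)} (hP : P ∈ homOp w K γ)
    (hQ : Q ∈ homOp w K δ) : P * Q ∈ homOp w K (γ + δ) := fun ε v hv A => by
  rw [add_assoc]
  exact hP _ _ (hQ ε v hv) A

theorem expAnnih_mem_homOp {n : ℕ} {q : K} (g : Twist n q) {s : ℕ → MvPowerSeries σ K} {η : Γ}
    (hs : ∀ k, s k ∈ homSub w K ((k + 1) • η)) (d : ℕ) : expAnnih g s d ∈ homOp w K (d • η) := by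
  refine expCoeff_mem (F := fun d => homOp w K (d • η))
    (c := fun k => s k • annih g (MvPowerSeries σ K) k) ?_ (fun i j P Q hP hQ => ?_) (fun i => ?_) d
  · rw [zero_smul]
    exact one_mem_homOp
  · rw [add_smul]
    exact mul_mem_homOp hP hQ
  · have := smul_mem_homOp (hs i) (extendHom_mem_homOp (w := w) (annihOp g i))
    rwa [add_zero] at this

theorem powerSumCoeff_mem_homSub {n N : ℕ} {x y : Fin N → MvPowerSeries σ K} {η : Γ}
    (hx : ∀ j, x j ∈ homSub w K η) (hy : ∀ j, y j ∈ homSub w K η) (k : ℕ) :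
    powerSumCoeff K n x y k ∈ homSub w K ((k + 1) • n • η) := by
  have h : ∀ {u : Fin N → MvPowerSeries σ K}, (∀ j, u j ∈ homSub w K η) →
      ∑ j, (u j ^ n) ^ (k + 1) ∈ homSub w K ((k + 1) • n • η) := fun hu =>
    Submodule.sum_mem _ fun j _ => pow_mem_homSub (pow_mem_homSub (hu j) n) (k + 1)
  have := mul_mem_homSub (algebraMap_mem_homSub ((k + 1 : ℕ) : K)⁻¹)
    (Submodule.sub_mem _ (h hx) (h hy))
  rwa [zero_add] at this

end Homogeneous

/-! ### Summability by degree. -/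

section Summability

variable {σ Γ K : Type*} [AddCommMonoid Γ] [Field K] [TopologicalSpace K] [DiscreteTopology K]
  {w : σ → Γ}

/-- Regularity is what allows a summable family to be summed in iterated form. -/
instance : T3Space (MvPowerSeries σ K) := inferInstanceAs (T3Space ((σ →₀ ℕ) → K))

-- A monomial has one degree, and φ is injective, so it meets a single k and hence finitely many
-- terms.
omit [DiscreteTopology K] in
theorem summable_of_mem_homSub {ι κ : Type*} {F : ι × κ → MvPowerSeries σ K} {φ : κ → Γ}
    (hφ : Function.Injective φ) (hF : ∀ i k, F (i, k) ∈ homSub w K (φ k))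
    (hfin : ∀ k, {i | F (i, k) ≠ 0}.Finite) : Summable F := by
  rw [MvPowerSeries.WithPiTopology.summable_iff_summable_coeff]
  intro m
  refine summable_of_hasFiniteSupport ?_
  by_cases hk : ∃ k, φ k = Finsupp.linearCombination ℕ w m
  · obtain ⟨k, hk⟩ := hk
    refine ((hfin k).prod (Set.finite_singleton k)).subset ?_
    rintro ⟨i, k'⟩ h
    have h1 : k' = k := hφ ((hF i k' m h).symm.trans hk.symm)
    subst h1
    refine ⟨fun h0 => h ?_, rfl⟩
    show MvPowerSeries.coeff m (F (i, k')) = 0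
    rw [show F (i, k') = 0 from h0, map_zero]
  · refine Set.finite_empty.subset ?_
    rintro ⟨i, k⟩ h
    exact hk ⟨k, (hF i k m h).symm⟩

/-- Two iterated sums of a summable family have the same value. -/
theorem exists_hasSum_fiberwise {ι κ : Type*} {F : ι × κ → MvPowerSeries σ K} (hF : Summable F)
    {a : ι → MvPowerSeries σ K} {b : κ → MvPowerSeries σ K}
    (ha : ∀ i, HasSum (fun k => F (i, k)) (a i)) (hb : ∀ k, HasSum (fun i => F (i, k)) (b k)) :
    ∃ s, HasSum a s ∧ HasSum b s := by
  obtain ⟨s, hs⟩ := hF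
  exact ⟨s, hs.prod_fiberwise ha,
    ((Equiv.prodComm κ ι).hasSum_iff.mpr hs).prod_fiberwise hb⟩

/-- The product of two sums, regrouped by degree. -/
theorem hasSum_mul_fiberwise {ι κ κ' : Type*} {A : ι → MvPowerSeries σ K}
    {B : κ → MvPowerSeries σ K} {a b : MvPowerSeries σ K} (hA : HasSum A a) (hB : HasSum B b)
    {φ : κ' → Γ} (hφ : Function.Injective φ) {θ : ι × κ → κ'} {T : κ' → Finset (ι × κ)}
    (hT : ∀ k p, p ∈ T k ↔ θ p = k) (h : ∀ p : ι × κ, A p.1 * B p.2 ∈ homSub w K (φ (θ p))) :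
    HasSum (fun k => ∑ p ∈ T k, A p.1 * B p.2) (a * b) := by
  have hs : Summable fun p : ι × κ => A p.1 * B p.2 := by
    rw [MvPowerSeries.WithPiTopology.summable_iff_summable_coeff]
    intro m
    refine summable_of_hasFiniteSupport ?_
    by_cases hk : ∃ k, φ k = Finsupp.linearCombination ℕ w m
    · obtain ⟨k, hk⟩ := hk
      refine (T k).finite_toSet.subset fun p hp => ?_
      exact (hT k p).mpr (hφ ((h p m hp).symm.trans hk.symm))
    · refine Set.finite_empty.subset fun p hp => ?_
      exact hk ⟨_, (h p m hp).symm⟩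
  have h1 := hA.mul hB hs
  rw [← (Equiv.sigmaFiberEquiv θ).hasSum_iff] at h1
  refine h1.sigma fun k => ?_
  have h2 := (T k).hasSum fun p => A p.1 * B p.2
  exact ((Equiv.subtypeEquivRight fun p => (hT k p)).symm.hasSum_iff (a := ∑ p ∈ T k, A p.1 * B p.2)
    (f := fun p : {p // p ∈ T k} => A p.1.1 * B p.1.2)).mpr h2

end Summability

/-! ### Evaluating graded power series at 1. -/

section Evaluation

open PowerSeries

variable {σ Γ K : Type*} [AddCommMonoid Γ] [Field K] [TopologicalSpace K] [DiscreteTopology K]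
  {w : σ → Γ} {η : Γ}

/-- The power series `F` has coefficients of degrees `0, η, 2 η, …`, whose sum is `f`. -/
def IsEval (w : σ → Γ) (η : Γ) (F : PowerSeries (MvPowerSeries σ K)) (f : MvPowerSeries σ K) :
    Prop :=
  (∀ j, coeff j F ∈ homSub w K (j • η)) ∧ HasSum (fun j => coeff j F) f

omit [DiscreteTopology K] in
theorem isEval_one : IsEval w η (1 : PowerSeries (MvPowerSeries σ K)) 1 := by
  have h : ∀ j ≠ 0, coeff j (1 : PowerSeries (MvPowerSeries σ K)) = 0 := fun j hj => by
    rw [coeff_one, if_neg hj]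
  refine ⟨fun j => ?_, ?_⟩
  · by_cases hj : j = 0
    · subst hj
      rw [coeff_zero_one, zero_smul]
      exact one_mem_homSub
    · rw [h j hj]
      exact Submodule.zero_mem _
  · have := hasSum_single 0 h
    rwa [coeff_zero_one] at this

theorem isEval_one_sub {a : MvPowerSeries σ K} (ha : a ∈ homSub w K η) :
    IsEval w η (1 - C a * X) (1 - a) := by
  have h : ∀ j, coeff j (C a * X : PowerSeries (MvPowerSeries σ K)) = if j = 1 then a else 0 :=
    fun j => by rw [coeff_C_mul, coeff_X, mul_ite, mul_one, mul_zero]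
  refine ⟨fun j => ?_, ?_⟩
  · rw [map_sub]
    refine Submodule.sub_mem _ (isEval_one.1 j) ?_
    rw [h]
    split_ifs with hj
    · rwa [hj, one_smul]
    · exact Submodule.zero_mem _
  · have h1 : HasSum (fun j => coeff j (1 : PowerSeries (MvPowerSeries σ K))) 1 :=
      (isEval_one (w := w) (η := η)).2
    have h2 : HasSum (fun j => coeff j (C a * X : PowerSeries (MvPowerSeries σ K))) a :=
      (funext h) ▸ hasSum_ite_eq 1 a
    have h3 := h1.sub h2
    simp only [← map_sub] at h3
    exact h3

/-- Vanishing of the constant coefficient makes the geometric series converge to the inverse. -/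
theorem isEval_geomSeries {a : MvPowerSeries σ K} (ha : a ∈ homSub w K η)
    (h0 : MvPowerSeries.constantCoeff a = 0) : IsEval w η (geomSeries a) (1 - a)⁻¹ := by
  have hs := MvPowerSeries.WithPiTopology.summable_pow_of_constantCoeff_eq_zero h0
  have h1 := MvPowerSeries.WithPiTopology.tsum_pow_mul_one_sub_of_constantCoeff_eq_zero h0
  have h2 : (1 - a)⁻¹ = ∑' j, a ^ j :=
    (MvPowerSeries.inv_eq_iff_mul_eq_one (by simp [h0])).mpr h1
  refine ⟨fun j => ?_, ?_⟩
  · rw [geomSeries, coeff_mk]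
    exact pow_mem_homSub ha j
  · simp only [geomSeries, coeff_mk]
    rw [h2]
    exact hs.hasSum

theorem IsEval.mul (hη : Function.Injective fun j : ℕ => j • η)
    {F G : PowerSeries (MvPowerSeries σ K)} {f g : MvPowerSeries σ K} (hF : IsEval w η F f)
    (hG : IsEval w η G g) : IsEval w η (F * G) (f * g) := by
  refine ⟨fun j => ?_, ?_⟩
  · rw [coeff_mul]
    refine Submodule.sum_mem _ fun p hp => ?_
    rw [← Finset.HasAntidiagonal.mem_antidiagonal.mp hp, add_smul]
    exact mul_mem_homSub (hF.1 _) (hG.1 _)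
  · have h := hasSum_mul_fiberwise hF.2 hG.2 hη (θ := fun p => p.1 + p.2)
      (T := Finset.HasAntidiagonal.antidiagonal) (fun k p => Finset.HasAntidiagonal.mem_antidiagonal) fun p => by
        have := mul_mem_homSub (hF.1 p.1) (hG.1 p.2)
        rwa [← add_smul] at this
    exact (funext fun k => coeff_mul k F G) ▸ h

theorem IsEval.prod (hη : Function.Injective fun j : ℕ => j • η) {ι : Type*} (s : Finset ι)
    {F : ι → PowerSeries (MvPowerSeries σ K)} {f : ι → MvPowerSeries σ K}
    (h : ∀ i ∈ s, IsEval w η (F i) (f i)) : IsEval w η (∏ i ∈ s, F i) (∏ i ∈ s, f i) := by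
  classical
  induction s using Finset.induction_on with
  | empty => exact isEval_one
  | insert i s hi ih =>
    rw [Finset.prod_insert hi, Finset.prod_insert hi]
    exact (h i (Finset.mem_insert_self _ _)).mul hη
      (ih fun j hj => h j (Finset.mem_insert_of_mem hj))

end Evaluation

/-! ### Ω as a series graded by degree. -/

section OmegaSeries

open PowerSeries

variable {σ K : Type*} [Field K]

/-- The power series whose value at `1` is `Omega`. -/
noncomputable def omegaSeries (n : ℕ) (q : K) {N M : ℕ} (x y : Fin N → MvPowerSeries σ K)
    (z w : Fin M → MvPowerSeries σ K) : PowerSeries (MvPowerSeries σ K) :=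
  ∏ t ∈ Finset.range n, ∏ i : Fin N, ∏ j : Fin M,
    ((1 - C ((q ^ 2) ^ t • (x i ^ n * w j ^ n)) * X) *
      (1 - C ((q ^ 2) ^ t • (y i ^ n * z j ^ n)) * X)) *
      (geomSeries ((q ^ 2) ^ t • (x i ^ n * z j ^ n)) *
        geomSeries ((q ^ 2) ^ t • (y i ^ n * w j ^ n)))

variable (n : ℕ) (q : K) {N M : ℕ} (x y : Fin N → MvPowerSeries σ K)
  (z w : Fin M → MvPowerSeries σ K)

theorem coeff_zero_omegaSeries : coeff 0 (omegaSeries n q x y z w) = 1 := by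
  have hg : ∀ a : MvPowerSeries σ K, constantCoeff (geomSeries a) = 1 := fun a => by
    rw [← coeff_zero_eq_constantCoeff_apply, geomSeries, coeff_mk, pow_zero]
  rw [coeff_zero_eq_constantCoeff_apply, omegaSeries]
  simp [map_prod, hg]

theorem natCast_mul_powerSumCoeff [CharZero K] (k : ℕ) :
    ((k + 1 : ℕ) : MvPowerSeries σ K) * powerSumCoeff K n x y k =
      ∑ j, (x j ^ n) ^ (k + 1) - ∑ j, (y j ^ n) ^ (k + 1) := by
  have h : ((k + 1 : ℕ) : K) ≠ 0 := Nat.cast_ne_zero.mpr (Nat.succ_ne_zero k)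
  rw [powerSumCoeff, ← mul_assoc, ← map_natCast (algebraMap K (MvPowerSeries σ K)), ← map_mul,
    mul_inv_cancel₀ h, map_one, one_mul]

/-- The logarithmic derivative of Ω is a sum of geometric series whose coefficients factor into
power sums in x, y, power sums in z, w, and ∑ v^{t(k+1)}: the recursion that `exp_exchange` asks of
ω. -/
theorem coeff_succ_omegaSeries [CharZero K] (m : ℕ) :
    (m + 1 : ℕ) * coeff (m + 1) (omegaSeries n q x y z w) = ∑ k ∈ Finset.range (m + 1),
      ((k + 1 : ℕ) * powerSumCoeff K n x y k * (levelScalar K (MvPowerSeries σ K) n q k *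
        ((k + 1 : ℕ) * powerSumCoeff K n z w k))) *
        coeff (m - k) (omegaSeries n q x y z w) := by
  have hlog : IsLogDeriv (omegaSeries n q x y z w) (∑ t ∈ Finset.range n, ∑ i : Fin N, ∑ j : Fin M,
      ((-(C ((q ^ 2) ^ t • (x i ^ n * w j ^ n)) * geomSeries ((q ^ 2) ^ t • (x i ^ n * w j ^ n))) +
        -(C ((q ^ 2) ^ t • (y i ^ n * z j ^ n)) * geomSeries ((q ^ 2) ^ t • (y i ^ n * z j ^ n)))) +
      (C ((q ^ 2) ^ t • (x i ^ n * z j ^ n)) * geomSeries ((q ^ 2) ^ t • (x i ^ n * z j ^ n)) +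
        C ((q ^ 2) ^ t • (y i ^ n * w j ^ n)) * geomSeries ((q ^ 2) ^ t • (y i ^ n * w j ^ n))))) :=
    IsLogDeriv.prod _ fun t _ => IsLogDeriv.prod _ fun i _ => IsLogDeriv.prod _ fun j _ =>
      ((isLogDeriv_one_sub _).mul (isLogDeriv_one_sub _)).mul
        ((isLogDeriv_geomSeries _).mul (isLogDeriv_geomSeries _))
  have h := hlog.coeff_succ m
  push_cast at h ⊢
  rw [h]
  refine Finset.sum_congr rfl fun k _ => ?_
  congr 1
  have e1 := natCast_mul_powerSumCoeff n x y k
  have e2 := natCast_mul_powerSumCoeff n z w k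
  push_cast at e1 e2
  rw [e1, e2, levelScalar, map_sum, map_sum, Finset.sum_mul, Finset.mul_sum]
  refine Finset.sum_congr rfl fun t _ => ?_
  have hp : ∀ a b : MvPowerSeries σ K, coeff k (C ((q ^ 2) ^ t • (a ^ n * b ^ n)) *
      geomSeries ((q ^ 2) ^ t • (a ^ n * b ^ n))) =
      algebraMap K _ (((q ^ 2) ^ t) ^ (k + 1)) * ((a ^ n) ^ (k + 1) * (b ^ n) ^ (k + 1)) :=
    fun a b => by
      rw [coeff_C_mul, geomSeries, coeff_mk, ← pow_succ', smul_pow, mul_pow, Algebra.smul_def]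
  simp only [map_sum, map_add, map_neg, hp]
  simp only [Finset.sum_add_distrib, Finset.sum_neg_distrib, ← Finset.mul_sum, ← Finset.sum_mul]
  ring

variable {n q x y z w}

theorem isEval_omegaSeries {Γ : Type*} [AddCommMonoid Γ] [TopologicalSpace K] [DiscreteTopology K]
    {d : σ → Γ} {η θ : Γ} (hn : 0 < n) (hη : Function.Injective fun j : ℕ => j • (n • η + n • θ))
    (hx : ∀ i, x i ∈ homSub d K η) (hy : ∀ i, y i ∈ homSub d K η)
    (hz : ∀ i, z i ∈ homSub d K θ) (hw : ∀ i, w i ∈ homSub d K θ)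
    (hx0 : ∀ i, MvPowerSeries.constantCoeff (x i) = 0)
    (hy0 : ∀ i, MvPowerSeries.constantCoeff (y i) = 0) :
    IsEval d (n • η + n • θ) (omegaSeries n q x y z w) (Omega n q x y z w) := by
  have hmem : ∀ (t : ℕ) {a b : MvPowerSeries σ K}, a ∈ homSub d K η → b ∈ homSub d K θ →
      (q ^ 2) ^ t • (a ^ n * b ^ n) ∈ homSub d K (n • η + n • θ) := fun t a b ha hb =>
    Submodule.smul_mem _ _ (mul_mem_homSub (pow_mem_homSub ha n) (pow_mem_homSub hb n))
  have h0 : ∀ (t : ℕ) {a b : MvPowerSeries σ K}, MvPowerSeries.constantCoeff a = 0 →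
      MvPowerSeries.constantCoeff ((q ^ 2) ^ t • (a ^ n * b ^ n)) = 0 := fun t a b ha => by
    rw [MvPowerSeries.constantCoeff_smul, map_mul, map_pow, ha, zero_pow hn.ne', zero_mul, smul_zero]
  refine IsEval.prod hη _ fun t _ => IsEval.prod hη _ fun i _ => IsEval.prod hη _ fun j _ => ?_
  refine ((isEval_one_sub (hmem t (hx i) (hw j))).mul hη
    (isEval_one_sub (hmem t (hy i) (hz j)))).mul hη ?_
  have h1 := (isEval_geomSeries (hmem t (hx i) (hz j)) (h0 t (hx0 i))).mul hη
    (isEval_geomSeries (hmem t (hy i) (hw j)) (h0 t (hy0 i)))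
  rwa [← MvPowerSeries.mul_inv_rev, mul_comm (1 - (q ^ 2) ^ t • (y i ^ n * w j ^ n))] at h1

end OmegaSeries

/-! ### The exponentials preserve charge. -/

section ChargeOverAlgebra

variable {K : Type*} [Field K] {n : ℕ} {q : K} (g : Twist n q) {R : Type*} [CommRing R]
  [Algebra K R]

variable (K R) in
/-- The operators which preserve the span of the diagrams of a given charge. -/
def chargePreserving (c : ℤ) : Submodule K (Module.End R (Maya →₀ R)) where
  carrier := {P | ∀ v ∈ Finsupp.supported R R (chargeSet c), P v ∈ Finsupp.supported R R (chargeSet c)}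
  zero_mem' _ _ := Submodule.zero_mem _
  add_mem' hP hQ v hv := Submodule.add_mem _ (hP v hv) (hQ v hv)
  smul_mem' a P hP v hv := by
    rw [← algebraMap_smul R a]
    exact Submodule.smul_mem _ _ (hP v hv)

theorem smul_annih_mem_chargePreserving (s : ℕ → R) (k : ℕ) (c : ℤ) :
    s k • annih g R k ∈ chargePreserving K R c := fun v hv => by
  refine Submodule.smul_mem _ _ (extendHom_mem_supported (fun A hA => ?_) hv)
  exact Submodule.smul_mem _ _ (lowerCur_charge g k (Finsupp.single_mem_supported K 1 hA))

theorem expAnnih_mem_supported (s : ℕ → R) (d : ℕ) {c : ℤ} {v : Maya →₀ R}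
    (hv : v ∈ Finsupp.supported R R (chargeSet c)) :
    expAnnih g s d v ∈ Finsupp.supported R R (chargeSet c) := by
  have h : expAnnih g s d ∈ chargePreserving K R c := by
    refine expCoeff_mem (F := fun _ => chargePreserving K R c) (c := fun k => s k • annih g R k)
      (fun v hv => hv) (fun i j P Q hP hQ => ?_) (fun i => ?_) d
    · exact fun v hv => hP _ (hQ v hv)
    · exact smul_annih_mem_chargePreserving g s i c
  exact h v hv

theorem exists_mem_chargeSet (A : Maya) : ∃ c, A ∈ chargeSet c := by
  obtain ⟨m, rfl⟩ := NormOrd.maya_surjective A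
  obtain ⟨N, c, h⟩ := m.1.exists_drop_eq_vac
  exact ⟨_, mem_chargeSet_of_drop (h N le_rfl).1⟩

variable [NeZero n] [CharZero K]

/-- A nonzero matrix entry from A to B is, by transposition, an entry of a lowering exponential from
B to A, and these preserve charge. -/
theorem expCreat_mem_supported (hq : q ≠ 0) (s : ℕ → R) (d : ℕ) {c : ℤ} {A : Maya}
    (hA : A ∈ chargeSet c) :
    expCreat g s d (Finsupp.single A 1) ∈ Finsupp.supported R R (chargeSet c) := by
  rw [Finsupp.mem_supported]
  intro B hB
  obtain ⟨c', hc'⟩ := exists_mem_chargeSet B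
  rw [Finset.mem_coe, Finsupp.mem_support_iff, ← (expAnnih_transpose g hq s d).apply_single] at hB
  have h := (Finsupp.mem_supported R _).mp
    (expAnnih_mem_supported g.dual s d (Finsupp.single_mem_supported R 1 hc'))
    (Finsupp.mem_support_iff.mpr hB)
  rwa [eq_of_mem_chargeSet hA h]

end ChargeOverAlgebra

/-! ### The Cauchy identity. -/

section Cauchy

variable {σ K : Type*} [Field K] [TopologicalSpace K] [DiscreteTopology K]

theorem ket_maya_injective (c : ℤ) : Function.Injective fun ν => (ket c ν).maya :=
  NormOrd.maya_injective.comp (ket_injective c)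

-- Diagrams of charge c are exactly the kets of partitions, so the finite sum over diagrams becomes
-- a sum over partitions.
omit [DiscreteTopology K] in
theorem hasSum_ket {c : ℤ} {v : Maya →₀ MvPowerSeries σ K}
    (hv : v ∈ Finsupp.supported (MvPowerSeries σ K) (MvPowerSeries σ K) (chargeSet c)) (f : Maya → MvPowerSeries σ K) :
    HasSum (fun ν => v (ket c ν).maya * f (ket c ν).maya) (v.sum fun A a => a * f A) := by
  refine ((ket_maya_injective c).hasSum_iff (f := fun A => v A * f A) fun A hA => ?_).mpr ?_
  · have : v A = 0 := by
      by_contra h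
      exact hA (exists_ket_eq ((Finsupp.mem_supported _ v).mp hv (Finsupp.mem_support_iff.mpr h)))
    rw [this, zero_mul]
  · refine hasSum_sum_of_ne_finset_zero fun A hA => ?_
    rw [Finsupp.notMem_support_iff.mp hA, zero_mul]

theorem end_apply_eq_sum {ι R : Type*} [CommRing R] (P : Module.End R (ι →₀ R)) (v : ι →₀ R)
    (j : ι) : P v j = v.sum fun i a => a * P (Finsupp.single i 1) j := by
  conv_lhs => rw [← Finsupp.sum_single v, Finsupp.sum, map_sum, Finsupp.finsetSum_apply]
  refine Finset.sum_congr rfl fun i _ => ?_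
  have : Finsupp.single i (v i) = v i • Finsupp.single i (1 : R) := by simp
  rw [this, map_smul]
  rfl

theorem dot_eq_sum {ι R : Type*} [CommRing R] (v w : ι →₀ R) :
    dot v w = v.sum fun i a => a * w i := by
  rw [dot, Finsupp.linearCombination_apply, Finsupp.sum, LinearMap.sum_apply]
  rfl

variable {n : ℕ} [NeZero n] [CharZero K] {q : K}

omit [DiscreteTopology K] in
theorem hasSum_superLLT_mul (g g' : Twist n q) (hq : q ≠ 0) (c : ℤ) (lam lam' mu mu' : YoungDiagram)
    {N M : ℕ} (x y : Fin N → MvPowerSeries σ K) (z w : Fin M → MvPowerSeries σ K) :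
    HasSum (fun p : ℕ × ℕ => superLLTPart g c lam mu x y p.1 * superLLTPart g' c lam' mu' z w p.2)
      (superLLT g c lam mu x y * superLLT g' c lam' mu' z w) := by
  obtain ⟨D, hD0, hD⟩ := superLLT_eq_sum g hq c lam x y
  obtain ⟨E, hE0, hE⟩ := superLLT_eq_sum g' hq c lam' z w
  rw [hD, hE, Finset.sum_mul_sum, ← Finset.sum_product']
  refine hasSum_sum_of_ne_finset_zero fun p hp => ?_
  rw [Finset.mem_product, Finset.mem_range, Finset.mem_range, not_and_or, not_lt, not_lt] at hp
  rcases hp with hp | hp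
  · rw [superLLTPart, hD0 _ hp, Finsupp.zero_apply, zero_mul]
  · rw [mul_comm, superLLTPart, hE0 _ hp, Finsupp.zero_apply, zero_mul]

/-- The degrees of the products of the graded pieces of index `d` and `e`. -/
def bidegree (n : ℕ) (p : ℕ × ℕ) : ℕ × ℕ :=
  p.1 • n • ((1, 0) : ℕ × ℕ) + p.2 • n • ((0, 1) : ℕ × ℕ)

omit [NeZero n] in
theorem bidegree_eq (p : ℕ × ℕ) : bidegree n p = (p.1 * n, p.2 * n) := by
  simp [bidegree]

theorem bidegree_injective : Function.Injective (bidegree n) := fun p p' h => by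
  have hn := NeZero.pos n
  rw [bidegree_eq, bidegree_eq, Prod.mk.injEq] at h
  exact Prod.ext (Nat.eq_of_mul_eq_mul_right hn h.1) (Nat.eq_of_mul_eq_mul_right hn h.2)

variable {N M : ℕ} {δ : σ → ℕ × ℕ} {x y : Fin N → MvPowerSeries σ K} {z w : Fin M → MvPowerSeries σ K}

omit [TopologicalSpace K] [DiscreteTopology K] [NeZero n] [CharZero K] in
theorem superLLTPart_mem_homSub (g : Twist n q) (c : ℤ) (lam mu : YoungDiagram) {η : ℕ × ℕ}
    (hx : ∀ i, x i ∈ homSub δ K η) (hy : ∀ i, y i ∈ homSub δ K η) (d : ℕ) :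
    superLLTPart g c lam mu x y d ∈ homSub δ K (d • n • η) := by
  have := expAnnih_mem_homOp g (powerSumCoeff_mem_homSub (n := n) hx hy) d 0
    (Finsupp.single (ket c lam).maya 1) (fun A => by
      classical
      rw [Finsupp.single_apply]
      split_ifs
      · exact one_mem_homSub
      · exact Submodule.zero_mem _) (ket c mu).maya
  rwa [add_zero] at this

omit [TopologicalSpace K] [DiscreteTopology K] [NeZero n] [CharZero K] in
theorem superLLTPart_mul_mem_homSub (g g' : Twist n q) (c : ℤ) (lam lam' mu mu' : YoungDiagram)
    (hx : ∀ i, x i ∈ homSub δ K (1, 0)) (hy : ∀ i, y i ∈ homSub δ K (1, 0))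
    (hz : ∀ i, z i ∈ homSub δ K (0, 1)) (hw : ∀ i, w i ∈ homSub δ K (0, 1)) (p : ℕ × ℕ) :
    superLLTPart g c lam mu x y p.1 * superLLTPart g' c lam' mu' z w p.2 ∈
      homSub δ K (bidegree n p) :=
  mul_mem_homSub (superLLTPart_mem_homSub g c lam mu hx hy p.1)
    (superLLTPart_mem_homSub g' c lam' mu' hz hw p.2)

omit [TopologicalSpace K] [DiscreteTopology K] [CharZero K] in
theorem finite_ket_support (c : ℤ) (v : Maya →₀ MvPowerSeries σ K) :
    {ν | v (ket c ν).maya ≠ 0}.Finite :=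
  (v.support.finite_toSet.preimage (ket_maya_injective c).injOn).subset fun _ hν =>
    Finsupp.mem_support_iff.mpr hν

/-- The graded pieces of the left-hand side of the Cauchy identity. -/
noncomputable def skewPart (g : Twist n q) (c : ℤ) (lam mu : YoungDiagram)
    (x y : Fin N → MvPowerSeries σ K) (z w : Fin M → MvPowerSeries σ K) (p : ℕ × ℕ) :
    MvPowerSeries σ K :=
  expCreat g (powerSumCoeff K n z w) p.2
    (expAnnih g (powerSumCoeff K n x y) p.1 (Finsupp.single (ket c lam).maya 1)) (ket c mu).maya

/-- The graded pieces of the right-hand side of the Cauchy identity. -/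
noncomputable def coskewPart (g : Twist n q) (c : ℤ) (lam mu : YoungDiagram)
    (x y : Fin N → MvPowerSeries σ K) (z w : Fin M → MvPowerSeries σ K) (p : ℕ × ℕ) :
    MvPowerSeries σ K :=
  expAnnih g (powerSumCoeff K n x y) p.1
    (expCreat g (powerSumCoeff K n z w) p.2 (Finsupp.single (ket c lam).maya 1)) (ket c mu).maya

-- Transposition turns the second factor into a creation exponential, and the sum over ν is the
-- insertion of a complete set of states.
omit [DiscreteTopology K] in
theorem hasSum_skewPart (hq : q ≠ 0) (g : Twist n q) (c : ℤ) (lam mu : YoungDiagram) (p : ℕ × ℕ) :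
    HasSum (fun ν => superLLTPart g c lam ν x y p.1 * superLLTPart g.dual c mu ν z w p.2)
      (skewPart g c lam mu x y z w p) := by
  have h := hasSum_ket (expAnnih_mem_supported g (powerSumCoeff K n x y) p.1
    (Finsupp.single_mem_supported _ 1 (ket_mem_chargeSet c lam)))
    fun B => expAnnih g.dual (powerSumCoeff K n z w) p.2 (Finsupp.single (ket c mu).maya 1) B
  rwa [← dot_eq_sum, dot_comm, expAnnih_transpose g hq, dot_single_left, one_mul] at h

omit [DiscreteTopology K] in
theorem hasSum_coskewPart (hq : q ≠ 0) (g : Twist n q) (c : ℤ) (lam mu : YoungDiagram)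
    (p : ℕ × ℕ) :
    HasSum (fun ν => superLLTPart g c ν mu x y p.1 * superLLTPart g.dual c ν lam z w p.2)
      (coskewPart g c lam mu x y z w p) := by
  have h := hasSum_ket (expCreat_mem_supported g hq (powerSumCoeff K n z w) p.2
    (ket_mem_chargeSet c lam))
    fun B => expAnnih g (powerSumCoeff K n x y) p.1 (Finsupp.single B 1) (ket c mu).maya
  rw [← end_apply_eq_sum] at h
  convert h using 2 with ν
  · rw [mul_comm, ← (expAnnih_transpose g hq _ p.2).apply_single]
    rfl
  · rfl

/-- The family indexed by ν and the bidegree is summable, since a fixed bidegree involves finitely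
many ν; summing it in the two orders gives the two sums. -/
theorem exists_hasSum_skewPart (hq : q ≠ 0) (g : Twist n q) (c : ℤ) (lam mu : YoungDiagram)
    (hx : ∀ i, x i ∈ homSub δ K (1, 0)) (hy : ∀ i, y i ∈ homSub δ K (1, 0))
    (hz : ∀ i, z i ∈ homSub δ K (0, 1)) (hw : ∀ i, w i ∈ homSub δ K (0, 1)) :
    ∃ S, HasSum (fun ν => superLLT g c lam ν x y * superLLT g.dual c mu ν z w) S ∧
      HasSum (skewPart g c lam mu x y z w) S := by
  have hF : Summable fun p : YoungDiagram × (ℕ × ℕ) =>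
      superLLTPart g c lam p.1 x y p.2.1 * superLLTPart g.dual c mu p.1 z w p.2.2 := by
    refine summable_of_mem_homSub (w := δ) bidegree_injective
      (fun ν p => superLLTPart_mul_mem_homSub g g.dual c lam mu ν ν hx hy hz hw p) fun p => ?_
    exact (finite_ket_support c (expAnnih g (powerSumCoeff K n x y) p.1
      (Finsupp.single (ket c lam).maya 1))).subset fun ν hν h0 => hν (mul_eq_zero_of_left h0 _)
  exact exists_hasSum_fiberwise hF
    (fun ν => hasSum_superLLT_mul g g.dual hq c lam mu ν ν x y z w)
    (hasSum_skewPart hq g c lam mu)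

theorem exists_hasSum_coskewPart (hq : q ≠ 0) (g : Twist n q) (c : ℤ) (lam mu : YoungDiagram)
    (hx : ∀ i, x i ∈ homSub δ K (1, 0)) (hy : ∀ i, y i ∈ homSub δ K (1, 0))
    (hz : ∀ i, z i ∈ homSub δ K (0, 1)) (hw : ∀ i, w i ∈ homSub δ K (0, 1)) :
    ∃ T, HasSum (fun ν => superLLT g c ν mu x y * superLLT g.dual c ν lam z w) T ∧
      HasSum (coskewPart g c lam mu x y z w) T := by
  have hF : Summable fun p : YoungDiagram × (ℕ × ℕ) =>
      superLLTPart g c p.1 mu x y p.2.1 * superLLTPart g.dual c p.1 lam z w p.2.2 := by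
    refine summable_of_mem_homSub (w := δ) bidegree_injective
      (fun ν p => superLLTPart_mul_mem_homSub g g.dual c ν ν mu lam hx hy hz hw p) fun p => ?_
    refine (finite_ket_support c (expCreat g (powerSumCoeff K n z w) p.2
      (Finsupp.single (ket c lam).maya 1))).subset fun ν hν h0 => hν ?_
    exact mul_eq_zero_of_right _ (((expAnnih_transpose g hq _ p.2).apply_single _ _).trans h0)
  exact exists_hasSum_fiberwise hF
    (fun ν => hasSum_superLLT_mul g g.dual hq c ν ν mu lam x y z w)
    (hasSum_coskewPart hq g c lam mu)

theorem skewPart_mem_homSub (hq : q ≠ 0) (g : Twist n q) (c : ℤ) (lam mu : YoungDiagram)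
    (hx : ∀ i, x i ∈ homSub δ K (1, 0)) (hy : ∀ i, y i ∈ homSub δ K (1, 0))
    (hz : ∀ i, z i ∈ homSub δ K (0, 1)) (hw : ∀ i, w i ∈ homSub δ K (0, 1)) (p : ℕ × ℕ) :
    skewPart g c lam mu x y z w p ∈ homSub δ K (bidegree n p) := fun m hm => by
  have h := MvPowerSeries.WithPiTopology.hasSum_iff_hasSum_coeff.mp
    (hasSum_skewPart (x := x) (y := y) (z := z) (w := w) hq g c lam mu p) m
  by_contra hne
  refine hm (h.unique ?_)
  convert hasSum_zero with ν
  by_contra h0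
  exact hne (superLLTPart_mul_mem_homSub g g.dual c lam mu ν ν hx hy hz hw p m h0)

-- The exchange relation of the exponentials, read as an identity of matrix elements in one
-- bidegree.
omit [TopologicalSpace K] [DiscreteTopology K] in
theorem coskewPart_eq_sum (hq : q ≠ 0) (g : Twist n q) (c : ℤ) (lam mu : YoungDiagram)
    (p : ℕ × ℕ) : coskewPart g c lam mu x y z w p = ∑ j ∈ Finset.range (min p.1 p.2 + 1),
      PowerSeries.coeff j (omegaSeries n q x y z w) *
        skewPart g c lam mu x y z w (p.1 - j, p.2 - j) := by
  have hex := expAnnih_mul_expCreat (R := MvPowerSeries σ K) g hq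
    (a := powerSumCoeff K n x y) (b := powerSumCoeff K n z w)
    (ω := fun j => PowerSeries.coeff j (omegaSeries n q x y z w))
    (coeff_zero_omegaSeries n q x y z w) (coeff_succ_omegaSeries n q x y z w) p.1 p.2
  have h := DFunLike.congr_fun
    (DFunLike.congr_fun hex (Finsupp.single (ket c lam).maya 1)) (ket c mu).maya
  rw [LinearMap.sum_apply, Finsupp.finsetSum_apply] at h
  exact h

/-- The pairs of a number `j` and a pair of degrees which add up to given degrees. -/
def shiftFiber (k : ℕ × ℕ) : Finset (ℕ × (ℕ × ℕ)) :=
  (Finset.range (min k.1 k.2 + 1)).image fun j => (j, (k.1 - j, k.2 - j))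

theorem mem_shiftFiber (k : ℕ × ℕ) (p : ℕ × (ℕ × ℕ)) :
    p ∈ shiftFiber k ↔ (p.2.1 + p.1, p.2.2 + p.1) = k := by
  obtain ⟨j, d, e⟩ := p
  obtain ⟨k, l⟩ := k
  simp only [shiftFiber, Finset.mem_image, Finset.mem_range, Prod.mk.injEq]
  constructor
  · rintro ⟨i, hi, rfl, rfl, rfl⟩
    omega
  · rintro ⟨rfl, rfl⟩
    exact ⟨j, by omega, rfl, by omega, by omega⟩

theorem sum_shiftFiber {R : Type*} [AddCommMonoid R] (f : ℕ × (ℕ × ℕ) → R) (k : ℕ × ℕ) :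
    ∑ p ∈ shiftFiber k, f p =
      ∑ j ∈ Finset.range (min k.1 k.2 + 1), f (j, (k.1 - j, k.2 - j)) :=
  Finset.sum_image fun _ _ _ _ h => congrArg Prod.fst h

/-- The coefficient of index j of the Ω series has bidegree (jn, jn), so the product of the two sums
regroups by bidegree into exactly the convolution of `coskewPart_eq_sum`. -/
theorem hasSum_coskewPart_of_skewPart (hq : q ≠ 0) (g : Twist n q) (c : ℤ) (lam mu : YoungDiagram)
    (hx : ∀ i, x i ∈ homSub δ K (1, 0)) (hy : ∀ i, y i ∈ homSub δ K (1, 0))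
    (hz : ∀ i, z i ∈ homSub δ K (0, 1)) (hw : ∀ i, w i ∈ homSub δ K (0, 1))
    (hx0 : ∀ i, MvPowerSeries.constantCoeff (x i) = 0)
    (hy0 : ∀ i, MvPowerSeries.constantCoeff (y i) = 0) {S : MvPowerSeries σ K}
    (hS : HasSum (skewPart g c lam mu x y z w) S) :
    HasSum (coskewPart g c lam mu x y z w) (Omega n q x y z w * S) := by
  have hn := NeZero.pos n
  have hη : Function.Injective fun j : ℕ =>
      j • (n • ((1, 0) : ℕ × ℕ) + n • ((0, 1) : ℕ × ℕ)) := fun j j' h => by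
    have h1 := congrArg Prod.fst h
    simp only [Prod.smul_mk, smul_eq_mul, mul_one, mul_zero, Prod.mk_add_mk, add_zero] at h1
    exact Nat.eq_of_mul_eq_mul_right hn h1
  have hω := isEval_omegaSeries (q := q) hn hη hx hy hz hw hx0 hy0
  have h := hasSum_mul_fiberwise hω.2 hS (bidegree_injective (n := n)) mem_shiftFiber fun p => by
    have h2 := mul_mem_homSub (hω.1 p.1) (skewPart_mem_homSub hq g c lam mu hx hy hz hw p.2)
    have h3 : p.1 • (n • ((1, 0) : ℕ × ℕ) + n • ((0, 1) : ℕ × ℕ)) + bidegree n p.2 =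
        bidegree n (p.2.1 + p.1, p.2.2 + p.1) := by
      simp only [bidegree, add_smul, smul_add]
      abel
    rwa [h3] at h2
  simp only [sum_shiftFiber] at h
  rw [funext fun k => coskewPart_eq_sum (x := x) (y := y) (z := z) (w := w) hq g c lam mu k]
  exact h

/-- The Cauchy identity for power series graded by two degrees, one for `x, y` and one for
`z, w`. -/
theorem cauchy_identity (hq : q ≠ 0) (g : Twist n q) (c : ℤ) (lam mu : YoungDiagram)
    (hx : ∀ i, x i ∈ homSub δ K (1, 0)) (hy : ∀ i, y i ∈ homSub δ K (1, 0))
    (hz : ∀ i, z i ∈ homSub δ K (0, 1)) (hw : ∀ i, w i ∈ homSub δ K (0, 1))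
    (hx0 : ∀ i, MvPowerSeries.constantCoeff (x i) = 0)
    (hy0 : ∀ i, MvPowerSeries.constantCoeff (y i) = 0) :
    ∃ S T : MvPowerSeries σ K,
      HasSum (fun ν => superLLT g c lam ν x y * superLLT g.dual c mu ν z w) S ∧
      HasSum (fun ν => superLLT g c ν mu x y * superLLT g.dual c ν lam z w) T ∧
      Omega n q x y z w * S = T := by
  obtain ⟨S, hS, hS'⟩ := exists_hasSum_skewPart hq g c lam mu hx hy hz hw
  obtain ⟨T, hT, hT'⟩ := exists_hasSum_coskewPart hq g c lam mu hx hy hz hw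
  exact ⟨S, T, hS, hT,
    (hasSum_coskewPart_of_skewPart hq g c lam mu hx hy hz hw hx0 hy0 hS').unique hT'⟩

end Cauchy

end LLT

/-- The supersymmetric LLT Cauchy identity, as an identity of formal power series in the variables
`x, y, z, w`. For `g = Twist.untwisted n q`, and for every twist with `g (-a) = g a`, one has
`g.dual = g`, so that both factors are the same family of polynomials. -/
theorem mainTheorem6 {K : Type*} [Field K] [CharZero K] [TopologicalSpace K] [DiscreteTopology K]
    (n : ℕ) (hn : 1 ≤ n) (q : K) (hq : q ≠ 0) (g : LLT.Twist n q) (N M : ℕ) (c : ℤ)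
    (lam mu : YoungDiagram) :
    let V := (Fin N ⊕ Fin N) ⊕ (Fin M ⊕ Fin M)
    let x : Fin N → MvPowerSeries V K := fun i => MvPowerSeries.X (Sum.inl (Sum.inl i))
    let y : Fin N → MvPowerSeries V K := fun i => MvPowerSeries.X (Sum.inl (Sum.inr i))
    let z : Fin M → MvPowerSeries V K := fun j => MvPowerSeries.X (Sum.inr (Sum.inl j))
    let w : Fin M → MvPowerSeries V K := fun j => MvPowerSeries.X (Sum.inr (Sum.inr j))
    ∃ S T : MvPowerSeries V K,
      HasSum (fun nu : YoungDiagram =>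
        LLT.superLLT g c lam nu x y * LLT.superLLT g.dual c mu nu z w) S ∧
      HasSum (fun nu : YoungDiagram =>
        LLT.superLLT g c nu mu x y * LLT.superLLT g.dual c nu lam z w) T ∧
      LLT.Omega n q x y z w * S = T := by
  intro V x y z w
  have : NeZero n := ⟨by omega⟩
  -- The bidegree: x and y have degree (1, 0), z and w have degree (0, 1).
  let δ : V → ℕ × ℕ := Sum.elim (fun _ => (1, 0)) (fun _ => (0, 1))
  exact LLT.cauchy_identity (δ := δ) hq g c lam mu (fun i => LLT.X_mem_homSub _)
    (fun i => LLT.X_mem_homSub _) (fun j => LLT.X_mem_homSub _) (fun j => LLT.X_mem_homSub _)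
    (fun i => MvPowerSeries.constantCoeff_X _) (fun i => MvPowerSeries.constantCoeff_X _)
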